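/- Let $p,q\in\mathbb{C}^*$ with $|p|,|q|<1$, let $\sqrt{pq}$ be either square root of $pq$, and put $$(z;p)_\infty=\prod_{j\ge0}(1-zp^j),\qquad \Gamma(z)=\prod_{j,k\ge 0}\frac{1-z^{-1}p^{j+1}q^{k+1}}{1-zp^jq^k},$$ with the usual conventions $\Gamma(a,b)=\Gamma(a)\Gamma(b)$, $\Gamma(z^{\pm2})=\Gamma(z^2)\Gamma(z^{-2})$, $\Gamma(ax^{\pm1}y^{\pm1})=\Gamma(axy)\Gamma(axy^{-1})\Gamma(ax^{-1}y)\Gamma(ax^{-1}y^{-1})$. Put $D(s;u,w)=\Gamma(\sqrt{pq}\,s^{-1}u^{\pm1}w^{\pm1})$. A contour is a piecewise $C^1$ closed curve in $\mathbb{C}^*$ with winding number $1$ about $0$. It separates a set $S\subset\mathbb C^*$ from its reciprocals if, for every $a\in S$, neither $a$ nor $a^{-1}$ is on the curve and the winding numbers about $a$ and $a^{-1}$ are $1$ and $0$. (The positively oriented unit circle $\mathbb{T}$ separates $S$ from its reciprocals if $|a|<1$ for all $a\in S$.) Write $[a]=\{a\,p^jq^k: j,k\ge0\}$. The operator $$M(t)_{wz}f(z)=\frac{(p;p)_\infty(q;q)_\infty}{4\pi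 i}\int_C\frac{\Gamma(tw^{\pm1}z^{\pm1})}{\Gamma(t^2,z^{\pm2})}f(z)\frac{dz}{z}$$ over a contour $C$ is defined at $w$ if $C$ separates $[tw]\cup[tw^{-1}]$ from its reciprocals and $t^2\ne p^{j+1}q^{k+1}$ for all $j,k\ge0$ (for $C=\mathbb{T}$ and $t,w\in\mathbb{C}^*$ the separation condition holds if $|tw^{\pm1}|<1$). Functions $\alpha(z,t)$, integrable along $C$, and $\beta(w,t)$ form an elliptic integral Bailey pair with respect to $t$, over $C$ and for $w\in W$, if for all $w\in W$ the operator $M(t)_{wz}$ over $C$ is defined at $w$ and $\beta(w,t)=M(t)_{wz}\alpha(z,t)$. Theorem. Let $s,t,u\in\mathbb{C}$ and let $C,C'$ be closed curves as above such that $C'$ separates $[\sqrt{pq}(st)^{-1}u]\cup[\sqrt{pq}(st)^{-1}u^{-1}]$ and, for every $z\in C$, $[tz]\cup[tz^{-1}]$ from their reciprocals. (For $C=C'=\mathbb{T}$ and nonzero parameters these conditions hold if $|t|<1$ and $|\sqrt{pq}\,u^{\pm1}|<|st|$.) Let $\alpha(z,t),\beta(w,t)$ form an elliptic integral Bailey pair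 with respect to $t$, over $C$ and for $w\in C'$. Then the functions $$\alpha'(w,st)=D(s;u,w)\alpha(w,t),\qquad \beta'(w,st)=D(t^{-1};u,w)\,M(s)_{wx}\,D(st;u,x)\beta(x,t),$$ with $M(s)$ taken over $C'$, form an elliptic integral Bailey pair with respect to $st$, over $C$ and for all $w$ at which $\beta'$ is defined, that is, at which $M(s)_{wx}$ over $C'$ is defined and $D(t^{-1};u,w)$ has no pole. Moreover, $D(s;u,w)D(s^{-1};u,w)=1$ for all $s,u,w\in\mathbb{C}^*$ such that neither factor has a pole. -/

import Mathlib

noncomputable section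

namespace EllipticBailey

/-- The infinite product `(z; p)_∞ = ∏_{j ≥ 0} (1 - z p^j)`. -/
def qPoch (z p : ℂ) : ℂ := ∏' j : ℕ, (1 - z * p ^ j)

/-- The elliptic gamma function
`Γ(z; p, q) = ∏_{j, k ≥ 0} (1 - z⁻¹ p^(j+1) q^(k+1)) / (1 - z p^j q^k)`. -/
def ellGamma (p q z : ℂ) : ℂ :=
  ∏' n : ℕ × ℕ, (1 - z⁻¹ * p ^ (n.1 + 1) * q ^ (n.2 + 1)) / (1 - z * p ^ n.1 * q ^ n.2)

/-- `Γ(a x^{±1} y^{±1}; p, q)`, a product of four elliptic gamma functions. -/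
def ellGamma4 (p q a x y : ℂ) : ℂ :=
  ellGamma p q (a * x * y) * ellGamma p q (a * x * y⁻¹) *
    (ellGamma p q (a * x⁻¹ * y) * ellGamma p q (a * x⁻¹ * y⁻¹))

/-- A piecewise continuously differentiable closed curve, parametrized by `[0, 1]`. -/
structure Contour where
  /-- The parametrization; only its values on `[0, 1]` matter. -/
  toFun : ℝ → ℂ
  continuousOn : ContinuousOn toFun (Set.Icc 0 1)
  closed : toFun 0 = toFun 1
  piecewise_C1 : ∃ (P : Finset ℝ) (K : ℝ), ∀ θ ∈ Set.Ioo (0 : ℝ) 1, θ ∉ P →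
    DifferentiableAt ℝ toFun θ ∧ ContinuousAt (deriv toFun) θ ∧ ‖deriv toFun θ‖ ≤ K

namespace Contour

/-- The set of points on the curve. -/
def trace (C : Contour) : Set ℂ := C.toFun '' Set.Icc 0 1

/-- The contour integral `∫_C f(z) dz`. -/
def integral (C : Contour) (f : ℂ → ℂ) : ℂ :=
  ∫ θ in (0 : ℝ)..1, f (C.toFun θ) * deriv C.toFun θ

/-- `f` is integrable along `C`. -/
def Integrable (C : Contour) (f : ℂ → ℂ) : Prop :=
  IntervalIntegrable (fun θ => f (C.toFun θ) * deriv C.toFun θ) MeasureTheory.volume 0 1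

/-- The winding number of `C` about a point `a` that is not on `C`. -/
def winding (C : Contour) (a : ℂ) : ℂ :=
  (2 * Real.pi * Complex.I)⁻¹ * C.integral (fun z => (z - a)⁻¹)

/-- `C` encircles `a` once in the positive direction. -/
def Encloses (C : Contour) (a : ℂ) : Prop := a ∉ C.trace ∧ C.winding a = 1

/-- `C` leaves `a` outside. -/
def Excludes (C : Contour) (a : ℂ) : Prop := a ∉ C.trace ∧ C.winding a = 0

/-- `C` goes once around the origin and separates the points of `S`, which lie inside,
from their reciprocals, which lie outside. -/
def Separates (C : Contour) (S : Set ℂ) : Prop :=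
  C.Encloses 0 ∧ ∀ a ∈ S, C.Encloses a ∧ C.Excludes a⁻¹

end Contour

/-- The points `a x^{±1} p^j q^k`, `j, k ≥ 0`: the poles of `y ↦ Γ(a x^{±1} y^{±1}; p, q)` that
converge to zero. Their reciprocals are its remaining poles. -/
def poles (p q a x : ℂ) : Set ℂ :=
  {y | ∃ j k : ℕ, y = a * x * p ^ j * q ^ k ∨ y = a * x⁻¹ * p ^ j * q ^ k}

/-- `(M(t)_{wz} f)(w)`, where the variable `z` is integrated over the contour `C`. -/
def M (p q : ℂ) (C : Contour) (t : ℂ) (f : ℂ → ℂ) (w : ℂ) : ℂ :=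
  qPoch p p * qPoch q q / (4 * Real.pi * Complex.I) *
    C.integral (fun z =>
      ellGamma4 p q t w z /
        (ellGamma p q (t ^ 2) * (ellGamma p q (z ^ 2) * ellGamma p q ((z⁻¹) ^ 2))) * f z / z)

/-- `M(t)_{wz}` over the contour `C` is defined at `w`: the contour separates the sequence of poles
of the kernel that converges to zero from its reciprocals, and the denominator
`Γ(t²; p, q)` does not vanish. -/
def MDefined (p q : ℂ) (C : Contour) (t w : ℂ) : Prop :=
  C.Separates (poles p q t w) ∧ ∀ j k : ℕ, t ^ 2 ≠ p ^ (j + 1) * q ^ (k + 1)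

/-- `α` and `β` form an elliptic integral Bailey pair with respect to `t`, where `M(t)` is taken
over the contour `C` and `β` is considered on the set `W`: `β(w) = M(t)_{wz} α(z)` on `W`. -/
def IsBaileyPair (p q : ℂ) (C : Contour) (t : ℂ) (W : Set ℂ) (α β : ℂ → ℂ) : Prop :=
  C.Integrable α ∧ ∀ w ∈ W, MDefined p q C t w ∧ β w = M p q C t α w

/-- `D(s; u, w) = Γ(r s⁻¹ u^{±1} w^{±1}; p, q)`, where `r` is a square root of `p q`. -/
def D (p q r s u w : ℂ) : ℂ := ellGamma4 p q (r * s⁻¹) u w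

/-- `w` is not a pole of `w ↦ D(s; u, w)`. -/
def DDefined (p q r s u w : ℂ) : Prop :=
  w ∉ poles p q (r * s⁻¹) u ∧ w⁻¹ ∉ poles p q (r * s⁻¹) u

end EllipticBailey

end

/-!
The Bailey lemma reduces to Spiridonov's elliptic beta integral. Inserting the definition of `β`
into `M(s) D(st; u, ·) β` gives a double integral; after Fubini's theorem the inner integral has the
six parameters `s w^{±1}, √(pq) (st)⁻¹ u^{±1}, t z^{±1}` with product `pq`
(`betaKernel_baileyParams`), and its value is a product of gamma functions that is rearranged by the
reflection formula `Γ(x) Γ(pq / x) = 1` (`betaValue_baileyParams`, `D_mul_D_inv`). That `C`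
separates the poles of the kernel of `M(st)` follows by computing winding numbers, again with
Fubini's theorem (`Contour.winding_mul`, `Contour.winding_inv_mul`).

The elliptic beta integral itself (`Cycle.Separates.integral_betaKernel`) is proved from scratch.

* Write `ρ` for the ratio of the integral over the unit circle and the product of gamma functions. A
  theta function identity (`theta_identity`) shows that a combination of two shifted integrands is,
  up to a factor, `F(z) + F(z⁻¹)` with `F = shiftIntegrand` holomorphic for `1 ≤ |z| ≤ |q|⁻¹` and
  `F(q⁻¹ z) = -F(z⁻¹)`, so that its integral vanishes. Hence `ρ` does not change when `(a, q b)` is replaced by `(q a, b)`.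
* Keep the product of two parameters `x`, `T / x` fixed. Then `ρ` is holomorphic in the annulus
  `|T| < |x| < 1` and invariant under `x ↦ q x`, hence attains its maximum modulus and is constant
  (`betaRatio_eq_of_mul_eq`).
* Such moves lead to parameters `i x, -i x, ∗, y, y, y`. As `x → 1` the contour is pinched at `± i`,
  and the residues at these points give the constant value of `ρ`
  (`PinchRadius.tendsto_betaRatio`, `SmallParams.betaRatio_eq`).
* For a general contour the parameters are moved along a one-parameter family. By the homology form
  of Cauchy's theorem (`Cycle.integral_eq_zero`) all cycles that separate the poles from their
  reciprocals give the same integral, and both sides are holomorphic in the position on the family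
  outside of a countable closed set, which does not disconnect the plane.
-/

noncomputable section

namespace EllipticBailey

open Filter Topology

/-! ### Infinite products -/

/-- The double product `∏_{j, k ≥ 0} (1 - x p^j q^k)`. -/
def dPoch (p q x : ℂ) : ℂ := ∏' n : ℕ × ℕ, (1 - x * p ^ n.1 * q ^ n.2)

/-- The theta function `θ(x; p) = (x; p)_∞ (p / x; p)_∞`. -/
def theta (p x : ℂ) : ℂ := qPoch x p * qPoch (p / x) p

/-- The holomorphic function on `ℂ \ {0}` that extends `1 / (Γ(x) Γ(x⁻¹))`. -/
def weight (p q x : ℂ) : ℂ :=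
  qPoch x p * qPoch (q * x) q * (qPoch x⁻¹ p * qPoch (q * x⁻¹) q)

variable {p q : ℂ}

lemma summable_pow_mul_pow (hp : ‖p‖ < 1) (hq : ‖q‖ < 1) :
    Summable fun n : ℕ × ℕ => ‖p ^ n.1 * q ^ n.2‖ := by
  have := (summable_geometric_of_lt_one (norm_nonneg p) hp).mul_of_nonneg
    (summable_geometric_of_lt_one (norm_nonneg q) hq) (fun _ => by positivity)
    (fun _ => by positivity)
  simpa [norm_mul, norm_pow] using this

lemma summable_dPoch (hp : ‖p‖ < 1) (hq : ‖q‖ < 1) (x : ℂ) :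
    Summable fun n : ℕ × ℕ => ‖-(x * p ^ n.1 * q ^ n.2)‖ := by
  have := (summable_pow_mul_pow hp hq).mul_left ‖x‖
  simpa [norm_mul, mul_assoc] using this

lemma multipliable_dPoch (hp : ‖p‖ < 1) (hq : ‖q‖ < 1) (x : ℂ) :
    Multipliable fun n : ℕ × ℕ => (1 - x * p ^ n.1 * q ^ n.2) := by
  simpa [sub_eq_add_neg] using multipliable_one_add_of_summable (summable_dPoch hp hq x)

lemma summable_qPoch (hp : ‖p‖ < 1) (x : ℂ) : Summable fun n : ℕ => ‖-(x * p ^ n)‖ := by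
  have := (summable_geometric_of_lt_one (norm_nonneg p) hp).mul_left ‖x‖
  simpa [norm_mul, norm_pow] using this

lemma multipliable_qPoch (hp : ‖p‖ < 1) (x : ℂ) :
    Multipliable fun n : ℕ => (1 - x * p ^ n) := by
  simpa [sub_eq_add_neg] using multipliable_one_add_of_summable (summable_qPoch hp x)

lemma dPoch_eq_zero_iff (hp : ‖p‖ < 1) (hq : ‖q‖ < 1) {x : ℂ} :
    dPoch p q x = 0 ↔ ∃ j k : ℕ, x * p ^ j * q ^ k = 1 := by
  constructor
  · intro h
    by_contra! hne
    have := tprod_one_add_ne_zero_of_summable (f := fun n : ℕ × ℕ => -(x * p ^ n.1 * q ^ n.2))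
      (fun n => by
        rw [← sub_eq_add_neg, sub_ne_zero]; exact (hne n.1 n.2).symm) (summable_dPoch hp hq x)
    simp only [← sub_eq_add_neg] at this
    exact this h
  · rintro ⟨j, k, h⟩
    exact tprod_of_exists_eq_zero ⟨(j, k), by simp [h]⟩

lemma qPoch_eq_zero_iff (hp : ‖p‖ < 1) {x : ℂ} :
    qPoch x p = 0 ↔ ∃ j : ℕ, x * p ^ j = 1 := by
  constructor
  · intro h
    by_contra! hne
    have := tprod_one_add_ne_zero_of_summable (f := fun n : ℕ => -(x * p ^ n))
      (fun n => by
        rw [← sub_eq_add_neg, sub_ne_zero]; exact (hne n).symm) (summable_qPoch hp x)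
    simp only [← sub_eq_add_neg] at this
    exact this h
  · rintro ⟨j, h⟩
    exact tprod_of_exists_eq_zero ⟨j, by simp [h]⟩

lemma dPoch_ne_zero_of_norm_lt (hp : ‖p‖ < 1) (hq : ‖q‖ < 1) {x : ℂ} (hx : ‖x‖ < 1) :
    dPoch p q x ≠ 0 := by
  rw [Ne, dPoch_eq_zero_iff hp hq]
  rintro ⟨j, k, h⟩
  have h1 : ‖x * p ^ j * q ^ k‖ < 1 := by
    rw [norm_mul, norm_mul, norm_pow, norm_pow, mul_assoc]
    have h2 : ‖p‖ ^ j * ‖q‖ ^ k ≤ 1 :=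
      mul_le_one₀ (pow_le_one₀ (norm_nonneg _) hp.le) (by positivity)
        (pow_le_one₀ (norm_nonneg _) hq.le)
    calc ‖x‖ * (‖p‖ ^ j * ‖q‖ ^ k) ≤ ‖x‖ * 1 := by gcongr
      _ < 1 := by simpa using hx
  rw [h] at h1; simp at h1

lemma qPoch_ne_zero_of_norm_lt (hp : ‖p‖ < 1) {x : ℂ} (hx : ‖x‖ < 1) : qPoch x p ≠ 0 := by
  rw [Ne, qPoch_eq_zero_iff hp]
  rintro ⟨j, h⟩
  have h1 : ‖x * p ^ j‖ < 1 := by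
    rw [norm_mul, norm_pow]
    calc ‖x‖ * ‖p‖ ^ j ≤ ‖x‖ * 1 := by
          gcongr; exact pow_le_one₀ (norm_nonneg _) hp.le
      _ < 1 := by simpa using hx
  rw [h] at h1; simp at h1

/-- An infinite product `∏ (1 - x cᵢ)` with summable coefficients is an entire function of `x`. -/
lemma differentiable_tprod_one_sub {ι : Type*} [Countable ι] {c : ι → ℂ}
    (hc : Summable fun i => ‖c i‖) : Differentiable ℂ fun x => ∏' i, (1 - x * c i) := by
  intro x
  have hb : ∀ᶠ i in cofinite, ∀ y ∈ Metric.ball (0 : ℂ) (‖x‖ + 1),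
      ‖-(y * c i)‖ ≤ (‖x‖ + 1) * ‖c i‖ := by
    refine Eventually.of_forall fun i y hy => ?_
    rw [norm_neg, norm_mul]
    gcongr
    simpa using (mem_ball_zero_iff.1 hy).le
  have h := Summable.hasProdLocallyUniformlyOn_one_add (f := fun i (y : ℂ) => -(y * c i))
    Metric.isOpen_ball (hc.mul_left (‖x‖ + 1)) hb (fun i => by fun_prop)
  have h2 : DifferentiableOn ℂ (fun y => ∏' i, (1 + -(y * c i))) (Metric.ball 0 (‖x‖ + 1)) := by
    refine TendstoLocallyUniformlyOn.differentiableOn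
      (hasProdLocallyUniformlyOn_iff_tendstoLocallyUniformlyOn.1 h)
      (Eventually.of_forall fun s => ?_) Metric.isOpen_ball
    fun_prop
  simp only [← sub_eq_add_neg] at h2
  exact h2.differentiableAt (Metric.isOpen_ball.mem_nhds (by simp))

lemma differentiable_dPoch (hp : ‖p‖ < 1) (hq : ‖q‖ < 1) : Differentiable ℂ (dPoch p q) := by
  have := differentiable_tprod_one_sub (summable_pow_mul_pow hp hq)
  simp only [← mul_assoc] at this
  exact this

lemma differentiable_qPoch (hp : ‖p‖ < 1) : Differentiable ℂ fun x => qPoch x p := by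
  refine differentiable_tprod_one_sub (c := fun n : ℕ => p ^ n) ?_
  simpa using summable_geometric_of_lt_one (norm_nonneg p) hp

lemma qPoch_eq_mul (hp : ‖p‖ < 1) (x : ℂ) : qPoch x p = (1 - x) * qPoch (p * x) p := by
  unfold qPoch
  rw [tprod_eq_zero_mul']
  · congr 1
    · simp
    · congr 1; ext n; ring
  · have := multipliable_qPoch hp (p * x)
    convert this using 2 with n
    ring

lemma dPoch_comm (x : ℂ) : dPoch p q x = dPoch q p x := by
  unfold dPoch
  rw [← (Equiv.prodComm ℕ ℕ).tprod_eq]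
  congr 1; ext n
  simp; ring

lemma dPoch_eq_mul (hp : ‖p‖ < 1) (hq : ‖q‖ < 1) (x : ℂ) :
    dPoch p q x = qPoch x q * dPoch p q (p * x) := by
  have h1 : dPoch p q x = ∏' j : ℕ, qPoch (x * p ^ j) q := by
    unfold dPoch qPoch
    exact (multipliable_dPoch hp hq x).tprod_prod' (fun j => multipliable_qPoch hq (x * p ^ j))
  have h2 : ∀ y, Multipliable fun j : ℕ => qPoch (y * p ^ j) q := by
    intro y
    have := (multipliable_dPoch hp hq y).hasProd.prod_fiberwise
      (fun j => (multipliable_qPoch hq (y * p ^ j)).hasProd)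
    exact this.multipliable
  have h3 : dPoch p q (p * x) = ∏' j : ℕ, qPoch (p * x * p ^ j) q := by
    unfold dPoch qPoch
    exact (multipliable_dPoch hp hq _).tprod_prod'
      (fun j => multipliable_qPoch hq (p * x * p ^ j))
  rw [h1, h3, tprod_eq_zero_mul']
  · simp only [pow_zero, mul_one]
    congr 2; ext n; congr 1; ring
  · have := h2 (p * x)
    convert this using 3 with n
    ring

lemma dPoch_eq_mul' (hp : ‖p‖ < 1) (hq : ‖q‖ < 1) (x : ℂ) :
    dPoch p q x = qPoch x p * dPoch p q (q * x) := by
  rw [dPoch_comm, dPoch_eq_mul hq hp, dPoch_comm]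

/-- The double product with its first factors split off. -/
lemma dPoch_eq_qPoch_mul (hp : ‖p‖ < 1) (hq : ‖q‖ < 1) (x : ℂ) :
    dPoch p q x = qPoch x p * qPoch (q * x) q * dPoch p q (p * q * x) := by
  rw [dPoch_eq_mul' hp hq, dPoch_eq_mul hp hq (q * x)]; ring_nf

lemma ellGamma_eq (hp : ‖p‖ < 1) (hq : ‖q‖ < 1) (z : ℂ) :
    ellGamma p q z = dPoch p q (p * q / z) / dPoch p q z := by
  by_cases hz : ∃ j k : ℕ, z * p ^ j * q ^ k = 1
  · rw [(dPoch_eq_zero_iff hp hq).2 hz, div_zero]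
    obtain ⟨j, k, h⟩ := hz
    exact tprod_of_exists_eq_zero ⟨(j, k), by simp [h]⟩
  · have h0 : dPoch p q z ≠ 0 := fun h => hz ((dPoch_eq_zero_iff hp hq).1 h)
    unfold ellGamma dPoch
    rw [← Multipliable.tprod_div₀ (multipliable_dPoch hp hq _) (multipliable_dPoch hp hq _) h0]
    congr 1; ext n
    congr 2
    rw [pow_succ, pow_succ]; ring

/-- The reflection formula: `Γ(x) Γ(y) = 1` for `x y = p q` away from the poles. -/
lemma ellGamma_mul_ellGamma (hp : ‖p‖ < 1) (hq : ‖q‖ < 1) (hp0 : p ≠ 0) (hq0 : q ≠ 0) {x y : ℂ}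
    (hxy : x * y = p * q) (hx : dPoch p q x ≠ 0) (hy : dPoch p q y ≠ 0) :
    ellGamma p q x * ellGamma p q y = 1 := by
  have hx0 : x ≠ 0 := by rintro rfl; simp [hp0, hq0] at hxy; 
  have hy0 : y ≠ 0 := by rintro rfl; simp [hp0, hq0] at hxy; 
  rw [ellGamma_eq hp hq, ellGamma_eq hp hq, ← hxy, mul_div_cancel_left₀ _ hx0,
    mul_div_cancel_right₀ _ hy0]
  field_simp

lemma ellGamma_mul_left (hp : ‖p‖ < 1) (hq : ‖q‖ < 1) (hq0 : q ≠ 0) {x : ℂ}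
    (hx : qPoch x p ≠ 0) : ellGamma p q (q * x) = theta p x * ellGamma p q x := by
  rw [ellGamma_eq hp hq, ellGamma_eq hp hq, mul_comm p q, mul_div_mul_left _ _ hq0, theta,
    dPoch_eq_mul' hp hq x, dPoch_eq_mul' hp hq (p / x), ← mul_div_assoc, ← mul_div_assoc,
    mul_assoc (qPoch x p), mul_div_mul_left _ _ hx]

/-- `weight` is the reciprocal of `Γ(x) Γ(x⁻¹)` unless `x` or `x⁻¹` is of the form
`p^(j+1) q^(k+1)`. -/
lemma inv_ellGamma_mul (hp : ‖p‖ < 1) (hq : ‖q‖ < 1) {x : ℂ}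
    (h1 : dPoch p q (p * q * x) ≠ 0) (h2 : dPoch p q (p * q * x⁻¹) ≠ 0) :
    (ellGamma p q x * ellGamma p q x⁻¹)⁻¹ = weight p q x := by
  rw [ellGamma_eq hp hq, ellGamma_eq hp hq, dPoch_eq_qPoch_mul hp hq x,
    dPoch_eq_qPoch_mul hp hq x⁻¹, weight, div_eq_mul_inv (p * q), div_inv_eq_mul]
  rw [div_mul_div_comm, inv_div, div_eq_iff (mul_ne_zero h2 h1)]
  ring

lemma weight_eq_theta (hp : ‖p‖ < 1) (hq : ‖q‖ < 1) {x : ℂ} :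
    weight p q x = theta p x * theta q x⁻¹ := by
  rw [weight, theta, theta, qPoch_eq_mul hp x⁻¹, qPoch_eq_mul hq x⁻¹]
  simp only [div_eq_mul_inv, inv_inv]; ring

lemma theta_inv (hp : ‖p‖ < 1) {x : ℂ} (hx : x ≠ 0) : theta p x⁻¹ = -x⁻¹ * theta p x := by
  rw [theta, theta, qPoch_eq_mul hp x⁻¹, qPoch_eq_mul hp x]
  simp only [div_eq_mul_inv, inv_inv]; field_simp; ring

lemma theta_mul (hp : ‖p‖ < 1) (hp0 : p ≠ 0) {x : ℂ} (hx : x ≠ 0) :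
    theta p (p * x) = -x⁻¹ * theta p x := by
  rw [theta, theta, div_mul_cancel_left₀ hp0, qPoch_eq_mul hp x⁻¹, qPoch_eq_mul hp x]
  simp only [div_eq_mul_inv]; field_simp; ring

lemma differentiableOn_theta (hp : ‖p‖ < 1) : DifferentiableOn ℂ (theta p) {0}ᶜ := by
  have := differentiable_qPoch hp
  unfold theta
  refine (this.differentiableOn).mul (this.comp_differentiableOn ?_)
  exact (differentiableOn_const _).div differentiableOn_id fun x hx => hx

lemma theta_eq_zero_iff (hp : ‖p‖ < 1) (hp0 : p ≠ 0) {x : ℂ} (hx : x ≠ 0) :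
    theta p x = 0 ↔ ∃ n : ℤ, x = p ^ n := by
  rw [theta, mul_eq_zero, qPoch_eq_zero_iff hp, qPoch_eq_zero_iff hp]
  constructor
  · rintro (⟨j, h⟩ | ⟨j, h⟩)
    · refine ⟨-j, ?_⟩
      rw [zpow_neg, zpow_natCast]; exact eq_inv_of_mul_eq_one_left h
    · refine ⟨j + 1, ?_⟩
      rw [zpow_add₀ hp0, zpow_natCast, zpow_one]
      field_simp at h; rw [← h]; ring
  · rintro ⟨n, rfl⟩
    obtain ⟨j, rfl | rfl⟩ := n.eq_nat_or_neg
    · rcases j with _ | j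
      · left; exact ⟨0, by simp⟩
      · right; refine ⟨j, ?_⟩
        rw [zpow_natCast, pow_succ]; field_simp
    · left; refine ⟨j, ?_⟩
      rw [zpow_neg, zpow_natCast]; field_simp

open MeasureTheory Set

/-! ### Contour integrals -/

/-- An integral depends holomorphically on a parameter if the integrand does and is locally
uniformly dominated. -/
lemma differentiableAt_integral_of_dominated {X : Type*} [MeasurableSpace X] {μ : Measure X}
    {F : ℂ → X → ℂ} {z₀ : ℂ} {R : ℝ} (hR : 0 < R) {b : X → ℝ} (hb : Integrable b μ)
    (hmeas : ∀ z ∈ Metric.ball z₀ R, AEStronglyMeasurable (F z) μ)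
    (hbd : ∀ᵐ x ∂μ, ∀ z ∈ Metric.ball z₀ R, ‖F z x‖ ≤ b x)
    (hdiff : ∀ᵐ x ∂μ, DifferentiableOn ℂ (fun z => F z x) (Metric.ball z₀ R)) :
    DifferentiableAt ℂ (fun z => ∫ x, F z x ∂μ) z₀ := by
  have hball : Metric.ball z₀ R ∈ 𝓝 z₀ := Metric.ball_mem_nhds z₀ hR
  have hint : Integrable (F z₀) μ :=
    hb.mono' (hmeas z₀ (Metric.mem_ball_self hR))
      (hbd.mono fun x hx => hx z₀ (Metric.mem_ball_self hR))
  have hder : ∀ᵐ x ∂μ, ∀ z ∈ Metric.ball z₀ (R / 2),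
      HasDerivAt (fun z => F z x) (deriv (fun z => F z x) z) z := by
    filter_upwards [hdiff] with x hx z hz
    exact (hx.differentiableAt (Metric.isOpen_ball.mem_nhds
      (Metric.ball_subset_ball (by linarith) hz))).hasDerivAt
  have hF' : AEStronglyMeasurable (fun x => deriv (fun z => F z x) z₀) μ := by
    have hseq : Tendsto (fun n : ℕ => z₀ + (((R / 2 / (n + 1) : ℝ)) : ℂ)) atTop (𝓝[≠] z₀) := by
      rw [tendsto_nhdsWithin_iff]
      constructor
      · have h1 : Tendsto (fun n : ℕ => R / 2 / ((n : ℝ) + 1)) atTop (𝓝 0) :=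
          tendsto_const_div_atTop_nhds_zero_nat (R / 2) |>.comp (tendsto_add_atTop_nat 1)
            |>.congr fun n => by simp
        have h2 := (Complex.continuous_ofReal.tendsto 0).comp h1
        simpa using (tendsto_const_nhds (x := z₀)).add h2
      · refine Eventually.of_forall fun n => ?_
        simp only [mem_compl_iff, mem_singleton_iff, add_eq_left, Complex.ofReal_eq_zero]
        positivity
    refine aestronglyMeasurable_of_tendsto_ae atTop
      (f := fun (n : ℕ) x => slope (fun z => F z x) z₀ (z₀ + (((R / 2 / (n + 1) : ℝ)) : ℂ))) ?_ ?_
    · intro n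
      simp only [slope_def_field, div_eq_mul_inv _ (_ - _)]
      refine AEStronglyMeasurable.mul_const ((hmeas _ ?_).sub
        (hmeas _ (Metric.mem_ball_self hR))) _
      rw [Metric.mem_ball, dist_eq_norm, add_sub_cancel_left, Complex.norm_real, Real.norm_eq_abs,
        abs_of_pos (by positivity)]
      have : R / 2 / ((n : ℝ) + 1) ≤ R / 2 := div_le_self (by positivity) (by linarith [n.cast_nonneg (α := ℝ)])
      linarith
    · filter_upwards [hder] with x hx
      exact (hasDerivAt_iff_tendsto_slope.1 (hx z₀ (Metric.mem_ball_self (by positivity)))).comp hseq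
  refine (hasDerivAt_integral_of_dominated_loc_of_deriv_le (bound := fun x => b x / (R / 4))
    (F' := fun z x => deriv (fun z => F z x) z)
    (Metric.ball_mem_nhds z₀ (by positivity : 0 < R / 2)) ?_ hint hF' ?_
    (hb.div_const _) hder).2.differentiableAt
  · filter_upwards [hball] with z hz using hmeas z hz
  · filter_upwards [hbd, hdiff] with x hx1 hx2 z hz
    have hsub : Metric.closedBall z (R / 4) ⊆ Metric.ball z₀ R := by
      intro y hy
      rw [Metric.mem_ball] at hz ⊢
      rw [Metric.mem_closedBall] at hy
      linarith [dist_triangle y z z₀]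
    refine Complex.norm_deriv_le_of_forall_mem_sphere_norm_le (by positivity) ?_ ?_
    · refine DifferentiableOn.diffContOnCl ?_
      rw [closure_ball _ (by positivity)]
      exact hx2.mono hsub
    · exact fun y hy => hx1 y (hsub (Metric.sphere_subset_closedBall hy))

namespace Contour

lemma integral_eq (C : Contour) (f : ℂ → ℂ) :
    C.integral f = ∫ θ, f (C.toFun θ) * deriv C.toFun θ ∂(volume.restrict (Ioc (0 : ℝ) 1)) := by
  rw [integral, intervalIntegral.integral_of_le zero_le_one]

lemma mem_trace (C : Contour) {θ : ℝ} (hθ : θ ∈ Icc (0 : ℝ) 1) : C.toFun θ ∈ C.trace :=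
  ⟨θ, hθ, rfl⟩

lemma ae_mem_trace (C : Contour) :
    ∀ᵐ θ ∂(volume.restrict (Ioc (0 : ℝ) 1)), C.toFun θ ∈ C.trace := by
  filter_upwards [ae_restrict_mem measurableSet_Ioc] with θ hθ
  exact C.mem_trace (Ioc_subset_Icc_self hθ)

lemma trace_nonempty (C : Contour) : C.trace.Nonempty := ⟨_, C.mem_trace (left_mem_Icc.2 zero_le_one)⟩

lemma isCompact_trace (C : Contour) : IsCompact C.trace :=
  isCompact_Icc.image_of_continuousOn C.continuousOn

lemma isClosed_trace (C : Contour) : IsClosed C.trace := C.isCompact_trace.isClosed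

lemma exists_deriv_bound (C : Contour) :
    ∃ K : ℝ, 0 ≤ K ∧ ∀ᵐ θ ∂(volume.restrict (Ioc (0 : ℝ) 1)), ‖deriv C.toFun θ‖ ≤ K := by
  obtain ⟨P, K, h⟩ := C.piecewise_C1
  refine ⟨max K 0, le_max_right _ _, ?_⟩
  have h1 : ∀ᵐ θ : ℝ, θ ∉ (P : Set ℝ) ∪ {1} :=
    (P.countable_toSet.union (countable_singleton 1)).ae_notMem _
  filter_upwards [ae_restrict_mem measurableSet_Ioc, ae_restrict_of_ae h1] with θ hθ h2
  simp only [mem_union, Finset.mem_coe, mem_singleton_iff, not_or] at h2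
  exact (h θ ⟨hθ.1, lt_of_le_of_ne hθ.2 h2.2⟩ h2.1).2.2.trans (le_max_left _ _)

lemma aestronglyMeasurable_deriv (C : Contour) :
    AEStronglyMeasurable (deriv C.toFun) (volume.restrict (Ioc (0 : ℝ) 1)) :=
  (measurable_deriv _).aestronglyMeasurable

lemma aestronglyMeasurable_comp (C : Contour) {f : ℂ → ℂ} (hf : ContinuousOn f C.trace) :
    AEStronglyMeasurable (fun θ => f (C.toFun θ)) (volume.restrict (Ioc (0 : ℝ) 1)) := by
  refine ContinuousOn.aestronglyMeasurable (ContinuousOn.mono ?_ Ioc_subset_Icc_self)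
    measurableSet_Ioc
  exact hf.comp C.continuousOn fun θ hθ => C.mem_trace hθ

lemma integrable_iff (C : Contour) (f : ℂ → ℂ) :
    C.Integrable f ↔ MeasureTheory.Integrable (fun θ => f (C.toFun θ) * deriv C.toFun θ)
      (volume.restrict (Ioc (0 : ℝ) 1)) := by
  rw [Integrable, intervalIntegrable_iff_integrableOn_Ioc_of_le zero_le_one]; rfl

lemma integrable_of_continuousOn (C : Contour) {f : ℂ → ℂ} (hf : ContinuousOn f C.trace) :
    C.Integrable f := by
  rw [integrable_iff]
  obtain ⟨K, hK0, hK⟩ := C.exists_deriv_bound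
  obtain ⟨M, hM⟩ := C.isCompact_trace.exists_bound_of_continuousOn hf
  refine MeasureTheory.Integrable.mono' (integrable_const (M * K))
    ((C.aestronglyMeasurable_comp hf).mul C.aestronglyMeasurable_deriv) ?_
  filter_upwards [hK, C.ae_mem_trace] with θ h1 h2
  rw [norm_mul]
  exact mul_le_mul (hM _ h2) h1 (norm_nonneg _) ((norm_nonneg _).trans (hM _ h2))

lemma integral_congr (C : Contour) {f g : ℂ → ℂ} (h : ∀ z ∈ C.trace, f z = g z) :
    C.integral f = C.integral g := by
  rw [integral_eq, integral_eq]
  refine integral_congr_ae ?_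
  filter_upwards [C.ae_mem_trace] with θ hθ
  rw [h _ hθ]

lemma integral_sub (C : Contour) {f g : ℂ → ℂ} (hf : C.Integrable f) (hg : C.Integrable g) :
    C.integral (fun z => f z - g z) = C.integral f - C.integral g := by
  rw [integrable_iff] at hf hg
  rw [integral_eq, integral_eq, integral_eq, ← MeasureTheory.integral_sub hf hg]
  simp only [sub_mul]

lemma integral_const_mul (C : Contour) (c : ℂ) (f : ℂ → ℂ) :
    C.integral (fun z => c * f z) = c * C.integral f := by
  rw [integral_eq, integral_eq, ← MeasureTheory.integral_const_mul]
  simp only [mul_assoc]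

/-- A curve stays at a given point only for a null set of times with nonzero velocity, so that the
values of the integrand at countably many points do not matter. -/
lemma ae_deriv_eq_zero (C : Contour) {S : Set ℂ} (hS : S.Countable) :
    ∀ᵐ θ ∂(volume.restrict (Ioc (0 : ℝ) 1)), C.toFun θ ∈ S → deriv C.toFun θ = 0 := by
  have key : ∀ a ∈ S, ∀ᵐ θ : ℝ, C.toFun θ = a → deriv C.toFun θ = 0 := by
    intro a _
    have hc : {θ : ℝ | C.toFun θ = a ∧ deriv C.toFun θ ≠ 0}.Countable := by
      set A := {θ : ℝ | C.toFun θ = a ∧ deriv C.toFun θ ≠ 0} with hA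
      refine Countable.mono (fun θ hθ => ?_) (countable_setOfPred_isolated_right_within (s := A))
      refine ⟨hθ, ?_⟩
      have hd : DifferentiableAt ℝ C.toFun θ := by
        by_contra h; exact hθ.2 (deriv_zero_of_not_differentiableAt h)
      have h1 := hd.hasDerivAt.eventually_ne (c := a) hθ.2
      rw [← Filter.empty_mem_iff_bot]
      have h2 : ∀ᶠ z in 𝓝[A ∩ Ioi θ] θ, C.toFun z ≠ a :=
        h1.filter_mono (nhdsWithin_mono _ fun z hz => ne_of_gt hz.2)
      filter_upwards [h2, self_mem_nhdsWithin] with z hz hz2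
      exact (hz hz2.1.1).elim
    filter_upwards [hc.ae_notMem volume] with θ hθ h1
    by_contra h2
    exact hθ ⟨h1, h2⟩
  refine ae_restrict_of_ae ?_
  filter_upwards [(ae_ball_iff hS).2 key] with θ hθ hs
  exact hθ _ hs rfl

lemma integral_congr_of_countable (C : Contour) {f g : ℂ → ℂ} {S : Set ℂ} (hS : S.Countable)
    (h : ∀ z ∈ C.trace, z ∉ S → f z = g z) : C.integral f = C.integral g := by
  rw [integral_eq, integral_eq]
  refine integral_congr_ae ?_
  filter_upwards [C.ae_mem_trace, C.ae_deriv_eq_zero hS] with θ hθ h2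
  by_cases hs : C.toFun θ ∈ S
  · simp [h2 hs]
  · rw [h _ hθ hs]

lemma integral_deriv_eq_zero (C : Contour) {f f' : ℂ → ℂ} {U : Set ℂ} (hC : C.trace ⊆ U)
    (hf : ∀ z ∈ U, HasDerivAt f (f' z) z) (hf' : ContinuousOn f' C.trace) :
    C.integral f' = 0 := by
  obtain ⟨P, K, h⟩ := C.piecewise_C1
  have h1 := integral_eq_of_hasDerivAt_off_countable (a := 0) (b := 1)
    (fun θ => f (C.toFun θ)) (fun θ => f' (C.toFun θ) * deriv C.toFun θ)
    (s := (P : Set ℝ)) P.countable_toSet ?_ ?_ (C.integrable_of_continuousOn hf')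
  · rw [integral, h1, C.closed, sub_self]
  · rw [uIcc_of_le zero_le_one]
    exact ContinuousOn.comp (t := C.trace)
      (fun z hz => (hf z (hC hz)).continuousAt.continuousWithinAt) C.continuousOn
      fun θ hθ => C.mem_trace hθ
  · rintro θ ⟨hθ, hθP⟩
    rw [min_eq_left zero_le_one, max_eq_right zero_le_one] at hθ
    exact (hf _ (hC (C.mem_trace (Ioo_subset_Icc_self hθ)))).comp θ
      (h θ hθ hθP).1.hasDerivAt

/-- Contour integrals depend holomorphically on a parameter. -/
lemma differentiableAt_integral (C : Contour) {F : ℂ → ℂ → ℂ} {z₀ : ℂ} {R M : ℝ} (hR : 0 < R)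
    (hcont : ∀ z ∈ Metric.ball z₀ R, ContinuousOn (F z) C.trace)
    (hbd : ∀ z ∈ Metric.ball z₀ R, ∀ w ∈ C.trace, ‖F z w‖ ≤ M)
    (hdiff : ∀ w ∈ C.trace, DifferentiableOn ℂ (fun z => F z w) (Metric.ball z₀ R)) :
    DifferentiableAt ℂ (fun z => C.integral (F z)) z₀ := by
  obtain ⟨K, hK0, hK⟩ := C.exists_deriv_bound
  simp only [integral_eq]
  refine differentiableAt_integral_of_dominated hR (b := fun _ => M * K) (integrable_const _)
    (fun z hz => (C.aestronglyMeasurable_comp (hcont z hz)).mul C.aestronglyMeasurable_deriv) ?_ ?_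
  · filter_upwards [hK, C.ae_mem_trace] with θ h1 h2 z hz
    rw [norm_mul]
    exact mul_le_mul (hbd z hz _ h2) h1 (norm_nonneg _)
      ((norm_nonneg _).trans (hbd z hz _ h2))
  · filter_upwards [C.ae_mem_trace] with θ h2
    exact (hdiff _ h2).mul_const _

lemma norm_integral_le (C : Contour) : ∃ K : ℝ, 0 ≤ K ∧ ∀ (f : ℂ → ℂ) (M : ℝ), 0 ≤ M →
    (∀ w ∈ C.trace, ‖f w‖ ≤ M) → ‖C.integral f‖ ≤ M * K := by
  obtain ⟨K, hK0, hK⟩ := C.exists_deriv_bound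
  refine ⟨K, hK0, fun f M hM hf => ?_⟩
  rw [integral_eq]
  have := norm_integral_le_of_norm_le_const (μ := volume.restrict (Ioc (0 : ℝ) 1))
    (f := fun θ => f (C.toFun θ) * deriv C.toFun θ) (C := M * K) ?_
  · simpa using this
  · filter_upwards [hK, C.ae_mem_trace] with θ h1 h2
    rw [norm_mul]
    exact mul_le_mul (hf _ h2) h1 (norm_nonneg _) hM

end Contour

/-! ### Cycles and the homology form of Cauchy's theorem -/

namespace Contour

lemma integral_inv_sub (C : Contour) (a : ℂ) :
    C.integral (fun z => (z - a)⁻¹) = 2 * Real.pi * Complex.I * C.winding a := by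
  rw [winding, mul_inv_cancel_left₀ Complex.two_pi_I_ne_zero]

lemma infDist_pos (C : Contour) {a : ℂ} (ha : a ∉ C.trace) :
    ∃ r > 0, ∀ z ∈ C.trace, r ≤ dist z a := by
  refine ⟨Metric.infDist a C.trace,
    (C.isClosed_trace.notMem_iff_infDist_pos C.trace_nonempty).1 ha, fun z hz => ?_⟩
  rw [dist_comm]; exact Metric.infDist_le_dist_of_mem hz

/-- A Cauchy integral is holomorphic off the curve. -/
lemma differentiableAt_cauchy (C : Contour) {f : ℂ → ℂ} (hf : ContinuousOn f C.trace) {a : ℂ}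
    (ha : a ∉ C.trace) : DifferentiableAt ℂ (fun z => C.integral (fun w => f w * (w - z)⁻¹)) a := by
  obtain ⟨r, hr, hd⟩ := C.infDist_pos ha
  obtain ⟨M, hM⟩ := C.isCompact_trace.exists_bound_of_continuousOn hf
  have hlow : ∀ z ∈ Metric.ball a (r / 2), ∀ w ∈ C.trace, r / 2 ≤ ‖w - z‖ := by
    intro z hz w hw
    rw [← dist_eq_norm]
    have := hd w hw
    rw [Metric.mem_ball] at hz
    linarith [dist_triangle w z a]
  have hne : ∀ z ∈ Metric.ball a (r / 2), ∀ w ∈ C.trace, w - z ≠ 0 := fun z hz w hw => by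
    rw [← norm_pos_iff]; linarith [hlow z hz w hw]
  refine C.differentiableAt_integral (R := r / 2) (M := M * (r / 2)⁻¹) (by positivity) ?_ ?_ ?_
  · intro z hz
    exact hf.mul ((continuousOn_id.sub continuousOn_const).inv₀ (hne z hz))
  · intro z hz w hw
    rw [norm_mul, norm_inv]
    have := hlow z hz w hw
    exact mul_le_mul (hM w hw) (inv_anti₀ (by positivity) this) (by positivity)
      ((norm_nonneg _).trans (hM w hw))
  · intro w hw z hz
    exact (((differentiableAt_const w).sub differentiableAt_id).inv (hne z hz w hw)
      |>.const_mul _).differentiableWithinAt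

lemma tendsto_cauchy (C : Contour) {f : ℂ → ℂ} (hf : ContinuousOn f C.trace) :
    Tendsto (fun z => C.integral (fun w => f w * (w - z)⁻¹)) (cocompact ℂ) (𝓝 0) := by
  obtain ⟨M, hM⟩ := C.isCompact_trace.exists_bound_of_continuousOn hf
  obtain ⟨B, hB⟩ := C.isCompact_trace.exists_bound_of_continuousOn (continuousOn_id (s := C.trace))
  obtain ⟨K, hK0, hK⟩ := C.norm_integral_le
  have hM0 : 0 ≤ M := by
    obtain ⟨w, hw⟩ := C.trace_nonempty; exact (norm_nonneg _).trans (hM w hw)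
  have h1 : Tendsto (fun z : ℂ => M * (‖z‖ - B)⁻¹ * K) (cocompact ℂ) (𝓝 (M * 0 * K)) := by
    refine (Tendsto.const_mul M (Tendsto.inv_tendsto_atTop ?_)).mul_const K
    exact tendsto_atTop_add_const_right _ (-B) (tendsto_norm_cocompact_atTop (E := ℂ))
  rw [mul_zero, zero_mul] at h1
  refine squeeze_zero_norm' ?_ h1
  filter_upwards [(tendsto_norm_cocompact_atTop (E := ℂ)).eventually_gt_atTop B] with z hz
  refine hK _ _ (mul_nonneg hM0 (inv_nonneg.2 (by linarith))) fun w hw => ?_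
  rw [norm_mul, norm_inv]
  have h2 : ‖w‖ ≤ B := hB w hw
  have h3 : ‖z‖ - B ≤ ‖w - z‖ := by
    rw [norm_sub_rev]; linarith [norm_sub_norm_le z w]
  exact mul_le_mul (hM w hw) (inv_anti₀ (by linarith) h3) (by positivity) hM0

/-- The winding number does not change along a segment that avoids the curve: on the complement of
the segment from `a` to `b`, the function `log ((z - a) / (z - b))` is a primitive. -/
lemma winding_eq_of_segment (C : Contour) {a b : ℂ} (h : Disjoint (segment ℝ a b) C.trace) :
    C.winding a = C.winding b := by
  have hne : ∀ z ∉ segment ℝ a b, z - a ≠ 0 ∧ z - b ≠ 0 := fun z hz =>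
    ⟨fun h0 => hz (by rw [sub_eq_zero.1 h0]; exact left_mem_segment ℝ a b),
      fun h0 => hz (by rw [sub_eq_zero.1 h0]; exact right_mem_segment ℝ a b)⟩
  have hC : C.trace ⊆ (segment ℝ a b)ᶜ := fun z hz hs => h.ne_of_mem hs hz rfl
  have hcont : ∀ c ∈ segment ℝ a b, ContinuousOn (fun z => (z - c)⁻¹) C.trace := fun c hc =>
    (continuousOn_id.sub continuousOn_const).inv₀ fun z hz h0 =>
      hC hz (by rw [show z = c from sub_eq_zero.1 h0]; exact hc)
  have ha := hcont a (left_mem_segment ℝ a b)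
  have hb := hcont b (right_mem_segment ℝ a b)
  have key := C.integral_deriv_eq_zero (f := fun z => Complex.log ((z - a) / (z - b)))
    (f' := fun z => (z - a)⁻¹ - (z - b)⁻¹) hC ?_ (ha.sub hb)
  · rw [C.integral_sub (C.integrable_of_continuousOn ha) (C.integrable_of_continuousOn hb),
      sub_eq_zero] at key
    rw [winding, winding, key]
  · intro z hz
    obtain ⟨h1, h2⟩ := hne z hz
    have h3 : (z - a) / (z - b) ∈ Complex.slitPlane := by
      rw [Complex.mem_slitPlane_iff_not_le_zero]
      intro h0
      obtain ⟨s, hs, hs2⟩ : ∃ s : ℝ, 0 ≤ s ∧ (z - a) / (z - b) = -(s : ℂ) := by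
        refine ⟨-((z - a) / (z - b)).re, by simpa using (Complex.le_def.1 h0).1, ?_⟩
        apply Complex.ext
        · simp
        · simpa using (Complex.le_def.1 h0).2
      apply hz
      rw [div_eq_iff h2] at hs2
      have h5 : (1 + s : ℂ) ≠ 0 := by
        rw [← Complex.ofReal_one, ← Complex.ofReal_add, Ne, Complex.ofReal_eq_zero]; positivity
      refine ⟨1 / (1 + s), s / (1 + s), by positivity, by positivity, by field_simp, ?_⟩
      rw [Complex.real_smul, Complex.real_smul]
      push_cast
      field_simp
      linear_combination -hs2
    have h4 := (((hasDerivAt_id z).sub_const a).div ((hasDerivAt_id z).sub_const b) h2).clog h3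
    refine h4.congr_deriv ?_
    simp only [id, Pi.div_apply]
    field_simp

lemma winding_eventually_eq (C : Contour) {a : ℂ} (ha : a ∉ C.trace) :
    ∀ᶠ b in 𝓝 a, b ∉ C.trace ∧ C.winding b = C.winding a := by
  obtain ⟨r, hr, hd⟩ := C.infDist_pos ha
  have hnot : ∀ z ∈ Metric.ball a r, z ∉ C.trace := fun z hz h => by
    have := hd z h; rw [Metric.mem_ball] at hz; linarith
  filter_upwards [Metric.ball_mem_nhds a hr] with b hb
  refine ⟨hnot b hb, C.winding_eq_of_segment ?_⟩
  rw [Set.disjoint_left]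
  exact fun z hz => hnot z ((convex_ball a r).segment_subset hb (Metric.mem_ball_self hr) hz)

/-- The winding number about points far from the origin vanishes. -/
lemma winding_eq_zero_of_lt (C : Contour) {B : ℝ} (hB : ∀ w ∈ C.trace, ‖w‖ ≤ B) {a : ℂ}
    (ha : B < ‖a‖) : C.winding a = 0 := by
  have ha0 : a ≠ 0 := by
    rw [← norm_pos_iff]
    obtain ⟨w, hw⟩ := C.trace_nonempty
    exact ((norm_nonneg _).trans (hB w hw)).trans_lt ha
  rw [winding, C.integral_deriv_eq_zero (f := fun z => Complex.log (1 - z / a))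
    (U := Metric.ball 0 ‖a‖), mul_zero]
  · intro w hw
    rw [mem_ball_zero_iff]; exact (hB w hw).trans_lt ha
  · intro z hz
    rw [mem_ball_zero_iff] at hz
    have h1 : 1 - z / a ∈ Complex.slitPlane := by
      rw [sub_eq_add_neg]
      refine Complex.mem_slitPlane_of_norm_lt_one ?_
      rw [norm_neg, norm_div, div_lt_one (norm_pos_iff.2 ha0)]; exact hz
    have h2 : HasDerivAt (fun z => 1 - z / a) (-(1 / a)) z :=
      ((hasDerivAt_id z).div_const a).const_sub 1
    convert h2.clog h1 using 1
    have h3 : z - a ≠ 0 := fun h => by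
      rw [sub_eq_zero.1 h] at hz; exact lt_irrefl _ hz
    have h4 : a - z ≠ 0 := fun h => h3 (by rw [← neg_sub, h, neg_zero])
    have h5 : 1 - z / a = (a - z) / a := by field_simp
    rw [h5]; field_simp
    ring
  · refine (continuousOn_id.sub continuousOn_const).inv₀ fun w hw h => ?_
    have := hB w hw
    rw [show w = a from sub_eq_zero.1 h] at this
    linarith

end Contour

/-- A cycle: a formal linear combination of closed curves. -/
abbrev Cycle := Contour →₀ ℂ

namespace Cycle

/-- The integral along a cycle, as a linear function of the cycle. -/
def integral (γ : Cycle) (f : ℂ → ℂ) : ℂ :=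
  Finsupp.linearCombination ℂ (fun C : Contour => C.integral f) γ

/-- The winding number of a cycle about a point. -/
def winding (γ : Cycle) (a : ℂ) : ℂ :=
  Finsupp.linearCombination ℂ (fun C : Contour => C.winding a) γ

/-- The cycles all of whose curves lie in `Ω`. -/
def inside (Ω : Set ℂ) : Submodule ℂ Cycle := Finsupp.supported ℂ ℂ {C | C.trace ⊆ Ω}

lemma integral_eq_sum (γ : Cycle) (f : ℂ → ℂ) :
    γ.integral f = ∑ C ∈ γ.support, γ C * C.integral f := by
  simp [integral, Finsupp.linearCombination_apply, Finsupp.sum]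

lemma winding_eq_sum (γ : Cycle) (a : ℂ) :
    γ.winding a = ∑ C ∈ γ.support, γ C * C.winding a := by
  simp [winding, Finsupp.linearCombination_apply, Finsupp.sum]

lemma mem_inside {γ : Cycle} {Ω : Set ℂ} : γ ∈ inside Ω ↔ ∀ C ∈ γ.support, C.trace ⊆ Ω := by
  simp [inside, Finsupp.mem_supported, Set.subset_def]

lemma single_mem_inside {C : Contour} {Ω : Set ℂ} (h : C.trace ⊆ Ω) (c : ℂ) :
    Finsupp.single C c ∈ inside Ω := Finsupp.single_mem_supported ℂ c h

@[simp] lemma integral_single (C : Contour) (c : ℂ) (f : ℂ → ℂ) :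
    integral (Finsupp.single C c) f = c * C.integral f := by simp [integral]

@[simp] lemma winding_single (C : Contour) (c : ℂ) (a : ℂ) :
    winding (Finsupp.single C c) a = c * C.winding a := by simp [winding]

lemma integral_sub (γ γ' : Cycle) (f : ℂ → ℂ) :
    (γ - γ').integral f = γ.integral f - γ'.integral f := by simp [integral]

lemma winding_sub (γ γ' : Cycle) (a : ℂ) :
    (γ - γ').winding a = γ.winding a - γ'.winding a := by simp [winding]

lemma winding_add (γ γ' : Cycle) (a : ℂ) :
    (γ + γ').winding a = γ.winding a + γ'.winding a := by simp [winding]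

lemma winding_sum {ι : Type*} (s : Finset ι) (γ : ι → Cycle) (a : ℂ) :
    (∑ i ∈ s, γ i).winding a = ∑ i ∈ s, (γ i).winding a := by simp [winding]

/-- The curves of a cycle cover a compact set. -/
lemma exists_isCompact {γ : Cycle} {Ω : Set ℂ} (hγ : γ ∈ inside Ω) :
    ∃ K ⊆ Ω, IsCompact K ∧ γ ∈ inside K := by
  refine ⟨⋃ C ∈ γ.support, C.trace, ?_, ?_, ?_⟩
  · exact iUnion₂_subset fun C hC => mem_inside.1 hγ C hC
  · exact γ.support.isCompact_biUnion fun C _ => C.isCompact_trace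
  · exact mem_inside.2 fun C hC => subset_biUnion_of_mem (u := fun C : Contour => C.trace) hC

end Cycle

lemma dslope_symm (f : ℂ → ℂ) (a b : ℂ) : dslope f a b = dslope f b a := by
  rcases eq_or_ne a b with rfl | h
  · rfl
  · rw [dslope_of_ne f h.symm, dslope_of_ne f h, slope_comm]

lemma Contour.differentiableAt_integral_dslope (C : Contour) {Ω : Set ℂ} (hΩ : IsOpen Ω)
    (hC : C.trace ⊆ Ω) {f : ℂ → ℂ} (hf : DifferentiableOn ℂ f Ω) {a : ℂ} (ha : a ∈ Ω) :
    DifferentiableAt ℂ (fun z => C.integral (fun w => dslope f w z)) a := by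
  obtain ⟨R, hR, hball⟩ := Metric.isOpen_iff.1 hΩ a ha
  obtain ⟨r, hr, hrR⟩ : ∃ r > 0, Metric.closedBall a r ⊆ Ω :=
    ⟨R / 2, by positivity, (Metric.closedBall_subset_ball (by linarith)).trans hball⟩
  have hdiff : ∀ w ∈ Ω, DifferentiableOn ℂ (dslope f w) Ω := fun w hw =>
    (Complex.differentiableOn_dslope (hΩ.mem_nhds hw)).2 hf
  obtain ⟨M₁, hM₁⟩ := C.isCompact_trace.exists_bound_of_continuousOn (hf.continuousOn.mono hC)
  obtain ⟨M₂, hM₂⟩ := (isCompact_closedBall a r).exists_bound_of_continuousOn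
    (hf.continuousOn.mono hrR)
  have hfar : ∀ z ∈ Metric.closedBall a r, ∀ w ∈ C.trace, r / 4 ≤ dist z w →
      ‖dslope f w z‖ ≤ (M₂ + M₁) / (r / 4) := by
    intro z hz w hw hzw
    have hne : z ≠ w := by
      rintro rfl; rw [dist_self] at hzw; linarith
    rw [dslope_of_ne f hne, slope_def_field, norm_div, ← dist_eq_norm z w]
    have := (norm_sub_le (f z) (f w)).trans (add_le_add (hM₂ z hz) (hM₁ w hw))
    have h0 := (norm_nonneg _).trans this
    gcongr
  refine C.differentiableAt_integral (R := r / 4) (M := (M₂ + M₁) / (r / 4)) (by positivity)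
    ?_ ?_ ?_
  · intro z hz
    simp only [dslope_symm f _ z]
    exact ((hdiff z (hrR (Metric.ball_subset_closedBall
      (Metric.ball_subset_ball (by linarith) hz)))).continuousOn).mono hC
  · intro z hz w hw
    by_cases hwa : dist w a ≤ r / 2
    · -- the maximum principle on the disc around `a` of radius `r`
      refine Complex.norm_le_of_forall_mem_frontier_norm_le (U := Metric.ball a r)
        Metric.isBounded_ball ?_ ?_ (subset_closure (Metric.ball_subset_ball (by linarith) hz))
      · refine DifferentiableOn.diffContOnCl ?_
        rw [closure_ball _ hr.ne']
        exact (hdiff w (hC hw)).mono hrR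
      · intro y hy
        rw [frontier_ball _ hr.ne'] at hy
        refine hfar y (Metric.sphere_subset_closedBall hy) w hw ?_
        rw [Metric.mem_sphere] at hy
        linarith [dist_triangle y w a]
    · refine hfar z (Metric.ball_subset_closedBall (Metric.ball_subset_ball (by linarith) hz)) w hw ?_
      rw [Metric.mem_ball] at hz
      linarith [dist_triangle w z a, dist_comm w z]
  · intro w hw
    exact (hdiff w (hC hw)).mono ((Metric.ball_subset_closedBall.trans
      (Metric.closedBall_subset_closedBall (by linarith))).trans hrR)

lemma Contour.integral_dslope (C : Contour) {Ω : Set ℂ} (hC : C.trace ⊆ Ω) {f : ℂ → ℂ}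
    (hf : ContinuousOn f Ω) {a : ℂ} (ha : a ∉ C.trace) :
    C.integral (fun w => dslope f w a) =
      C.integral (fun w => f w * (w - a)⁻¹) - f a * (2 * Real.pi * Complex.I) * C.winding a := by
  have hne : ∀ w ∈ C.trace, w - a ≠ 0 := fun w hw h => ha (by rwa [← sub_eq_zero.1 h])
  have hinv : ContinuousOn (fun w => (w - a)⁻¹) C.trace :=
    (continuousOn_id.sub continuousOn_const).inv₀ hne
  have h0 := C.integral_sub
    (C.integrable_of_continuousOn (f := fun w => f w * (w - a)⁻¹) ((hf.mono hC).mul hinv))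
    (C.integrable_of_continuousOn (f := fun w => f a * (w - a)⁻¹) (continuousOn_const.mul hinv))
  rw [mul_assoc, ← C.integral_inv_sub, ← C.integral_const_mul, ← h0]
  refine C.integral_congr fun w hw => ?_
  have h1 : a ≠ w := fun h => ha (h ▸ hw)
  have h2 := hne w hw
  have h3 : a - w ≠ 0 := sub_ne_zero.2 h1
  rw [dslope_of_ne f h1, slope_def_field]
  have h4 : (w - a)⁻¹ = -(a - w)⁻¹ := by rw [← neg_sub, inv_neg]
  rw [h4, div_eq_mul_inv]; ring

/-- **Cauchy's theorem**, homology form: a cycle in `Ω` that does not wind around any point of the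
complement has vanishing integrals. The proof is Dixon's. -/
theorem Cycle.integral_eq_zero {Ω : Set ℂ} (hΩ : IsOpen Ω) (hne : Ω.Nonempty) {γ : Cycle}
    (hγ : γ ∈ inside Ω) (hw : ∀ a ∉ Ω, γ.winding a = 0) {f : ℂ → ℂ}
    (hf : DifferentiableOn ℂ f Ω) : γ.integral f = 0 := by
  classical
  obtain ⟨z₀, hz₀⟩ := hne
  have hγ' := mem_inside.1 hγ
  -- Dixon's argument is applied to `g`, whose difference quotient at `z₀` is `f`
  set g : ℂ → ℂ := fun w => f w * (w - z₀) with hg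
  have hgd : DifferentiableOn ℂ g Ω := hf.mul (differentiableOn_id.sub_const z₀)
  set h : ℂ → ℂ := fun z => ∑ C ∈ γ.support, γ C * C.integral (fun w => dslope g w z) with hh
  set k : ℂ → ℂ := fun z => ∑ C ∈ γ.support, γ C * C.integral (fun w => g w * (w - z)⁻¹) with hk
  have hhk : ∀ z ∈ Ω, (∀ C ∈ γ.support, z ∉ C.trace) → γ.winding z = 0 → h z = k z := by
    intro z hz hzC hz0
    have : h z = k z - g z * (2 * Real.pi * Complex.I) * γ.winding z := by
      rw [Cycle.winding_eq_sum, Finset.mul_sum, ← Finset.sum_sub_distrib]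
      refine Finset.sum_congr rfl fun C hC => ?_
      rw [C.integral_dslope (hγ' C hC) hgd.continuousOn (hzC C hC)]
      ring
    rw [this, hz0, mul_zero, sub_zero]
  set H : ℂ → ℂ := fun z => if z ∈ Ω then h z else k z with hH
  have hfar : ∃ B : ℝ, ∀ z, B < ‖z‖ → (∀ C ∈ γ.support, z ∉ C.trace) ∧ γ.winding z = 0 := by
    obtain ⟨K, -, hK, hγK⟩ := Cycle.exists_isCompact hγ
    obtain ⟨B, hB⟩ := hK.exists_bound_of_continuousOn (continuousOn_id (s := K))
    have hB' : ∀ C ∈ γ.support, ∀ w ∈ C.trace, ‖w‖ ≤ B := fun C hC w hw =>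
      hB w (mem_inside.1 hγK C hC hw)
    refine ⟨B, fun z hz => ⟨fun C hC hzC => (hB' C hC z hzC).not_gt hz, ?_⟩⟩
    rw [Cycle.winding_eq_sum]
    exact Finset.sum_eq_zero fun C hC => by
      rw [C.winding_eq_zero_of_lt (hB' C hC) hz, mul_zero]
  have hHk : ∀ z, (∀ C ∈ γ.support, z ∉ C.trace) → γ.winding z = 0 → H z = k z := by
    intro z h1 h2
    by_cases hz : z ∈ Ω
    · rw [hH]; simp only [hz, if_true]; exact hhk z hz h1 h2
    · rw [hH]; simp only [hz, if_false]
  have hHd : Differentiable ℂ H := by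
    intro z
    by_cases hz : z ∈ Ω
    · have h1 : DifferentiableAt ℂ h z := by
        refine DifferentiableAt.fun_sum fun C hC => DifferentiableAt.const_mul ?_ _
        exact C.differentiableAt_integral_dslope hΩ (hγ' C hC) hgd hz
      refine h1.congr_of_eventuallyEq ?_
      filter_upwards [hΩ.mem_nhds hz] with y hy
      rw [hH]; simp only [hy, if_true]
    · have hzC : ∀ C ∈ γ.support, z ∉ C.trace := fun C hC h1 => hz (hγ' C hC h1)
      have h1 : DifferentiableAt ℂ k z := by
        refine DifferentiableAt.fun_sum fun C hC => DifferentiableAt.const_mul ?_ _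
        exact C.differentiableAt_cauchy (hgd.continuousOn.mono (hγ' C hC)) (hzC C hC)
      refine h1.congr_of_eventuallyEq ?_
      have h2 : ∀ᶠ y in 𝓝 z, ∀ C ∈ γ.support, y ∉ C.trace ∧ C.winding y = C.winding z :=
        (Filter.eventually_all_finset _).2 fun C hC => C.winding_eventually_eq (hzC C hC)
      filter_upwards [h2] with y hy
      refine hHk y (fun C hC => (hy C hC).1) ?_
      rw [← hw z hz, Cycle.winding_eq_sum, Cycle.winding_eq_sum]
      exact Finset.sum_congr rfl fun C hC => by rw [(hy C hC).2]
  have hlim : Tendsto H (cocompact ℂ) (𝓝 0) := by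
    obtain ⟨B, hB⟩ := hfar
    have h1 : Tendsto k (cocompact ℂ) (𝓝 (∑ C ∈ γ.support, γ C * 0)) :=
      tendsto_finsetSum _ fun C hC => Tendsto.const_mul _
        (C.tendsto_cauchy (hgd.continuousOn.mono (hγ' C hC)))
    simp only [mul_zero, Finset.sum_const_zero] at h1
    refine h1.congr' ?_
    filter_upwards [(tendsto_norm_cocompact_atTop (E := ℂ)).eventually_gt_atTop B] with z hz
    exact (hHk z (hB z hz).1 (hB z hz).2).symm
  have h0 := hHd.apply_eq_of_tendsto_cocompact z₀ hlim
  rw [hH] at h0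
  simp only [hz₀, if_true, hh] at h0
  rw [Cycle.integral_eq_sum, ← h0]
  refine Finset.sum_congr rfl fun C hC => ?_
  congr 1
  refine C.integral_congr fun w hw => ?_
  have hwΩ := hγ' C hC hw
  rw [dslope_symm]
  rcases eq_or_ne w z₀ with rfl | hne
  · rw [dslope_same]
    have h1 := ((hf.differentiableAt (hΩ.mem_nhds hwΩ)).hasDerivAt.mul
      ((hasDerivAt_id w).sub_const w)).deriv
    have h2 : deriv g w = f w := by
      simpa [hg, Pi.mul_def] using h1
    rw [h2]
  · rw [dslope_of_ne g hne, slope_def_field, hg]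
    have := sub_ne_zero.2 hne
    simp only [sub_self, mul_zero, sub_zero]
    field_simp

/-! ### Theta functions -/

lemma isPreconnected_compl_zero : IsPreconnected ({0}ᶜ : Set ℂ) :=
  (isConnected_compl_singleton_of_one_lt_rank (by simp) 0).isPreconnected

/-- The identity theorem on `ℂ \ {0}`. -/
lemma eqOn_compl_zero {f g : ℂ → ℂ} (hf : ∀ z : ℂ, z ≠ 0 → DifferentiableAt ℂ f z)
    (hg : ∀ z : ℂ, z ≠ 0 → DifferentiableAt ℂ g z) {w : ℂ} (hw : w ≠ 0) (h : f =ᶠ[𝓝 w] g) :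
    EqOn f g {0}ᶜ :=
  AnalyticOnNhd.eqOn_of_preconnected_of_eventuallyEq
    (DifferentiableOn.analyticOnNhd (fun z hz => (hf z hz).differentiableWithinAt)
      isOpen_compl_singleton)
    (DifferentiableOn.analyticOnNhd (fun z hz => (hg z hz).differentiableWithinAt)
      isOpen_compl_singleton) isPreconnected_compl_zero hw h

lemma differentiableAt_theta (hp : ‖p‖ < 1) {x : ℂ} (hx : x ≠ 0) :
    DifferentiableAt ℂ (theta p) x :=
  (differentiableOn_theta hp).differentiableAt (isOpen_compl_singleton.mem_nhds hx)

lemma _root_.DifferentiableAt.theta (hp : ‖p‖ < 1) {f : ℂ → ℂ} {x : ℂ}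
    (hf : DifferentiableAt ℂ f x) (hx : f x ≠ 0) :
    DifferentiableAt ℂ (fun y => theta p (f y)) x :=
  (differentiableAt_theta hp hx).comp x hf

lemma theta_one (hp : ‖p‖ < 1) (hp0 : p ≠ 0) : theta p 1 = 0 :=
  (theta_eq_zero_iff hp hp0 one_ne_zero).2 ⟨0, by simp⟩

/-- The zeros of the theta function are simple. -/
lemma deriv_theta_ne_zero (hp : ‖p‖ < 1) (hp0 : p ≠ 0) (n : ℤ) : deriv (theta p) (p ^ n) ≠ 0 := by
  have h1 : deriv (theta p) 1 ≠ 0 := by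
    have hfun : theta p = fun x => (1 - x) * (qPoch (p * x) p * qPoch (p / x) p) := by
      funext x; rw [theta, qPoch_eq_mul hp]; ring
    have hq := differentiable_qPoch hp
    have hB : DifferentiableAt ℂ (fun x : ℂ => qPoch (p * x) p * qPoch (p / x) p) 1 := by
      refine DifferentiableAt.mul ?_ ?_
      · exact (hq _).comp (1 : ℂ) (by fun_prop)
      · exact (hq _).comp (1 : ℂ) ((differentiableAt_const p).div differentiableAt_id one_ne_zero)
    have := (((hasDerivAt_id (1 : ℂ)).const_sub 1).mul hB.hasDerivAt).deriv
    rw [hfun]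
    have h2 : deriv (fun x => (1 - x) * (qPoch (p * x) p * qPoch (p / x) p)) 1
        = - (qPoch p p * qPoch p p) := by
      simpa [Pi.mul_def] using this
    rw [h2, neg_ne_zero]
    exact mul_ne_zero (qPoch_ne_zero_of_norm_lt hp hp) (qPoch_ne_zero_of_norm_lt hp hp)
  have step : ∀ n : ℤ, p * deriv (theta p) (p ^ (n + 1)) = -(p ^ n)⁻¹ * deriv (theta p) (p ^ n) := by
    intro n
    have hn : p ^ n ≠ 0 := zpow_ne_zero n hp0
    have hz : theta p (p ^ n) = 0 := (theta_eq_zero_iff hp hp0 hn).2 ⟨n, rfl⟩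
    have hL : HasDerivAt (fun z => theta p (p * z)) (deriv (theta p) (p * p ^ n) * (p * 1)) (p ^ n) :=
      (differentiableAt_theta hp (mul_ne_zero hp0 hn)).hasDerivAt.comp _
        ((hasDerivAt_id _).const_mul p)
    have hR : HasDerivAt (fun z => -z⁻¹ * theta p z) _ (p ^ n) :=
      ((hasDerivAt_inv hn).neg).mul (differentiableAt_theta hp hn).hasDerivAt
    have heq : (fun z => theta p (p * z)) =ᶠ[𝓝 (p ^ n)] fun z => -z⁻¹ * theta p z := by
      filter_upwards [isOpen_compl_singleton.mem_nhds hn] with z hz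
      exact theta_mul hp hp0 hz
    have := (hL.congr_of_eventuallyEq heq.symm).unique hR
    rw [hz, mul_zero, zero_add, mul_one, mul_comm] at this
    rw [zpow_add₀ hp0, zpow_one, mul_comm (p ^ n) p]
    exact this
  induction n using Int.induction_on with
  | zero => simpa using h1
  | succ n ih =>
    intro h
    have := step n
    rw [h, mul_zero] at this
    exact mul_ne_zero (neg_ne_zero.2 (inv_ne_zero (zpow_ne_zero _ hp0))) ih this.symm
  | pred n ih =>
    intro h
    have := step (-n - 1)
    rw [h, mul_zero, sub_add_cancel] at this
    exact mul_ne_zero hp0 ih this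

/-- A holomorphic function is divisible by a holomorphic function with simple zeros only, if it
vanishes at these. -/
lemma exists_eq_mul_of_simple_zeros {U : Set ℂ} (hU : IsOpen U) {f g : ℂ → ℂ}
    (hf : DifferentiableOn ℂ f U) (hg : DifferentiableOn ℂ g U)
    (hfg : ∀ z ∈ U, g z = 0 → f z = 0 ∧ deriv g z ≠ 0) :
    ∃ h : ℂ → ℂ, DifferentiableOn ℂ h U ∧ ∀ z ∈ U, f z = g z * h z := by
  classical
  refine ⟨fun z => if g z = 0 then deriv f z / deriv g z else f z / g z, ?_, ?_⟩
  · intro a ha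
    refine DifferentiableAt.differentiableWithinAt ?_
    by_cases h0 : g a = 0
    · obtain ⟨hfa, hga⟩ := hfg a ha h0
      have hUa := hU.mem_nhds ha
      have h1 : DifferentiableAt ℂ (dslope f a) a :=
        ((Complex.differentiableOn_dslope hUa).2 hf).differentiableAt hUa
      have h2 : DifferentiableAt ℂ (dslope g a) a :=
        ((Complex.differentiableOn_dslope hUa).2 hg).differentiableAt hUa
      have h3 : dslope g a a ≠ 0 := by rwa [dslope_same]
      refine (h1.div h2 h3).congr_of_eventuallyEq ?_
      filter_upwards [h2.continuousAt.eventually_ne h3] with z hz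
      have hgz := sub_smul_dslope g a z
      have hfz := sub_smul_dslope f a z
      rw [h0, sub_zero, smul_eq_mul] at hgz
      rw [hfa, sub_zero, smul_eq_mul] at hfz
      rcases eq_or_ne z a with rfl | hne
      · simp [h0, dslope_same]
      · have : g z ≠ 0 := by
          rw [← hgz]; exact mul_ne_zero (sub_ne_zero.2 hne) hz
        simp only [this, if_false, Pi.div_apply]
        rw [← hgz, ← hfz, mul_div_mul_left _ _ (sub_ne_zero.2 hne)]
    · refine ((hf.differentiableAt (hU.mem_nhds ha)).div (hg.differentiableAt (hU.mem_nhds ha))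
        h0).congr_of_eventuallyEq ?_
      filter_upwards [(hg.differentiableAt (hU.mem_nhds ha)).continuousAt.eventually_ne h0] with z hz
      simp [hz]
  · intro z hz
    by_cases h0 : g z = 0
    · simp [h0, (hfg z hz h0).1]
    · simp only [h0, if_false]; field_simp

/-- A holomorphic function on `ℂ \ {0}` with `f (p z) = c z^m f z`, `m > 0`, vanishes: it is bounded,
hence constant. -/
lemma eq_zero_of_quasiperiodic_pos (hp : ‖p‖ < 1) (hp0 : p ≠ 0) {f : ℂ → ℂ} {c : ℂ} {m : ℕ}
    (hm : m ≠ 0) (hf : DifferentiableOn ℂ f {0}ᶜ) (hq : ∀ z ≠ 0, f (p * z) = c * z ^ m * f z) :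
    ∀ z ≠ 0, f z = 0 := by
  have hpn : 0 < ‖p‖ := norm_pos_iff.2 hp0
  by_cases hc : c = 0
  · intro z hz
    have := hq (z / p) (div_ne_zero hz hp0)
    rwa [hc, zero_mul, zero_mul, mul_div_cancel₀ _ hp0] at this
  have hcn : 0 < ‖c‖ := norm_pos_iff.2 hc
  set ρ : ℝ := min 1 ‖c‖⁻¹ with hρ
  set R : ℝ := max 1 ‖c‖⁻¹ with hR
  have hρ0 : 0 < ρ := by positivity
  have hρ1 : ρ ≤ 1 := min_le_left _ _
  have hR1 : 1 ≤ R := le_max_left _ _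
  have hsmall : ∀ z : ℂ, ‖z‖ ≤ ρ → ‖c * z ^ m‖ ≤ 1 := by
    intro z hz
    rw [norm_mul, norm_pow]
    have h1 : ‖z‖ ^ m ≤ ‖z‖ := pow_le_of_le_one (norm_nonneg _) (hz.trans hρ1) hm
    calc ‖c‖ * ‖z‖ ^ m ≤ ‖c‖ * ‖c‖⁻¹ := by
          gcongr; exact h1.trans (hz.trans (min_le_right _ _))
      _ = 1 := mul_inv_cancel₀ hcn.ne'
  have hlarge : ∀ z : ℂ, R ≤ ‖z‖ → 1 ≤ ‖c * z ^ m‖ := by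
    intro z hz
    rw [norm_mul, norm_pow]
    have h1 : ‖z‖ ≤ ‖z‖ ^ m := le_self_pow₀ (hR1.trans hz) hm
    calc 1 = ‖c‖ * ‖c‖⁻¹ := (mul_inv_cancel₀ hcn.ne').symm
      _ ≤ ‖c‖ * ‖z‖ ^ m := by
          gcongr; exact (le_max_right _ _).trans (hz.trans h1)
  have hK : IsCompact (Metric.closedBall (0 : ℂ) R \ Metric.ball 0 (‖p‖ * ρ)) :=
    (isCompact_closedBall 0 R).diff Metric.isOpen_ball
  obtain ⟨M, hM⟩ := hK.exists_bound_of_continuousOn (f := f) (hf.continuousOn.mono fun z hz h => by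
    rw [mem_singleton_iff] at h
    subst h
    exact hz.2 (Metric.mem_ball_self (by positivity)))
  have hdown : ∀ n : ℕ, ∀ z : ℂ, ‖p‖ ^ (n + 1) * ρ ≤ ‖z‖ → ‖z‖ ≤ R → ‖f z‖ ≤ M := by
    intro n
    induction n with
    | zero =>
      intro z h1 h2
      exact hM z ⟨by simpa using h2, by simpa using h1⟩
    | succ n ih =>
      intro z h1 h2
      by_cases h3 : ‖p‖ ^ (n + 1) * ρ ≤ ‖z‖
      · exact ih z h3 h2
      push Not at h3
      have hz' : ‖z / p‖ = ‖z‖ / ‖p‖ := norm_div _ _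
      have h4 : ‖p‖ ^ (n + 1) * ρ ≤ ‖z / p‖ := by
        rw [hz', le_div_iff₀ hpn]; calc _ = _ := by ring
          _ ≤ _ := h1
      have h5 : ‖z / p‖ ≤ ρ := by
        rw [hz', div_le_iff₀ hpn]
        refine h3.le.trans ?_
        rw [pow_succ, mul_comm ρ]
        have := pow_le_one₀ (n := n) (norm_nonneg p) hp.le
        gcongr
        nlinarith
      have h6 : z / p ≠ 0 := by
        rw [← norm_pos_iff]; exact lt_of_lt_of_le (by positivity) h4
      have h7 := hq _ h6
      rw [mul_div_cancel₀ _ hp0] at h7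
      rw [h7, norm_mul]
      have h8 := ih (z / p) h4 (h5.trans (hρ1.trans hR1))
      exact (mul_le_of_le_one_left (norm_nonneg _) (hsmall _ h5)).trans h8
  have hin : ∀ z ≠ 0, ‖z‖ ≤ R → ‖f z‖ ≤ M := by
    intro z hz h
    obtain ⟨n, hn⟩ := exists_pow_lt_of_lt_one (y := ‖p‖) (x := ‖z‖ / ρ)
      (div_pos (norm_pos_iff.2 hz) hρ0) hp
    refine hdown n z ?_ h
    rw [lt_div_iff₀ hρ0] at hn
    refine le_trans ?_ hn.le
    rw [pow_succ]
    gcongr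
    exact mul_le_of_le_one_right (by positivity) hp.le
  have hup : ∀ n : ℕ, ∀ z : ℂ, z ≠ 0 → ‖p‖ ^ n * ‖z‖ ≤ R → ‖f z‖ ≤ M := by
    intro n
    induction n with
    | zero => intro z hz h; exact hin z hz (by simpa using h)
    | succ n ih =>
      intro z hz h
      by_cases h1 : ‖z‖ ≤ R
      · exact hin z hz h1
      push Not at h1
      have h2 := ih (p * z) (mul_ne_zero hp0 hz) (by
        rw [norm_mul, ← mul_assoc, ← pow_succ]; exact h)
      rw [hq z hz, norm_mul] at h2
      exact (le_mul_of_one_le_left (norm_nonneg _) (hlarge z h1.le)).trans h2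
  have hall : ∀ z ≠ 0, ‖f z‖ ≤ M := by
    intro z hz
    have hz' := norm_pos_iff.2 hz
    obtain ⟨n, hn⟩ := exists_pow_lt_of_lt_one (y := ‖p‖) (x := R / ‖z‖) (by positivity) hp
    refine hup n z hz ?_
    rw [lt_div_iff₀ hz'] at hn
    exact hn.le
  have hent : Differentiable ℂ fun ζ => f (Complex.exp ζ) := fun ζ =>
    (hf.differentiableAt (isOpen_compl_singleton.mem_nhds (Complex.exp_ne_zero ζ))).comp ζ
      Complex.differentiable_exp.differentiableAt
  have hconst : ∀ z ≠ 0, ∀ w ≠ 0, f z = f w := by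
    intro z hz w hw
    have := hent.apply_eq_apply_of_bounded ((Metric.isBounded_iff_subset_closedBall 0).2 ⟨M, by
      rintro _ ⟨ζ, rfl⟩
      exact mem_closedBall_zero_iff.2 (hall _ (Complex.exp_ne_zero ζ))⟩)
        (Complex.log z) (Complex.log w)
    rwa [Complex.exp_log hz, Complex.exp_log hw] at this
  intro z hz
  set w : ℂ := ((2 * R : ℝ) : ℂ) with hw
  have hwn : ‖w‖ = 2 * R := by
    rw [hw, Complex.norm_real, Real.norm_eq_abs, abs_of_pos (by positivity)]
  have hw0 : w ≠ 0 := by rw [← norm_pos_iff, hwn]; positivity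
  have h1 : 1 < ‖c * w ^ m‖ := by
    have h2 : 1 ≤ ‖c * ((R : ℝ) : ℂ) ^ m‖ :=
      hlarge _ (by rw [Complex.norm_real]; exact le_abs_self _)
    have h3 : c * w ^ m = 2 ^ m * (c * ((R : ℝ) : ℂ) ^ m) := by rw [hw]; push_cast; ring
    rw [h3, norm_mul, norm_pow]
    have h4 : (1 : ℝ) < ‖(2 : ℂ)‖ ^ m := one_lt_pow₀ (by simp) hm
    nlinarith
  have h2 := hq w hw0
  rw [hconst _ (mul_ne_zero hp0 hw0) w hw0] at h2
  have h3 : (1 - c * w ^ m) * f w = 0 := by linear_combination h2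
  rcases mul_eq_zero.1 h3 with h4 | h4
  · rw [← sub_eq_zero.1 h4] at h1; simp at h1
  · rw [hconst z hz w hw0, h4]

/-- A theta function of degree `d`, `f (p z) = c z^(-d) f z`, with more than `d` zeros that are
inequivalent modulo `p^ℤ` vanishes. -/
theorem eq_zero_of_quasiperiodic (hp : ‖p‖ < 1) (hp0 : p ≠ 0) :
    ∀ (l : List ℂ) (d : ℤ) (c : ℂ) (f : ℂ → ℂ), d < l.length → DifferentiableOn ℂ f {0}ᶜ →
      (∀ z ≠ 0, f (p * z) = c * z ^ (-d) * f z) → (∀ a ∈ l, a ≠ 0 ∧ f a = 0) →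
      l.Pairwise (fun a b => ∀ n : ℤ, b ≠ a * p ^ n) → ∀ z ≠ 0, f z = 0 := by
  intro l
  induction l with
  | nil =>
    intro d c f hd hf hq _ _
    simp only [List.length_nil, Nat.cast_zero] at hd
    have hm : ((-d).toNat : ℤ) = -d := Int.toNat_of_nonneg (by omega)
    refine eq_zero_of_quasiperiodic_pos hp hp0 (c := c) (m := (-d).toNat) (by omega) hf ?_
    intro z hz
    rw [hq z hz, ← zpow_natCast z, hm]
  | cons a l ih =>
    intro d c f hd hf hq hz hpw
    obtain ⟨ha0, hfa⟩ := hz a (by simp)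
    rw [List.pairwise_cons] at hpw
    have hfz : ∀ n : ℤ, f (a * p ^ n) = 0 := by
      intro n
      induction n using Int.induction_on with
      | zero => simpa using hfa
      | succ n ihn =>
        have h1 := hq (a * p ^ (n : ℤ)) (mul_ne_zero ha0 (zpow_ne_zero _ hp0))
        rw [ihn, mul_zero] at h1
        rw [← h1, zpow_add₀ hp0, zpow_one]; ring_nf
      | pred n ihn =>
        have hne : a * p ^ (-(n : ℤ) - 1) ≠ 0 := mul_ne_zero ha0 (zpow_ne_zero _ hp0)
        have h1 := hq _ hne
        have h2 : p * (a * p ^ (-(n : ℤ) - 1)) = a * p ^ (-(n : ℤ)) := by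
          rw [zpow_sub₀ hp0, zpow_one]; field_simp
        rw [h2, ihn] at h1
        rcases mul_eq_zero.1 h1.symm with h3 | h3
        · rcases mul_eq_zero.1 h3 with h4 | h4
          · -- a vanishing multiplier forces `f = 0`
            have h5 := hq _ (div_ne_zero hne hp0)
            rwa [h4, zero_mul, zero_mul, mul_div_cancel₀ _ hp0] at h5
          · exact absurd h4 (zpow_ne_zero _ hne)
        · exact h3
    have hdiv : ∀ z : ℂ, z ≠ 0 → z / a ≠ 0 := fun z hz => div_ne_zero hz ha0
    have hΘ : DifferentiableOn ℂ (fun z => theta p (z / a)) {0}ᶜ := fun z hz =>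
      ((differentiableAt_id.div_const a).theta hp (hdiv z hz)).differentiableWithinAt
    obtain ⟨g, hg, hfg⟩ := exists_eq_mul_of_simple_zeros isOpen_compl_singleton hf hΘ (by
      intro z hz h0
      obtain ⟨n, hn⟩ := (theta_eq_zero_iff hp hp0 (hdiv z hz)).1 h0
      have hzn : z = a * p ^ n := by rw [← hn]; field_simp
      refine ⟨by rw [hzn]; exact hfz n, ?_⟩
      have h1 : HasDerivAt (fun z => theta p (z / a)) (deriv (theta p) (z / a) * (1 / a)) z :=
        HasDerivAt.comp z (h₂ := theta p) (h := fun z => z / a)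
          (differentiableAt_theta hp (hdiv z hz)).hasDerivAt ((hasDerivAt_id z).div_const a)
      rw [h1.deriv, hn]
      exact mul_ne_zero (deriv_theta_ne_zero hp hp0 n) (one_div_ne_zero ha0))
    have hgq : EqOn (fun z => g (p * z)) (fun z => -(c / a) * z ^ (-(d - 1)) * g z) {0}ᶜ := by
      obtain ⟨w, hw0, hw⟩ : ∃ w : ℂ, w ≠ 0 ∧ theta p (w / a) ≠ 0 := by
        by_contra! hcon
        refine deriv_theta_ne_zero hp hp0 0 ?_
        have : theta p =ᶠ[𝓝 (p ^ (0 : ℤ))] fun _ => 0 := by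
          filter_upwards [isOpen_compl_singleton.mem_nhds (zpow_ne_zero 0 hp0)] with z hz
          have := hcon (z * a) (mul_ne_zero hz ha0)
          rwa [mul_div_cancel_right₀ _ ha0] at this
        rw [this.deriv_eq]; simp
      have hgp : ∀ z : ℂ, z ≠ 0 → DifferentiableAt ℂ g z := fun z hz =>
        hg.differentiableAt (isOpen_compl_singleton.mem_nhds hz)
      have hL : ∀ z : ℂ, z ≠ 0 → DifferentiableAt ℂ (fun z => g (p * z)) z := fun z hz =>
        DifferentiableAt.comp z (g := g) (f := fun z => p * z) (hgp _ (mul_ne_zero hp0 hz))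
          (differentiableAt_id.const_mul p)
      have hR : ∀ z : ℂ, z ≠ 0 →
          DifferentiableAt ℂ (fun z => -(c / a) * z ^ (-(d - 1)) * g z) z := fun z hz => by
        have h1 : DifferentiableAt ℂ (fun z : ℂ => z ^ (-(d - 1))) z :=
          differentiableAt_zpow.2 (Or.inl hz)
        exact (h1.const_mul (-(c / a))).mul (hgp z hz)
      refine eqOn_compl_zero hL hR hw0 ?_
      have hcw : ContinuousAt (fun z => theta p (z / a)) w :=
        (hΘ.differentiableAt (isOpen_compl_singleton.mem_nhds hw0)).continuousAt
      filter_upwards [hcw.eventually_ne hw, isOpen_compl_singleton.mem_nhds hw0] with z hz hz0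
      have hz0' : z ≠ 0 := hz0
      have h1 := hq z hz0
      rw [hfg _ (mul_ne_zero hp0 hz0), hfg z hz0, mul_div_assoc, theta_mul hp hp0 (hdiv z hz0)] at h1
      have hzd : z ^ (-(d - 1)) = z ^ (-d) * z := by
        rw [neg_sub, sub_eq_add_neg, add_comm, zpow_add₀ hz0', zpow_one]
      rw [hzd]
      refine mul_left_cancel₀ hz ?_
      field_simp at h1 ⊢
      linear_combination -h1
    have hg0 := ih (d - 1) (-(c / a)) g (by simp at hd ⊢; omega) hg (fun z hz => hgq hz) (by
      intro b hb
      obtain ⟨hb0, hfb⟩ := hz b (by simp [hb])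
      refine ⟨hb0, ?_⟩
      rw [hfg b hb0] at hfb
      refine (mul_eq_zero.1 hfb).resolve_left fun h0 => ?_
      obtain ⟨n, hn⟩ := (theta_eq_zero_iff hp hp0 (hdiv b hb0)).1 h0
      exact hpw.1 b hb n (by rw [← hn]; field_simp)) hpw.2
    intro z hz
    rw [hfg z hz, hg0 z hz, mul_zero]

lemma theta_div_mul (hp : ‖p‖ < 1) (hp0 : p ≠ 0) {x z : ℂ} (hx : x ≠ 0) (hz : z ≠ 0) :
    theta p (x / (p * z)) = -(x / (p * z)) * theta p (x / z) := by
  have h := theta_mul hp hp0 (div_ne_zero hx (mul_ne_zero hp0 hz))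
  rw [show p * (x / (p * z)) = x / z by field_simp] at h
  rw [h]; field_simp

lemma theta_mul_mul (hp : ‖p‖ < 1) (hp0 : p ≠ 0) {x z : ℂ} (hx : x ≠ 0) (hz : z ≠ 0) :
    theta p (x * (p * z)) = -(x * z)⁻¹ * theta p (x * z) := by
  rw [← theta_mul hp hp0 (mul_ne_zero hx hz)]; ring_nf

lemma theta_sq_mul (hp : ‖p‖ < 1) (hp0 : p ≠ 0) {z : ℂ} (hz : z ≠ 0) :
    theta p ((p * z) ^ 2) = (p * z ^ 4)⁻¹ * theta p (z ^ 2) := by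
  have h2 : z ^ 2 ≠ 0 := pow_ne_zero 2 hz
  rw [show (p * z) ^ 2 = p * (p * z ^ 2) by ring, theta_mul hp hp0 (mul_ne_zero hp0 h2),
    theta_mul hp hp0 h2]
  field_simp

/-- The defect of the theta identity `theta_identity`, as a function of `z`. -/
def thetaDefect (p a b c d e f z : ℂ) : ℂ :=
  a * theta p (b / a) *
    (z⁻¹ * (theta p (a * z) * theta p (b * z) * theta p (c * z) * theta p (d * z) *
        theta p (e * z) * theta p (f * z)) -
      z ^ 3 * (theta p (a / z) * theta p (b / z) * theta p (c / z) * theta p (d / z) *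
        theta p (e / z) * theta p (f / z))) +
  theta p (z ^ 2) *
    (theta p (b * c) * theta p (b * d) * theta p (b * e) * theta p (b * f) *
        (theta p (a * z) * theta p (a / z)) -
      theta p (a * c) * theta p (a * d) * theta p (a * e) * theta p (a * f) *
        (theta p (b * z) * theta p (b / z)))

lemma thetaDefect_mul (hp : ‖p‖ < 1) (hp0 : p ≠ 0) {a b c d e f z : ℂ} (ha : a ≠ 0) (hb : b ≠ 0)
    (hc : c ≠ 0) (hd : d ≠ 0) (he : e ≠ 0) (hf : f ≠ 0) (hz : z ≠ 0)
    (hprod : a * b * c * d * e * f = p) :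
    thetaDefect p a b c d e f (p * z) = (p ^ 2)⁻¹ * z ^ (-6 : ℤ) * thetaDefect p a b c d e f z := by
  have hz6 : z ^ (-6 : ℤ) = (z ^ 6)⁻¹ := by rw [zpow_neg]; rfl
  have h1 : theta p (a * (p * z)) * theta p (b * (p * z)) * theta p (c * (p * z)) *
      theta p (d * (p * z)) * theta p (e * (p * z)) * theta p (f * (p * z)) =
      (p * z ^ 6)⁻¹ * (theta p (a * z) * theta p (b * z) * theta p (c * z) * theta p (d * z) *
        theta p (e * z) * theta p (f * z)) := by
    rw [theta_mul_mul hp hp0 ha hz, theta_mul_mul hp hp0 hb hz, theta_mul_mul hp hp0 hc hz,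
      theta_mul_mul hp hp0 hd hz, theta_mul_mul hp hp0 he hz, theta_mul_mul hp hp0 hf hz]
    rw [show (p * z ^ 6)⁻¹ = -(a * z)⁻¹ * -(b * z)⁻¹ * -(c * z)⁻¹ * -(d * z)⁻¹ * -(e * z)⁻¹ *
      -(f * z)⁻¹ by rw [← hprod]; field_simp]
    ring
  have h2 : theta p (a / (p * z)) * theta p (b / (p * z)) * theta p (c / (p * z)) *
      theta p (d / (p * z)) * theta p (e / (p * z)) * theta p (f / (p * z)) =
      (p ^ 5 * z ^ 6)⁻¹ * (theta p (a / z) * theta p (b / z) * theta p (c / z) * theta p (d / z) *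
        theta p (e / z) * theta p (f / z)) := by
    rw [theta_div_mul hp hp0 ha hz, theta_div_mul hp hp0 hb hz, theta_div_mul hp hp0 hc hz,
      theta_div_mul hp hp0 hd hz, theta_div_mul hp hp0 he hz, theta_div_mul hp hp0 hf hz]
    rw [show (p ^ 5 * z ^ 6)⁻¹ = (a * b * c * d * e * f) / (p * z) ^ 6 by rw [hprod]; field_simp]
    field_simp
  have h3 : ∀ x : ℂ, x ≠ 0 → theta p (x * (p * z)) * theta p (x / (p * z)) =
      (p * z ^ 2)⁻¹ * (theta p (x * z) * theta p (x / z)) := by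
    intro x hx
    rw [theta_mul_mul hp hp0 hx hz, theta_div_mul hp hp0 hx hz]
    field_simp
  unfold thetaDefect
  rw [h1, h2, h3 a ha, h3 b hb, theta_sq_mul hp hp0 hz, hz6]
  generalize theta p (a * z) * theta p (b * z) * theta p (c * z) * theta p (d * z) *
        theta p (e * z) * theta p (f * z) = X
  generalize theta p (a / z) * theta p (b / z) * theta p (c / z) * theta p (d / z) *
        theta p (e / z) * theta p (f / z) = Y
  generalize theta p (a * z) * theta p (a / z) = U
  generalize theta p (b * z) * theta p (b / z) = W
  generalize theta p (z ^ 2) = Q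
  generalize theta p (b / a) = S
  generalize theta p (b * c) * theta p (b * d) * theta p (b * e) * theta p (b * f) = B
  generalize theta p (a * c) * theta p (a * d) * theta p (a * e) * theta p (a * f) = A
  field_simp

lemma differentiableOn_thetaDefect (hp : ‖p‖ < 1) {a b c d e f : ℂ} (ha : a ≠ 0) (hb : b ≠ 0)
    (hc : c ≠ 0) (hd : d ≠ 0) (he : e ≠ 0) (hf : f ≠ 0) :
    DifferentiableOn ℂ (thetaDefect p a b c d e f) {0}ᶜ := by
  intro z hz
  refine DifferentiableAt.differentiableWithinAt ?_
  have hz0 : z ≠ 0 := hz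
  have hm : ∀ x : ℂ, x ≠ 0 → DifferentiableAt ℂ (fun z => theta p (x * z)) z := fun x hx =>
    DifferentiableAt.theta (f := fun z => x * z) hp (differentiableAt_id.const_mul x)
      (mul_ne_zero hx hz0)
  have hd' : ∀ x : ℂ, x ≠ 0 → DifferentiableAt ℂ (fun z => theta p (x / z)) z := fun x hx =>
    DifferentiableAt.theta (f := fun z => x / z) hp
      ((differentiableAt_const x).div differentiableAt_id hz0) (div_ne_zero hx hz0)
  have hs : DifferentiableAt ℂ (fun z => theta p (z ^ 2)) z :=
    DifferentiableAt.theta (f := fun z => z ^ 2) hp (differentiableAt_pow 2) (pow_ne_zero 2 hz0)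
  exact ((((differentiableAt_inv hz0).mul ((((((hm a ha).mul (hm b hb)).mul (hm c hc)).mul
    (hm d hd)).mul (hm e he)).mul (hm f hf))).sub ((differentiableAt_pow 3).mul
    ((((((hd' a ha).mul (hd' b hb)).mul (hd' c hc)).mul (hd' d hd)).mul (hd' e he)).mul
    (hd' f hf)))).const_mul _).add (hs.mul ((((hm a ha).mul (hd' a ha)).const_mul _).sub
    (((hm b hb).mul (hd' b hb)).const_mul _)))

lemma zpow_eq_one_iff_of_norm_lt (hp : ‖p‖ < 1) {n : ℤ} : p ^ n = 1 ↔ n = 0 := by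
  refine ⟨fun h => ?_, fun h => by simp [h]⟩
  have h1 : ‖p‖ ^ n = 1 := by simpa using congrArg norm h
  exact (zpow_eq_one_iff_right₀ (norm_nonneg p) hp.ne).1 h1

/-- Two numbers are inequivalent modulo `p^ℤ` if exactly one of the squares lies in `p^ℤ`. -/
lemma ne_mul_zpow_of_sq (hp0 : p ≠ 0) {x y : ℂ} {m : ℤ} (hy : y ^ 2 = p ^ m)
    (hx : ∀ n : ℤ, x ^ 2 ≠ p ^ n) (n : ℤ) : x ≠ y * p ^ n := by
  rintro rfl
  apply hx (m + 2 * n)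
  rw [mul_pow, hy, zpow_add₀ hp0, mul_comm 2 n, zpow_mul]
  rfl

/-- The case of `theta_identity` in which the seven zeros used are inequivalent. -/
lemma thetaDefect_eq_zero_of_generic (hp : ‖p‖ < 1) (hp0 : p ≠ 0) {a b c d e f : ℂ} (ha : a ≠ 0)
    (hb : b ≠ 0) (hc : c ≠ 0) (hd : d ≠ 0) (he : e ≠ 0) (hf : f ≠ 0)
    (hprod : a * b * c * d * e * f = p) (ha2 : ∀ n : ℤ, a ^ 2 ≠ p ^ n) (hb2 : ∀ n : ℤ, b ^ 2 ≠ p ^ n)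
    (hab : ∀ n : ℤ, a * b ≠ p ^ n) (hba : ∀ n : ℤ, b ≠ a * p ^ n) {z : ℂ} (hz : z ≠ 0) :
    thetaDefect p a b c d e f z = 0 := by
  obtain ⟨h, hh⟩ : ∃ h : ℂ, h ^ 2 = p := by
    obtain ⟨h, hh⟩ := IsAlgClosed.exists_pow_nat_eq p (n := 2) (by norm_num)
    exact ⟨h, hh⟩
  have hh0 : h ≠ 0 := by rintro rfl; simp at hh; exact hp0 hh.symm
  have hθ1 := theta_one hp hp0
  have hainv := theta_inv hp (pow_ne_zero 2 ha)
  have habinv : theta p (a / b) = -(a / b) * theta p (b / a) := by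
    have := theta_inv hp (div_ne_zero hb ha)
    rwa [inv_div] at this
  have hbinv := theta_inv hp (pow_ne_zero 2 hb)
  refine eq_zero_of_quasiperiodic hp hp0 [1, -1, h, a, a⁻¹, b, b⁻¹] 6 ((p ^ 2)⁻¹) _ (by simp)
    (differentiableOn_thetaDefect hp ha hb hc hd he hf)
    (fun z hz => thetaDefect_mul hp hp0 ha hb hc hd he hf hz hprod) ?_ ?_ z hz
  · have key : ∀ x : ℂ, x ≠ 0 → theta p (x * h) = -(h / x) * theta p (x / h) := by
      intro x hx
      have := theta_mul hp hp0 (div_ne_zero hx hh0)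
      rw [inv_div] at this
      rw [← this]
      congr 1
      rw [← hh]; field_simp
    intro x hx
    simp only [List.mem_cons, List.not_mem_nil, or_false] at hx
    rcases hx with rfl | rfl | rfl | rfl | rfl | rfl | rfl
    · refine ⟨one_ne_zero, ?_⟩
      simp [thetaDefect, hθ1]
    · refine ⟨by norm_num, ?_⟩
      have : (-1 : ℂ) ^ 2 = 1 := by norm_num
      simp only [thetaDefect, this, hθ1, mul_neg, mul_one, div_neg, div_one, inv_neg, inv_one]
      ring
    · refine ⟨hh0, ?_⟩
      have hp1 : theta p (x ^ 2) = 0 := by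
        rw [hh]; exact (theta_eq_zero_iff hp hp0 hp0).2 ⟨1, by simp⟩
      simp only [thetaDefect, hp1, key a ha, key b hb, key c hc, key d hd, key e he, key f hf]
      have hp' : x ^ 2 = a * b * c * d * e * f := by rw [hh, hprod]
      have : x⁻¹ * (-(x / a) * -(x / b) * -(x / c) * -(x / d) * -(x / e) * -(x / f)) = x ^ 3 := by
        have : -(x / a) * -(x / b) * -(x / c) * -(x / d) * -(x / e) * -(x / f) =
          x ^ 6 / (a * b * c * d * e * f) := by field_simp
        rw [this, ← hp']; field_simp
      linear_combination a * theta p (b / a) * (theta p (a / x) * theta p (b / x) *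
        theta p (c / x) * theta p (d / x) * theta p (e / x) * theta p (f / x)) * this
    · refine ⟨ha, ?_⟩
      simp only [thetaDefect, div_self ha, hθ1]
      field_simp
      ring_nf
    · refine ⟨inv_ne_zero ha, ?_⟩
      simp only [thetaDefect, mul_inv_cancel₀ ha, hθ1, div_inv_eq_mul, inv_pow, hainv]
      rw [← div_eq_mul_inv]
      field_simp
      ring_nf
    · refine ⟨hb, ?_⟩
      simp only [thetaDefect, div_self hb, hθ1, habinv]
      field_simp
      ring_nf
    · refine ⟨inv_ne_zero hb, ?_⟩
      simp only [thetaDefect, mul_inv_cancel₀ hb, hθ1, div_inv_eq_mul, inv_pow, hbinv]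
      rw [← div_eq_mul_inv, habinv]
      field_simp
      ring_nf
  · have hai : ∀ n : ℤ, a⁻¹ ^ 2 ≠ p ^ n := fun n h => ha2 (-n) (by
      rw [zpow_neg, ← h, inv_pow, inv_inv])
    have hbi : ∀ n : ℤ, b⁻¹ ^ 2 ≠ p ^ n := fun n h => hb2 (-n) (by
      rw [zpow_neg, ← h, inv_pow, inv_inv])
    have h1 : (1 : ℂ) ^ 2 = p ^ (0 : ℤ) := by simp
    have h2 : (-1 : ℂ) ^ 2 = p ^ (0 : ℤ) := by simp
    have h3 : h ^ 2 = p ^ (1 : ℤ) := by simpa using hh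
    have hpar : ∀ (x y : ℂ) (n : ℤ), x ^ 2 = 1 → y ^ 2 = p → y ≠ x * p ^ n := by
      rintro x y n hx hy rfl
      have h4 : p ^ (2 * n - 1) = 1 := by
        rw [zpow_sub₀ hp0, zpow_one, div_eq_one_iff_eq hp0, mul_comm 2 n, zpow_mul]
        rw [mul_pow, hx, one_mul] at hy
        exact hy
      have := (zpow_eq_one_iff_of_norm_lt hp).1 h4
      omega
    have h11 : ∀ n : ℤ, (-1 : ℂ) ≠ 1 * p ^ n := by
      intro n h4
      rw [one_mul] at h4
      have h5 : p ^ (n * 2) = 1 := by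
        rw [zpow_mul, ← h4]; norm_num
      have h6 := (zpow_eq_one_iff_of_norm_lt hp).1 h5
      rw [show n = 0 by omega, zpow_zero] at h4
      norm_num at h4
    simp only [List.pairwise_cons, List.mem_cons, List.not_mem_nil, or_false, forall_eq_or_imp,
      forall_eq, IsEmpty.forall_iff, implies_true, and_true, List.Pairwise.nil]
    refine ⟨⟨h11, fun n => hpar 1 h n (by simp) hh, ne_mul_zpow_of_sq hp0 h1 ha2,
      ne_mul_zpow_of_sq hp0 h1 hai, ne_mul_zpow_of_sq hp0 h1 hb2, ne_mul_zpow_of_sq hp0 h1 hbi⟩,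
      ⟨fun n => hpar (-1) h n (by simp) hh, ne_mul_zpow_of_sq hp0 h2 ha2,
      ne_mul_zpow_of_sq hp0 h2 hai, ne_mul_zpow_of_sq hp0 h2 hb2, ne_mul_zpow_of_sq hp0 h2 hbi⟩,
      ⟨ne_mul_zpow_of_sq hp0 h3 ha2, ne_mul_zpow_of_sq hp0 h3 hai, ne_mul_zpow_of_sq hp0 h3 hb2,
      ne_mul_zpow_of_sq hp0 h3 hbi⟩, ⟨fun n h4 => ha2 (-n) ?_, hba, fun n h4 => hab (-n) ?_⟩,
      ⟨fun n h4 => hab n ?_, fun n h4 => hba (-n) ?_⟩, fun n h4 => hb2 (-n) ?_⟩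
    all_goals
      have := zpow_ne_zero n hp0
      try rw [zpow_neg]
      field_simp at h4 ⊢
    all_goals first | exact h4 | exact h4.symm

lemma countable_sq_eq (c : ℂ) : {x : ℂ | x ^ 2 = c}.Countable := by
  obtain ⟨s, hs⟩ := IsAlgClosed.exists_pow_nat_eq c (n := 2) (by norm_num)
  refine Countable.mono (s₂ := {s, -s}) ?_ (by simp)
  intro x hx
  have hx' : x ^ 2 = c := hx
  rw [← hs] at hx'
  simpa using sq_eq_sq_iff_eq_or_eq_neg.1 hx'

/-- The theta identity behind the difference equation of the elliptic beta integral. -/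
theorem theta_identity (hp : ‖p‖ < 1) (hp0 : p ≠ 0) {a b c d e f : ℂ} (ha : a ≠ 0)
    (hb : b ≠ 0) (hc : c ≠ 0) (hd : d ≠ 0) (he : e ≠ 0) (hf : f ≠ 0)
    (hprod : a * b * c * d * e * f = p) (hab : ∀ n : ℤ, a * b ≠ p ^ n) {z : ℂ} (hz : z ≠ 0) :
    thetaDefect p a b c d e f z = 0 := by
  set T := a * b with hT
  have hT0 : T ≠ 0 := mul_ne_zero ha hb
  -- both sides are continuous in `a` for fixed `a * b`, and generic values of `a` are dense
  set L : ℂ → ℂ := fun x => thetaDefect p x (T / x) c d e f z with hL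
  have hbT : b = T / a := by rw [hT]; field_simp
  by_contra hne
  have hcont : ContinuousAt L a := by
    have hm : ∀ y : ℂ, y ≠ 0 → ContinuousAt (fun x => theta p (x * y)) a := fun y hy =>
      (DifferentiableAt.theta (f := fun x => x * y) hp (differentiableAt_id.mul_const y)
        (mul_ne_zero ha hy)).continuousAt
    have hd' : ∀ y : ℂ, y ≠ 0 → ContinuousAt (fun x => theta p (T / x * y)) a := fun y hy =>
      (DifferentiableAt.theta (f := fun x => T / x * y) hp
        (((differentiableAt_const T).div differentiableAt_id ha).mul_const y)
        (mul_ne_zero (div_ne_zero hT0 ha) hy)).continuousAt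
    have hs : ContinuousAt (fun x => theta p (T / x / x)) a :=
      (DifferentiableAt.theta (f := fun x => T / x / x) hp
        (((differentiableAt_const T).div differentiableAt_id ha).div differentiableAt_id ha)
        (div_ne_zero (div_ne_zero hT0 ha) ha)).continuousAt
    have hmz := hm z⁻¹ (inv_ne_zero hz)
    have hdz := hd' z⁻¹ (inv_ne_zero hz)
    simp only [← div_eq_mul_inv] at hmz hdz
    exact ((continuousAt_id.mul hs).mul ((continuousAt_const.mul ((((((hm z hz).mul (hd' z hz)).mul
      continuousAt_const).mul continuousAt_const).mul continuousAt_const).mul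
      continuousAt_const)).sub (continuousAt_const.mul (((((hmz.mul hdz).mul
      continuousAt_const).mul continuousAt_const).mul continuousAt_const).mul
      continuousAt_const)))).add (continuousAt_const.mul ((((((hd' c hc).mul (hd' d hd)).mul
      (hd' e he)).mul (hd' f hf)).mul ((hm z hz).mul hmz)).sub (((((hm c hc).mul (hm d hd)).mul
      (hm e he)).mul (hm f hf)).mul ((hd' z hz).mul hdz))))
  set B : Set ℂ := ⋃ n : ℤ, ({x : ℂ | x ^ 2 = p ^ n} ∪ {x : ℂ | x ^ 2 = T ^ 2 / p ^ n} ∪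
    {x : ℂ | x ^ 2 = T / p ^ n}) with hB
  have hBc : (B ∪ {0}).Countable := (countable_iUnion fun n =>
    ((countable_sq_eq _).union (countable_sq_eq _)).union (countable_sq_eq _)).union
      (countable_singleton 0)
  have hLa : L a ≠ 0 := by rw [hL]; simp only; rwa [← hbT]
  obtain ⟨x, hx1, hx2⟩ := (hBc.dense_compl ℝ).inter_nhds_nonempty (hcont.eventually_ne hLa)
  refine hx2 ?_
  simp only [mem_compl_iff, mem_union, mem_singleton_iff, not_or] at hx1
  obtain ⟨hxB, hx0⟩ := hx1
  simp only [hB, mem_iUnion, mem_union, mem_ofPred_eq, not_exists, not_or] at hxB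
  have hTx : T / x ≠ 0 := div_ne_zero hT0 hx0
  refine thetaDefect_eq_zero_of_generic hp hp0 hx0 hTx hc hd he hf ?_
    (fun n => (hxB n).1.1) (fun n h => (hxB n).1.2 ?_) (fun n h => hab n ?_)
    (fun n h => (hxB n).2 ?_) hz
  · rw [← hprod, mul_div_cancel₀ _ hx0]
  · have := zpow_ne_zero n hp0
    rw [← h]; field_simp
  · rw [← h]; field_simp
  · have := zpow_ne_zero n hp0
    field_simp at h ⊢
    exact h.symm

/-! ### Circles -/

namespace Contour

/-- The positively oriented circle with centre `c` and radius `R`. -/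
def circle (c : ℂ) (R : ℝ) : Contour where
  toFun θ := circleMap c R (2 * Real.pi * θ)
  continuousOn := by fun_prop
  closed := by
    have := periodic_circleMap c R 0
    simp only [mul_zero, mul_one]
    rw [← this, zero_add]
  piecewise_C1 := by
    have hd : ∀ θ : ℝ, HasDerivAt (fun θ : ℝ => circleMap c R (2 * Real.pi * θ))
        ((2 * Real.pi : ℝ) • (circleMap 0 R (2 * Real.pi * θ) * Complex.I)) θ := fun θ =>
      (hasDerivAt_circleMap c R (2 * Real.pi * θ)).scomp θ
        (by simpa using (hasDerivAt_id θ).const_mul (2 * Real.pi))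
    refine ⟨∅, 2 * Real.pi * |R|, fun θ _ _ => ⟨(hd θ).differentiableAt, ?_, ?_⟩⟩
    · rw [show deriv (fun θ : ℝ => circleMap c R (2 * Real.pi * θ)) = _ from
        funext fun θ => (hd θ).deriv]
      fun_prop
    · rw [(hd θ).deriv]
      simp [abs_of_pos Real.pi_pos]

lemma integral_circle (c : ℂ) (R : ℝ) (f : ℂ → ℂ) :
    (circle c R).integral f = ∮ z in C(c, R), f z := by
  have hd : ∀ θ : ℝ, deriv (circle c R).toFun θ =
      (2 * Real.pi : ℝ) • deriv (circleMap c R) (2 * Real.pi * θ) := fun θ => by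
    rw [deriv_circleMap]
    exact ((hasDerivAt_circleMap c R (2 * Real.pi * θ)).scomp θ
        (by simpa using (hasDerivAt_id θ).const_mul (2 * Real.pi))).deriv
  rw [integral, circleIntegral]
  simp only [hd]
  have := intervalIntegral.smul_integral_comp_mul_left (a := 0) (b := 1)
    (fun θ => deriv (circleMap c R) θ • f (circleMap c R θ)) (2 * Real.pi)
  rw [mul_zero, mul_one, ← intervalIntegral.integral_smul] at this
  rw [← this]
  refine intervalIntegral.integral_congr fun θ _ => ?_
  simp only [circle, smul_eq_mul, Complex.real_smul]
  ring

lemma trace_circle (c : ℂ) {R : ℝ} (hR : 0 ≤ R) : (circle c R).trace = Metric.sphere c R := by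
  refine Subset.antisymm ?_ fun z hz => ?_
  · rintro _ ⟨θ, -, rfl⟩
    exact circleMap_mem_sphere c hR _
  · rw [← abs_of_nonneg hR, ← image_circleMap_Ioc] at hz
    obtain ⟨θ, hθ, rfl⟩ := hz
    refine ⟨θ / (2 * Real.pi), ⟨by have := hθ.1; positivity, ?_⟩, ?_⟩
    · rw [div_le_one Real.two_pi_pos]; exact hθ.2
    · simp only [circle]
      rw [mul_div_cancel₀ _ Real.two_pi_pos.ne']

lemma winding_circle_of_lt {c a : ℂ} {R : ℝ} (h : dist a c < R) : (circle c R).winding a = 1 := by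
  rw [winding, integral_circle, circleIntegral.integral_sub_inv_of_mem_ball h,
    inv_mul_cancel₀ Complex.two_pi_I_ne_zero]

lemma winding_circle_of_gt {c a : ℂ} {R : ℝ} (hR : 0 ≤ R) (h : R < dist a c) :
    (circle c R).winding a = 0 := by
  rw [winding, integral_circle, mul_eq_zero]
  right
  have hne : ∀ z ∈ Metric.closedBall c R, z - a ≠ 0 := fun z hz h0 => by
    rw [sub_eq_zero.1 h0, Metric.mem_closedBall] at hz; linarith
  refine Complex.circleIntegral_eq_zero_of_differentiable_on_off_countable hR countable_empty
    ((continuousOn_id.sub continuousOn_const).inv₀ hne) fun z hz => ?_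
  exact ((differentiableAt_id.sub_const a)).inv (hne z (Metric.ball_subset_closedBall hz.1))

/-- Contour integrals depend holomorphically on a parameter if the integrand is continuous in both
variables and holomorphic in the parameter. -/
lemma differentiableOn_integral (C : Contour) {F : ℂ → ℂ → ℂ} {U : Set ℂ} (hU : IsOpen U)
    (hcont : ContinuousOn (fun x : ℂ × ℂ => F x.1 x.2) (U ×ˢ C.trace))
    (hdiff : ∀ w ∈ C.trace, DifferentiableOn ℂ (fun z => F z w) U) :
    DifferentiableOn ℂ (fun z => C.integral (F z)) U := by
  intro a ha
  obtain ⟨R, hR, hball⟩ := Metric.isOpen_iff.1 hU a ha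
  have hsub : Metric.closedBall a (R / 2) ⊆ U :=
    (Metric.closedBall_subset_ball (by linarith)).trans hball
  obtain ⟨M, hM⟩ := ((isCompact_closedBall a (R / 2)).prod C.isCompact_trace).exists_bound_of_continuousOn
    (hcont.mono (prod_mono hsub Subset.rfl))
  have hb : Metric.ball a (R / 2) ⊆ U := Metric.ball_subset_closedBall.trans hsub
  refine (C.differentiableAt_integral (R := R / 2) (M := M) (by positivity) ?_ ?_ ?_)
    |>.differentiableWithinAt
  · intro z hz
    exact hcont.comp (f := fun w => (z, w)) (by fun_prop) fun w hw => ⟨hb hz, hw⟩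
  · intro z hz w hw
    exact hM (z, w) ⟨Metric.ball_subset_closedBall hz, hw⟩
  · exact fun w hw => (hdiff w hw).mono hb

end Contour

lemma circleIntegral_inv_mul (R : ℝ) (hR : R ≠ 0) (g : ℂ → ℂ) :
    (∮ z in C(0, R), z⁻¹ * g z) =
      Complex.I * ∫ θ in (0 : ℝ)..2 * Real.pi, g (circleMap 0 R θ) := by
  rw [circleIntegral, ← intervalIntegral.integral_const_mul]
  refine intervalIntegral.integral_congr fun θ _ => ?_
  have := circleMap_ne_center (c := 0) (θ := θ) hR
  simp only [deriv_circleMap, smul_eq_mul]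
  field_simp

lemma circleIntegral_comp_mul {w : ℂ} (hw : w ≠ 0) {R : ℝ} (hR : R ≠ 0) (g : ℂ → ℂ) :
    (∮ z in C(0, R), z⁻¹ * g (w * z)) = ∮ z in C(0, ‖w‖ * R), z⁻¹ * g z := by
  rw [circleIntegral_inv_mul R hR, circleIntegral_inv_mul _ (mul_ne_zero (norm_ne_zero_iff.2 hw) hR)]
  congr 1
  have h1 : ∀ θ : ℝ, w * circleMap 0 R θ = circleMap 0 (‖w‖ * R) (θ + Complex.arg w) := by
    intro θ
    simp only [circleMap, zero_add]
    conv_lhs => rw [← Complex.norm_mul_exp_arg_mul_I w]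
    push_cast
    rw [add_mul, Complex.exp_add]; ring
  simp only [h1]
  have hper : Function.Periodic (fun θ => g (circleMap 0 (‖w‖ * R) θ)) (2 * Real.pi) :=
    (periodic_circleMap 0 (‖w‖ * R)).comp g
  rw [intervalIntegral.integral_comp_add_right (fun θ => g (circleMap 0 (‖w‖ * R) θ))]
  have := hper.intervalIntegral_add_eq (0 + Complex.arg w) 0
  rw [zero_add] at this ⊢
  rw [add_comm (2 * Real.pi), this, zero_add]

lemma circleIntegral_comp_inv (g : ℂ → ℂ) :
    (∮ z in C(0, 1), z⁻¹ * g z⁻¹) = ∮ z in C(0, 1), z⁻¹ * g z := by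
  rw [circleIntegral_inv_mul 1 one_ne_zero, circleIntegral_inv_mul 1 one_ne_zero]
  congr 1
  have h1 : ∀ θ : ℝ, (circleMap 0 1 θ)⁻¹ = circleMap 0 1 (-θ) := by
    intro θ
    simp only [circleMap, zero_add, Complex.ofReal_one, one_mul, ← Complex.exp_neg]
    push_cast; ring_nf
  simp only [h1]
  have hper : Function.Periodic (fun θ => g (circleMap 0 1 θ)) (2 * Real.pi) :=
    (periodic_circleMap 0 1).comp g
  rw [intervalIntegral.integral_comp_neg (fun θ => g (circleMap 0 1 θ))]
  have := hper.intervalIntegral_add_eq (-(2 * Real.pi)) 0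
  rw [neg_add_cancel, zero_add] at this
  rw [neg_zero, this]

/-! ### The difference equation -/

/-- `Γ(a z^{±1})`. -/
def gammaPair (p q a z : ℂ) : ℂ := ellGamma p q (a * z) * ellGamma p q (a / z)

/-- The integrand of the elliptic beta integral with respect to `dz / z`. -/
def betaIntegrand (p q a b c d e f z : ℂ) : ℂ :=
  weight p q (z ^ 2) * (gammaPair p q a z * gammaPair p q b z * gammaPair p q c z *
    gammaPair p q d z * gammaPair p q e z * gammaPair p q f z)

/-- The value of the elliptic beta integral. -/
def betaProd (p q a b c d e f : ℂ) : ℂ :=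
  ellGamma p q (a * b) *
  (ellGamma p q (a * c) * ellGamma p q (a * d) * ellGamma p q (a * e) * ellGamma p q (a * f)) *
  (ellGamma p q (b * c) * ellGamma p q (b * d) * ellGamma p q (b * e) * ellGamma p q (b * f)) *
  (ellGamma p q (c * d) * ellGamma p q (c * e) * ellGamma p q (c * f) *
   ellGamma p q (d * e) * ellGamma p q (d * f) * ellGamma p q (e * f))

lemma differentiableAt_ellGamma (hp : ‖p‖ < 1) (hq : ‖q‖ < 1) {x : ℂ} (hx : x ≠ 0)
    (h : dPoch p q x ≠ 0) : DifferentiableAt ℂ (ellGamma p q) x := by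
  have hE := differentiable_dPoch hp hq
  rw [show ellGamma p q = _ from funext fun z => ellGamma_eq hp hq z]
  exact ((hE _).comp x (f := fun z => p * q / z)
    ((differentiableAt_const _).div differentiableAt_id hx)).div (hE x) h

lemma norm_ne_zero_of_eq_one {z : ℂ} (hz : ‖z‖ = 1) : z ≠ 0 := by
  rintro rfl; simp at hz

lemma differentiableAt_weight (hp : ‖p‖ < 1) (hq : ‖q‖ < 1) {x : ℂ} (hx : x ≠ 0) :
    DifferentiableAt ℂ (weight p q) x := by
  have h1 := differentiable_qPoch hp
  have h2 := differentiable_qPoch hq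
  unfold weight
  have hi : DifferentiableAt ℂ (fun x : ℂ => x⁻¹) x := differentiableAt_inv hx
  exact ((h1 x).mul ((h2 _).comp x (f := fun x => q * x) (by fun_prop))).mul
    (((h1 _).comp x (f := fun x => x⁻¹) hi).mul ((h2 _).comp x (f := fun x => q * x⁻¹)
      (hi.const_mul q)))

lemma gammaPair_mul_left (hp : ‖p‖ < 1) (hq : ‖q‖ < 1) (hq0 : q ≠ 0) {a z : ℂ} (ha : ‖a‖ < 1)
    (hz : ‖z‖ = 1) :
    gammaPair p q (q * a) z = theta p (a * z) * theta p (a / z) * gammaPair p q a z := by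
  have h1 : ‖a * z‖ < 1 := by rw [norm_mul, hz, mul_one]; exact ha
  have h2 : ‖a / z‖ < 1 := by rw [norm_div, hz, div_one]; exact ha
  rw [gammaPair, gammaPair, mul_assoc q, mul_div_assoc q,
    ellGamma_mul_left hp hq hq0 (qPoch_ne_zero_of_norm_lt hp h1),
    ellGamma_mul_left hp hq hq0 (qPoch_ne_zero_of_norm_lt hp h2)]
  ring

/-- A function whose integral against `dz / z` over the unit circle vanishes: it is holomorphic in the
annulus `1 ≤ |z| ≤ |q|⁻¹`, and its values at `q⁻¹ z` and `z⁻¹` differ by the sign. -/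
def shiftIntegrand (p q a b c d e f z : ℂ) : ℂ :=
  z⁻¹ * theta q (z ^ 2)⁻¹ *
    ((ellGamma p q (q * a * z) * ellGamma p q (a / z)) *
      (ellGamma p q (q * b * z) * ellGamma p q (b / z)) *
      (ellGamma p q (q * c * z) * ellGamma p q (c / z)) *
      (ellGamma p q (q * d * z) * ellGamma p q (d / z)) *
      (ellGamma p q (q * e * z) * ellGamma p q (e / z)) *
      (ellGamma p q (q * f * z) * ellGamma p q (f / z)))

lemma shiftIntegrand_div (hq : ‖q‖ < 1) (hq0 : q ≠ 0) (a b c d e f : ℂ) {z : ℂ} (hz : z ≠ 0) :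
    shiftIntegrand p q a b c d e f (q⁻¹ * z) = -shiftIntegrand p q a b c d e f z⁻¹ := by
  have hz2 : z ^ 2 ≠ 0 := pow_ne_zero 2 hz
  have h1 : ∀ x : ℂ, ellGamma p q (q * x * (q⁻¹ * z)) * ellGamma p q (x / (q⁻¹ * z)) =
      ellGamma p q (q * x * z⁻¹) * ellGamma p q (x / z⁻¹) := by
    intro x
    rw [show q * x * (q⁻¹ * z) = x / z⁻¹ by field_simp,
      show x / (q⁻¹ * z) = q * x * z⁻¹ by field_simp]
    ring
  have h2 : theta q ((q⁻¹ * z) ^ 2)⁻¹ = q⁻¹ * z ^ 4 * theta q (z ^ 2)⁻¹ := by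
    rw [show ((q⁻¹ * z) ^ 2)⁻¹ = q * (q * (z ^ 2)⁻¹) by field_simp,
      theta_mul hq hq0 (mul_ne_zero hq0 (inv_ne_zero hz2)), theta_mul hq hq0 (inv_ne_zero hz2)]
    field_simp
  have h3 : theta q ((z⁻¹) ^ 2)⁻¹ = -z ^ 2 * theta q (z ^ 2)⁻¹ := by
    rw [theta_inv hq hz2, inv_pow, inv_inv]; field_simp
  unfold shiftIntegrand
  rw [h1 a, h1 b, h1 c, h1 d, h1 e, h1 f, h2, h3, inv_inv]
  have h4 : (q⁻¹ * z)⁻¹ * (q⁻¹ * z ^ 4) = z ^ 3 := by field_simp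
  rw [← neg_mul]
  congr 1
  linear_combination theta q (z ^ 2)⁻¹ * h4

lemma differentiableAt_shiftIntegrand (hp : ‖p‖ < 1) (hq : ‖q‖ < 1) (hq0 : q ≠ 0) {a b c d e f : ℂ}
    (ha0 : a ≠ 0) (hb0 : b ≠ 0) (hc0 : c ≠ 0) (hd0 : d ≠ 0) (he0 : e ≠ 0) (hf0 : f ≠ 0)
    (ha : ‖a‖ < 1) (hb : ‖b‖ < 1) (hc : ‖c‖ < 1) (hd : ‖d‖ < 1) (he : ‖e‖ < 1) (hf : ‖f‖ < 1)
    {z : ℂ} (hz : z ∈ Metric.closedBall (0 : ℂ) ‖q⁻¹‖ \ Metric.ball 0 1) :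
    DifferentiableAt ℂ (shiftIntegrand p q a b c d e f) z := by
  obtain ⟨hz1, hz2⟩ := hz
  rw [mem_closedBall_zero_iff, norm_inv] at hz1
  rw [mem_ball_zero_iff, not_lt] at hz2
  have hz0 : z ≠ 0 := by rw [← norm_pos_iff]; linarith
  have hfac : ∀ x : ℂ, x ≠ 0 → ‖x‖ < 1 →
      DifferentiableAt ℂ (fun z => ellGamma p q (q * x * z) * ellGamma p q (x / z)) z := by
    intro x hx0 hx
    have h1 : ‖q * x * z‖ < 1 := by
      rw [norm_mul, norm_mul]
      calc ‖q‖ * ‖x‖ * ‖z‖ ≤ ‖q‖ * ‖x‖ * ‖q‖⁻¹ := by gcongr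
        _ = ‖x‖ := by field_simp
        _ < 1 := hx
    have h2 : ‖x / z‖ < 1 := by
      rw [norm_div]
      exact (div_le_self (norm_nonneg _) hz2).trans_lt hx
    exact ((differentiableAt_ellGamma hp hq (mul_ne_zero (mul_ne_zero hq0 hx0) hz0)
      (dPoch_ne_zero_of_norm_lt hp hq h1)).comp z (f := fun z => q * x * z)
      (differentiableAt_id.const_mul _)).mul
      ((differentiableAt_ellGamma hp hq (div_ne_zero hx0 hz0)
      (dPoch_ne_zero_of_norm_lt hp hq h2)).comp z (f := fun z => x / z)
      ((differentiableAt_const _).div differentiableAt_id hz0))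
  have hθ : DifferentiableAt ℂ (fun z => theta q (z ^ 2)⁻¹) z :=
    DifferentiableAt.theta (f := fun z => (z ^ 2)⁻¹) hq
      ((differentiableAt_pow 2).inv (pow_ne_zero 2 hz0)) (inv_ne_zero (pow_ne_zero 2 hz0))
  exact ((differentiableAt_inv hz0).mul hθ).mul ((((((hfac a ha0 ha).mul (hfac b hb0 hb)).mul
    (hfac c hc0 hc)).mul (hfac d hd0 hd)).mul (hfac e he0 he)).mul (hfac f hf0 hf))

lemma integral_shiftIntegrand (hp : ‖p‖ < 1) (hq : ‖q‖ < 1) (hq0 : q ≠ 0) {a b c d e f : ℂ}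
    (ha0 : a ≠ 0) (hb0 : b ≠ 0) (hc0 : c ≠ 0) (hd0 : d ≠ 0) (he0 : e ≠ 0) (hf0 : f ≠ 0)
    (ha : ‖a‖ < 1) (hb : ‖b‖ < 1) (hc : ‖c‖ < 1) (hd : ‖d‖ < 1) (he : ‖e‖ < 1) (hf : ‖f‖ < 1) :
    (∮ z in C(0, 1), z⁻¹ * shiftIntegrand p q a b c d e f z) = 0 := by
  have hqn : 0 < ‖q‖ := norm_pos_iff.2 hq0
  have hdiff : ∀ z ∈ Metric.closedBall (0 : ℂ) ‖q⁻¹‖ \ Metric.ball 0 1,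
      DifferentiableAt ℂ (shiftIntegrand p q a b c d e f) z :=
    fun z hz => differentiableAt_shiftIntegrand hp hq hq0 ha0 hb0 hc0 hd0 he0 hf0 ha hb hc hd he hf
      hz
  have hann := Complex.circleIntegral_sub_center_inv_smul_eq_of_differentiable_on_annulus_off_countable
    (c := 0) (r := 1) (R := ‖q⁻¹‖) one_pos (by rw [norm_inv]; exact (one_le_inv₀ hqn).2 hq.le)
    countable_empty (f := shiftIntegrand p q a b c d e f)
    (fun z hz => (hdiff z hz).continuousAt.continuousWithinAt)
    (fun z hz => hdiff z ⟨Metric.ball_subset_closedBall hz.1.1, fun h =>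
      hz.1.2 (Metric.ball_subset_closedBall h)⟩)
  simp only [sub_zero, smul_eq_mul] at hann
  have h1 := circleIntegral_comp_mul (inv_ne_zero hq0) one_ne_zero (shiftIntegrand p q a b c d e f)
  rw [mul_one, hann] at h1
  have h2 : (∮ z in C(0, 1), z⁻¹ * shiftIntegrand p q a b c d e f (q⁻¹ * z)) =
      -∮ z in C(0, 1), z⁻¹ * shiftIntegrand p q a b c d e f z := by
    rw [← circleIntegral_comp_inv (shiftIntegrand p q a b c d e f), ← neg_one_mul, ← circleIntegral.integral_const_mul]
    refine circleIntegral.integral_congr zero_le_one fun z hz => ?_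
    have hz0 : z ≠ 0 := norm_ne_zero_of_eq_one (by simpa using hz)
    rw [shiftIntegrand_div hq hq0 a b c d e f hz0]; ring
  rw [h2] at h1
  linear_combination (-1 / 2) * h1

lemma DifferentiableAt.gammaPair_comp {X : Type*} [NormedAddCommGroup X] [NormedSpace ℂ X]
    (hp : ‖p‖ < 1) (hq : ‖q‖ < 1) {α ζ : X → ℂ} {x : X} (hα : DifferentiableAt ℂ α x)
    (hζ : DifferentiableAt ℂ ζ x) (h0 : α x ≠ 0) (hz : ζ x ≠ 0)
    (h1 : dPoch p q (α x * ζ x) ≠ 0) (h2 : dPoch p q (α x / ζ x) ≠ 0) :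
    DifferentiableAt ℂ (fun y => gammaPair p q (α y) (ζ y)) x := by
  have h3 : DifferentiableAt ℂ (fun y => ellGamma p q (α y * ζ y)) x :=
    (differentiableAt_ellGamma hp hq (mul_ne_zero h0 hz) h1).comp x (f := fun y => α y * ζ y)
      (hα.mul hζ)
  have h4 : DifferentiableAt ℂ (fun y => ellGamma p q (α y / ζ y)) x :=
    (differentiableAt_ellGamma hp hq (div_ne_zero h0 hz) h2).comp x (f := fun y => α y / ζ y)
      (by
        simp only [div_eq_mul_inv]
        exact hα.mul ((differentiableAt_inv hz).comp x hζ))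
  exact h3.mul h4

lemma DifferentiableAt.weight_sq_comp {X : Type*} [NormedAddCommGroup X] [NormedSpace ℂ X]
    (hp : ‖p‖ < 1) (hq : ‖q‖ < 1) {ζ : X → ℂ} {x : X}
    (hζ : DifferentiableAt ℂ ζ x) (hz : ζ x ≠ 0) :
    DifferentiableAt ℂ (fun y => weight p q (ζ y ^ 2)) x :=
  (differentiableAt_weight hp hq (pow_ne_zero 2 hz)).comp x (f := fun y => ζ y ^ 2) (hζ.pow 2)

lemma gammaPair_factors_ne_zero (hp : ‖p‖ < 1) (hq : ‖q‖ < 1) {a z : ℂ} (ha : ‖a‖ < 1)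
    (hz : ‖z‖ = 1) : dPoch p q (a * z) ≠ 0 ∧ dPoch p q (a / z) ≠ 0 :=
  ⟨dPoch_ne_zero_of_norm_lt hp hq (by rwa [norm_mul, hz, mul_one]),
    dPoch_ne_zero_of_norm_lt hp hq (by rwa [norm_div, hz, div_one])⟩

/-- On the unit circle the integrand is holomorphic in all parameters of modulus less than `1`. -/
lemma DifferentiableAt.betaIntegrand_comp {X : Type*} [NormedAddCommGroup X] [NormedSpace ℂ X]
    (hp : ‖p‖ < 1) (hq : ‖q‖ < 1) {a b c d e f ζ : X → ℂ} {x : X}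
    (ha : DifferentiableAt ℂ a x) (hb : DifferentiableAt ℂ b x) (hc : DifferentiableAt ℂ c x)
    (hd : DifferentiableAt ℂ d x) (he : DifferentiableAt ℂ e x) (hf : DifferentiableAt ℂ f x)
    (hζ : DifferentiableAt ℂ ζ x) (hz : ‖ζ x‖ = 1) (ha0 : a x ≠ 0) (hb0 : b x ≠ 0)
    (hc0 : c x ≠ 0) (hd0 : d x ≠ 0) (he0 : e x ≠ 0) (hf0 : f x ≠ 0) (ha1 : ‖a x‖ < 1)
    (hb1 : ‖b x‖ < 1) (hc1 : ‖c x‖ < 1) (hd1 : ‖d x‖ < 1) (he1 : ‖e x‖ < 1) (hf1 : ‖f x‖ < 1) :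
    DifferentiableAt ℂ (fun y => betaIntegrand p q (a y) (b y) (c y) (d y) (e y) (f y) (ζ y)) x := by
  have hz0 := norm_ne_zero_of_eq_one hz
  have key : ∀ {g : X → ℂ}, DifferentiableAt ℂ g x → g x ≠ 0 → ‖g x‖ < 1 →
      DifferentiableAt ℂ (fun y => gammaPair p q (g y) (ζ y)) x := fun hg h0 h1 =>
    DifferentiableAt.gammaPair_comp hp hq hg hζ h0 hz0 (gammaPair_factors_ne_zero hp hq h1 hz).1
      (gammaPair_factors_ne_zero hp hq h1 hz).2
  exact (DifferentiableAt.weight_sq_comp hp hq hζ hz0).mul ((((((key ha ha0 ha1).mul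
    (key hb hb0 hb1)).mul (key hc hc0 hc1)).mul (key hd hd0 hd1)).mul (key he he0 he1)).mul
    (key hf hf0 hf1))

/-- The elliptic beta integral over the unit circle, without the constant in front. -/
def betaIntegral (p q a b c d e f : ℂ) : ℂ :=
  ∮ z in C(0, 1), z⁻¹ * betaIntegrand p q a b c d e f z

lemma circleIntegrable_betaIntegrand (hp : ‖p‖ < 1) (hq : ‖q‖ < 1) {a b c d e f : ℂ}
    (ha0 : a ≠ 0) (hb0 : b ≠ 0) (hc0 : c ≠ 0) (hd0 : d ≠ 0) (he0 : e ≠ 0) (hf0 : f ≠ 0)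
    (ha : ‖a‖ < 1) (hb : ‖b‖ < 1) (hc : ‖c‖ < 1) (hd : ‖d‖ < 1) (he : ‖e‖ < 1) (hf : ‖f‖ < 1) :
    CircleIntegrable (fun z => z⁻¹ * betaIntegrand p q a b c d e f z) 0 1 := by
  refine ContinuousOn.circleIntegrable zero_le_one fun z hz => ContinuousAt.continuousWithinAt ?_
  have hz1 : ‖z‖ = 1 := by simpa using hz
  refine ContinuousAt.mul (continuousAt_inv₀ (norm_ne_zero_of_eq_one hz1)) ?_
  exact (DifferentiableAt.betaIntegrand_comp hp hq (differentiableAt_const a)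
    (differentiableAt_const b) (differentiableAt_const c) (differentiableAt_const d)
    (differentiableAt_const e) (differentiableAt_const f) differentiableAt_id hz1 ha0 hb0 hc0 hd0
    he0 hf0 ha hb hc hd he hf).continuousAt

lemma shiftIntegrand_add (hp : ‖p‖ < 1) (hq : ‖q‖ < 1) (hp0 : p ≠ 0) (hq0 : q ≠ 0)
    {a b c d e f : ℂ}
    (ha0 : a ≠ 0) (hb0 : b ≠ 0) (hc0 : c ≠ 0) (hd0 : d ≠ 0) (he0 : e ≠ 0) (hf0 : f ≠ 0)
    (ha : ‖a‖ < 1) (hb : ‖b‖ < 1) (hc : ‖c‖ < 1) (hd : ‖d‖ < 1) (he : ‖e‖ < 1) (hf : ‖f‖ < 1)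
    (hprod : a * b * c * d * e * f = p) (hab : ∀ n : ℤ, a * b ≠ p ^ n) {z : ℂ} (hz : ‖z‖ = 1) :
    a * theta p (b / a) * (shiftIntegrand p q a b c d e f z + shiftIntegrand p q a b c d e f z⁻¹) =
      theta p (a * c) * theta p (a * d) * theta p (a * e) * theta p (a * f) *
        betaIntegrand p q a (q * b) c d e f z -
      theta p (b * c) * theta p (b * d) * theta p (b * e) * theta p (b * f) *
        betaIntegrand p q (q * a) b c d e f z := by
  have hz0 := norm_ne_zero_of_eq_one hz
  have hid := theta_identity hp hp0 ha0 hb0 hc0 hd0 he0 hf0 hprod hab hz0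
  have h1 : ∀ x : ℂ, ‖x‖ < 1 → ellGamma p q (q * x * z) = theta p (x * z) * ellGamma p q (x * z) :=
    fun x hx => by
      rw [mul_assoc, ellGamma_mul_left hp hq hq0 (qPoch_ne_zero_of_norm_lt hp
        (by rwa [norm_mul, hz, mul_one]))]
  have h2 : ∀ x : ℂ, ‖x‖ < 1 → ellGamma p q (q * x * z⁻¹) = theta p (x / z) * ellGamma p q (x / z) :=
    fun x hx => by
      rw [mul_assoc, ← div_eq_mul_inv, ellGamma_mul_left hp hq hq0 (qPoch_ne_zero_of_norm_lt hp
        (by rwa [norm_div, hz, div_one]))]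
  have h3 : theta q ((z⁻¹) ^ 2)⁻¹ = -z ^ 2 * theta q (z ^ 2)⁻¹ := by
    rw [theta_inv hq (pow_ne_zero 2 hz0), inv_pow, inv_inv]; field_simp
  rw [betaIntegrand, betaIntegrand, gammaPair_mul_left hp hq hq0 ha hz,
    gammaPair_mul_left hp hq hq0 hb hz, weight_eq_theta hp hq, shiftIntegrand, shiftIntegrand, h3,
    h1 a ha, h1 b hb, h1 c hc, h1 d hd, h1 e he, h1 f hf, h2 a ha, h2 b hb, h2 c hc, h2 d hd,
    h2 e he, h2 f hf]
  simp only [div_inv_eq_mul, inv_inv, gammaPair]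
  unfold thetaDefect at hid
  linear_combination theta q (z ^ 2)⁻¹ * ((ellGamma p q (a * z) * ellGamma p q (a / z)) *
    (ellGamma p q (b * z) * ellGamma p q (b / z)) * (ellGamma p q (c * z) * ellGamma p q (c / z)) *
    (ellGamma p q (d * z) * ellGamma p q (d / z)) * (ellGamma p q (e * z) * ellGamma p q (e / z)) *
    (ellGamma p q (f * z) * ellGamma p q (f / z))) * hid

/-- The difference equation of the elliptic beta integral. -/
lemma betaIntegral_shift (hp : ‖p‖ < 1) (hq : ‖q‖ < 1) (hp0 : p ≠ 0) (hq0 : q ≠ 0)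
    {a b c d e f : ℂ}
    (ha0 : a ≠ 0) (hb0 : b ≠ 0) (hc0 : c ≠ 0) (hd0 : d ≠ 0) (he0 : e ≠ 0) (hf0 : f ≠ 0)
    (ha : ‖a‖ < 1) (hb : ‖b‖ < 1) (hc : ‖c‖ < 1) (hd : ‖d‖ < 1) (he : ‖e‖ < 1) (hf : ‖f‖ < 1)
    (hprod : a * b * c * d * e * f = p) (hab : ∀ n : ℤ, a * b ≠ p ^ n) :
    theta p (b * c) * theta p (b * d) * theta p (b * e) * theta p (b * f) *
        betaIntegral p q (q * a) b c d e f =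
      theta p (a * c) * theta p (a * d) * theta p (a * e) * theta p (a * f) *
        betaIntegral p q a (q * b) c d e f := by
  have hlt : ∀ x : ℂ, ‖x‖ < 1 → ‖q * x‖ < 1 := fun x hx => by
    rw [norm_mul]; exact mul_lt_one_of_nonneg_of_lt_one_left (norm_nonneg _) hq hx.le
  have hS := integral_shiftIntegrand hp hq hq0 ha0 hb0 hc0 hd0 he0 hf0 ha hb hc hd he hf
  have hS' := circleIntegral_comp_inv (shiftIntegrand p q a b c d e f)
  rw [hS] at hS'
  have hmem : ∀ z : ℂ, ‖z‖ = 1 → z ∈ Metric.closedBall (0 : ℂ) ‖q⁻¹‖ \ Metric.ball 0 1 := by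
    intro z hz
    refine ⟨?_, by simp [hz]⟩
    rw [mem_closedBall_zero_iff, hz, norm_inv]
    exact (one_le_inv₀ (norm_pos_iff.2 hq0)).2 hq.le
  have hc1 : CircleIntegrable (fun z => z⁻¹ * shiftIntegrand p q a b c d e f z) 0 1 := by
    refine ContinuousOn.circleIntegrable zero_le_one fun z hz => ContinuousAt.continuousWithinAt ?_
    have hz1 : ‖z‖ = 1 := by simpa using hz
    have hdiff : DifferentiableAt ℂ (shiftIntegrand p q a b c d e f) z :=
      differentiableAt_shiftIntegrand hp hq hq0 ha0 hb0 hc0 hd0 he0 hf0 ha hb hc hd he hf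
        (hmem z hz1)
    exact (continuousAt_inv₀ (norm_ne_zero_of_eq_one hz1)).mul hdiff.continuousAt
  have hc2 : CircleIntegrable (fun z => z⁻¹ * shiftIntegrand p q a b c d e f z⁻¹) 0 1 := by
    refine ContinuousOn.circleIntegrable zero_le_one fun z hz => ContinuousAt.continuousWithinAt ?_
    have hz1 : ‖z‖ = 1 := by simpa using hz
    have hz0 := norm_ne_zero_of_eq_one hz1
    refine (continuousAt_inv₀ hz0).mul ?_
    have hdiff : DifferentiableAt ℂ (shiftIntegrand p q a b c d e f) z⁻¹ :=
      differentiableAt_shiftIntegrand hp hq hq0 ha0 hb0 hc0 hd0 he0 hf0 ha hb hc hd he hf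
        (hmem z⁻¹ (by rw [norm_inv, hz1, inv_one]))
    exact hdiff.continuousAt.comp (f := fun z => z⁻¹) (continuousAt_inv₀ hz0)
  have h1 := circleIntegral.integral_add hc1 hc2
  rw [hS, hS', add_zero] at h1
  have hB1 := circleIntegrable_betaIntegrand hp hq (mul_ne_zero hq0 ha0) hb0 hc0 hd0 he0 hf0
    (hlt a ha) hb hc hd he hf
  have hB2 := circleIntegrable_betaIntegrand hp hq ha0 (mul_ne_zero hq0 hb0) hc0 hd0 he0 hf0
    ha (hlt b hb) hc hd he hf
  rw [betaIntegral, betaIntegral, ← circleIntegral.integral_const_mul,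
    ← circleIntegral.integral_const_mul, eq_comm, ← sub_eq_zero, ← circleIntegral.integral_sub]
  · refine Eq.trans (b := a * theta p (b / a) * ∮ z in C(0, 1),
      (z⁻¹ * shiftIntegrand p q a b c d e f z + z⁻¹ * shiftIntegrand p q a b c d e f z⁻¹)) ?_
      (by rw [h1, mul_zero])
    rw [← circleIntegral.integral_const_mul]
    refine circleIntegral.integral_congr zero_le_one fun z hz => ?_
    have hz1 : ‖z‖ = 1 := by simpa using hz
    have := shiftIntegrand_add hp hq hp0 hq0 ha0 hb0 hc0 hd0 he0 hf0 ha hb hc hd he hf hprod hab hz1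
    linear_combination -z⁻¹ * this
  · exact hB2.const_mul _
  · exact hB1.const_mul _

lemma ellGamma_ne_zero (hp : ‖p‖ < 1) (hq : ‖q‖ < 1) {x y : ℂ}
    (hxy : x * y = p * q) (hx0 : x ≠ 0) (hx : ‖x‖ < 1) (hy : ‖y‖ < 1) : ellGamma p q x ≠ 0 := by
  rw [ellGamma_eq hp hq, ← hxy, mul_div_cancel_left₀ _ hx0]
  exact div_ne_zero (dPoch_ne_zero_of_norm_lt hp hq hy) (dPoch_ne_zero_of_norm_lt hp hq hx)

lemma norm_mul_lt_one {x y : ℂ} (hx : ‖x‖ < 1) (hy : ‖y‖ < 1) : ‖x * y‖ < 1 := by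
  rw [norm_mul]; exact mul_lt_one_of_nonneg_of_lt_one_left (norm_nonneg _) hx hy.le

lemma betaProd_ne_zero (hp : ‖p‖ < 1) (hq : ‖q‖ < 1) {a b c d e f : ℂ}
    (ha0 : a ≠ 0) (hb0 : b ≠ 0) (hc0 : c ≠ 0) (hd0 : d ≠ 0) (he0 : e ≠ 0) (hf0 : f ≠ 0)
    (ha : ‖a‖ < 1) (hb : ‖b‖ < 1) (hc : ‖c‖ < 1) (hd : ‖d‖ < 1) (he : ‖e‖ < 1) (hf : ‖f‖ < 1)
    (hprod : a * b * c * d * e * f = p * q) : betaProd p q a b c d e f ≠ 0 := by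
  have key : ∀ {u v w x y z : ℂ}, u ≠ 0 → v ≠ 0 → ‖u‖ < 1 → ‖v‖ < 1 → ‖w‖ < 1 → ‖x‖ < 1 →
      ‖y‖ < 1 → ‖z‖ < 1 → u * v * (w * x * (y * z)) = p * q → ellGamma p q (u * v) ≠ 0 :=
    fun hu0 hv0 hu hv hw hx hy hz h => ellGamma_ne_zero hp hq h (mul_ne_zero hu0 hv0)
      (norm_mul_lt_one hu hv) (norm_mul_lt_one (norm_mul_lt_one hw hx) (norm_mul_lt_one hy hz))
  unfold betaProd
  refine mul_ne_zero (mul_ne_zero (mul_ne_zero ?_ (mul_ne_zero (mul_ne_zero (mul_ne_zero ?_ ?_) ?_)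
    ?_)) (mul_ne_zero (mul_ne_zero (mul_ne_zero ?_ ?_) ?_) ?_)) (mul_ne_zero (mul_ne_zero
    (mul_ne_zero (mul_ne_zero (mul_ne_zero ?_ ?_) ?_) ?_) ?_) ?_)
  · exact key ha0 hb0 ha hb hc hd he hf (by rw [← hprod]; ring)
  · exact key ha0 hc0 ha hc hb hd he hf (by rw [← hprod]; ring)
  · exact key ha0 hd0 ha hd hb hc he hf (by rw [← hprod]; ring)
  · exact key ha0 he0 ha he hb hc hd hf (by rw [← hprod]; ring)
  · exact key ha0 hf0 ha hf hb hc hd he (by rw [← hprod]; ring)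
  · exact key hb0 hc0 hb hc ha hd he hf (by rw [← hprod]; ring)
  · exact key hb0 hd0 hb hd ha hc he hf (by rw [← hprod]; ring)
  · exact key hb0 he0 hb he ha hc hd hf (by rw [← hprod]; ring)
  · exact key hb0 hf0 hb hf ha hc hd he (by rw [← hprod]; ring)
  · exact key hc0 hd0 hc hd ha hb he hf (by rw [← hprod]; ring)
  · exact key hc0 he0 hc he ha hb hd hf (by rw [← hprod]; ring)
  · exact key hc0 hf0 hc hf ha hb hd he (by rw [← hprod]; ring)
  · exact key hd0 he0 hd he ha hb hc hf (by rw [← hprod]; ring)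
  · exact key hd0 hf0 hd hf ha hb hc he (by rw [← hprod]; ring)
  · exact key he0 hf0 he hf ha hb hc hd (by rw [← hprod]; ring)

/-- The ratio of the two sides of the elliptic beta integral, up to a constant. -/
def betaRatio (p q a b c d e f : ℂ) : ℂ := betaIntegral p q a b c d e f / betaProd p q a b c d e f

/-- The factor `q` may be moved from one parameter to another. -/
lemma betaRatio_shift (hp : ‖p‖ < 1) (hq : ‖q‖ < 1) (hp0 : p ≠ 0) (hq0 : q ≠ 0)
    {a b c d e f : ℂ}
    (ha0 : a ≠ 0) (hb0 : b ≠ 0) (hc0 : c ≠ 0) (hd0 : d ≠ 0) (he0 : e ≠ 0) (hf0 : f ≠ 0)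
    (ha : ‖a‖ < 1) (hb : ‖b‖ < 1) (hc : ‖c‖ < 1) (hd : ‖d‖ < 1) (he : ‖e‖ < 1) (hf : ‖f‖ < 1)
    (hprod : a * b * c * d * e * f = p) (hab : ∀ n : ℤ, a * b ≠ p ^ n) :
    betaRatio p q (q * a) b c d e f = betaRatio p q a (q * b) c d e f := by
  have hlt : ∀ x : ℂ, ‖x‖ < 1 → ‖q * x‖ < 1 := fun x hx => norm_mul_lt_one hq hx
  have h1 := betaProd_ne_zero hp hq (mul_ne_zero hq0 ha0) hb0 hc0 hd0 he0 hf0 (hlt a ha) hb hc hd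
    he hf (by rw [← hprod]; ring)
  have h2 := betaProd_ne_zero hp hq ha0 (mul_ne_zero hq0 hb0) hc0 hd0 he0 hf0 ha (hlt b hb) hc hd
    he hf (by rw [← hprod]; ring)
  have hθ : ∀ x y : ℂ, ‖x‖ < 1 → ‖y‖ < 1 →
      ellGamma p q (q * x * y) = theta p (x * y) * ellGamma p q (x * y) := fun x y hx hy => by
    rw [mul_assoc, ellGamma_mul_left hp hq hq0 (qPoch_ne_zero_of_norm_lt hp (norm_mul_lt_one hx hy))]
  have hs := betaIntegral_shift hp hq hp0 hq0 ha0 hb0 hc0 hd0 he0 hf0 ha hb hc hd he hf hprod hab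
  rw [betaRatio, betaRatio, div_eq_div_iff h1 h2]
  rw [betaProd, betaProd, hθ a c ha hc, hθ a d ha hd, hθ a e ha he, hθ a f ha hf, hθ b c hb hc,
    hθ b d hb hd, hθ b e hb he, hθ b f hb hf, show a * (q * b) = q * a * b by ring]
  linear_combination ellGamma p q (q * a * b) *
    (ellGamma p q (a * c) * ellGamma p q (a * d) * ellGamma p q (a * e) * ellGamma p q (a * f)) *
    (ellGamma p q (b * c) * ellGamma p q (b * d) * ellGamma p q (b * e) * ellGamma p q (b * f)) *
    (ellGamma p q (c * d) * ellGamma p q (c * e) * ellGamma p q (c * f) *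
     ellGamma p q (d * e) * ellGamma p q (d * f) * ellGamma p q (e * f)) * hs

/-- The open annulus `r < |x| < 1`. -/
def annulus (r : ℝ) : Set ℂ := {x | r < ‖x‖ ∧ ‖x‖ < 1}

lemma isOpen_annulus (r : ℝ) : IsOpen (annulus r) :=
  (isOpen_lt continuous_const continuous_norm).inter (isOpen_lt continuous_norm continuous_const)

lemma isPreconnected_annulus {r : ℝ} (hr : 0 < r) : IsPreconnected (annulus r) := by
  have h : annulus r = Complex.exp '' (Complex.re ⁻¹' Ioo (Real.log r) 0) := by
    ext x
    constructor
    · rintro ⟨h1, h2⟩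
      have hx : x ≠ 0 := by rw [← norm_pos_iff]; linarith
      refine ⟨Complex.log x, ?_, Complex.exp_log hx⟩
      rw [mem_preimage, Complex.log_re]
      exact ⟨Real.log_lt_log hr h1, Real.log_neg (norm_pos_iff.2 hx) h2⟩
    · rintro ⟨ζ, ⟨h1, h2⟩, rfl⟩
      refine ⟨?_, ?_⟩
      · rw [Complex.norm_exp]; exact (Real.log_lt_iff_lt_exp hr).1 h1
      · rw [Complex.norm_exp]; simpa using Real.exp_lt_exp.2 h2
  rw [h]
  refine IsPreconnected.image (Convex.isPreconnected ?_) _ Complex.continuous_exp.continuousOn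
  exact (convex_Ioo _ _).linear_preimage Complex.reLm

lemma differentiableAt_ellGamma_comp (hp : ‖p‖ < 1) (hq : ‖q‖ < 1) {g : ℂ → ℂ} {x : ℂ}
    (hg : DifferentiableAt ℂ g x) (h0 : g x ≠ 0) (h1 : dPoch p q (g x) ≠ 0) :
    DifferentiableAt ℂ (fun y => ellGamma p q (g y)) x :=
  (differentiableAt_ellGamma hp hq h0 h1).comp x hg

lemma differentiableAt_betaProd (hp : ‖p‖ < 1) (hq : ‖q‖ < 1) {a b c d e f : ℂ → ℂ} {x : ℂ}
    (ha : DifferentiableAt ℂ a x) (hb : DifferentiableAt ℂ b x) (hc : DifferentiableAt ℂ c x)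
    (hd : DifferentiableAt ℂ d x) (he : DifferentiableAt ℂ e x) (hf : DifferentiableAt ℂ f x)
    (ha0 : a x ≠ 0) (hb0 : b x ≠ 0)
    (hc0 : c x ≠ 0) (hd0 : d x ≠ 0) (he0 : e x ≠ 0) (hf0 : f x ≠ 0)
    (hne : ∀ u ∈ ({a x, b x, c x, d x, e x, f x} : Set ℂ),
      ∀ v ∈ ({a x, b x, c x, d x, e x, f x} : Set ℂ), dPoch p q (u * v) ≠ 0) :
    DifferentiableAt ℂ (fun y => betaProd p q (a y) (b y) (c y) (d y) (e y) (f y)) x := by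
  have key : ∀ {g h : ℂ → ℂ}, DifferentiableAt ℂ g x → DifferentiableAt ℂ h x → g x ≠ 0 →
      h x ≠ 0 → g x ∈ ({a x, b x, c x, d x, e x, f x} : Set ℂ) →
      h x ∈ ({a x, b x, c x, d x, e x, f x} : Set ℂ) →
      DifferentiableAt ℂ (fun y => ellGamma p q (g y * h y)) x :=
    fun hg hh hg0 hh0 hg1 hh1 => differentiableAt_ellGamma_comp hp hq (hg.mul hh)
      (mul_ne_zero hg0 hh0) (hne _ hg1 _ hh1)
  unfold betaProd
  have hab := key ha hb ha0 hb0 (by simp) (by simp)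
  have hac := key ha hc ha0 hc0 (by simp) (by simp)
  have had := key ha hd ha0 hd0 (by simp) (by simp)
  have hae := key ha he ha0 he0 (by simp) (by simp)
  have haf := key ha hf ha0 hf0 (by simp) (by simp)
  have hbc := key hb hc hb0 hc0 (by simp) (by simp)
  have hbd := key hb hd hb0 hd0 (by simp) (by simp)
  have hbe := key hb he hb0 he0 (by simp) (by simp)
  have hbf := key hb hf hb0 hf0 (by simp) (by simp)
  have hcd := key hc hd hc0 hd0 (by simp) (by simp)
  have hce := key hc he hc0 he0 (by simp) (by simp)
  have hcf := key hc hf hc0 hf0 (by simp) (by simp)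
  have hde := key hd he hd0 he0 (by simp) (by simp)
  have hdf := key hd hf hd0 hf0 (by simp) (by simp)
  have hef := key he hf he0 hf0 (by simp) (by simp)
  exact ((hab.mul (((hac.mul had).mul hae).mul haf)).mul (((hbc.mul hbd).mul hbe).mul hbf)).mul
    (((((hcd.mul hce).mul hcf).mul hde).mul hdf).mul hef)

lemma annulus_facts {T x : ℂ} (hx : x ∈ annulus ‖T‖) (hT0 : T ≠ 0) :
    x ≠ 0 ∧ T / x ≠ 0 ∧ ‖T / x‖ < 1 := by
  have hx0 : x ≠ 0 := by
    rw [← norm_pos_iff]; exact (norm_pos_iff.2 hT0).trans hx.1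
  refine ⟨hx0, div_ne_zero hT0 hx0, ?_⟩
  rw [norm_div, div_lt_one (norm_pos_iff.2 hx0)]
  exact hx.1

lemma differentiableOn_betaRatio {c d e f T : ℂ} (hp : ‖p‖ < 1) (hq : ‖q‖ < 1)
    (hc0 : c ≠ 0) (hd0 : d ≠ 0) (he0 : e ≠ 0) (hf0 : f ≠ 0) (hT0 : T ≠ 0)
    (hc : ‖c‖ < 1) (hd : ‖d‖ < 1) (he : ‖e‖ < 1) (hf : ‖f‖ < 1)
    (hprod : T * c * d * e * f = p * q) :
    DifferentiableOn ℂ (fun x => betaRatio p q x (T / x) c d e f) (annulus ‖T‖) := by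
  have h1 : DifferentiableOn ℂ (fun x => betaIntegral p q x (T / x) c d e f) (annulus ‖T‖) := by
    simp only [betaIntegral, ← Contour.integral_circle]
    have hF : ∀ x ∈ annulus ‖T‖, ∀ z : ℂ, ‖z‖ = 1 → DifferentiableAt ℂ (fun y : ℂ × ℂ =>
        y.2⁻¹ * betaIntegrand p q y.1 (T / y.1) c d e f y.2) (x, z) := by
      intro x hx z hz
      obtain ⟨hx0, hTx0, hTx⟩ := annulus_facts hx hT0
      have hfst : DifferentiableAt ℂ (fun y : ℂ × ℂ => y.1) (x, z) := differentiableAt_fst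
      have hsnd : DifferentiableAt ℂ (fun y : ℂ × ℂ => y.2) (x, z) := differentiableAt_snd
      have hdiv : DifferentiableAt ℂ (fun y : ℂ × ℂ => T / y.1) (x, z) := by
        simp only [div_eq_mul_inv]
        exact ((differentiableAt_inv (x := (x, z).1) hx0).comp (x, z) hfst).const_mul T
      refine ((differentiableAt_inv (x := (x, z).2) (norm_ne_zero_of_eq_one hz)).comp (x, z)
        hsnd).mul ?_
      exact DifferentiableAt.betaIntegrand_comp hp hq hfst hdiv (differentiableAt_const c)
        (differentiableAt_const d) (differentiableAt_const e) (differentiableAt_const f) hsnd hz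
        hx0 hTx0 hc0 hd0 he0 hf0 hx.2 hTx hc hd he hf
    have htr : ∀ z ∈ (Contour.circle 0 1).trace, ‖z‖ = 1 := fun z hz => by
      rw [Contour.trace_circle 0 zero_le_one] at hz; simpa using hz
    refine Contour.differentiableOn_integral _ (isOpen_annulus _) ?_ ?_
    · rintro ⟨x, z⟩ ⟨hx, hz⟩
      exact (hF x hx z (htr z hz)).continuousAt.continuousWithinAt
    · intro z hz x hx
      exact ((hF x hx z (htr z hz)).comp x (f := fun x => (x, z))
        (differentiableAt_id.prodMk (differentiableAt_const z))).differentiableWithinAt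
  intro x hx
  obtain ⟨hx0, hTx0, hTx⟩ := annulus_facts hx hT0
  have h2 : DifferentiableAt ℂ (fun x => betaProd p q x (T / x) c d e f) x := by
    refine differentiableAt_betaProd hp hq differentiableAt_id
      ((differentiableAt_const T).div differentiableAt_id hx0) (differentiableAt_const c)
      (differentiableAt_const d) (differentiableAt_const e) (differentiableAt_const f)
      hx0 hTx0 hc0 hd0 he0 hf0 ?_
    have hall : ∀ u ∈ ({x, T / x, c, d, e, f} : Set ℂ), ‖u‖ < 1 := by
      intro u hu
      simp only [mem_insert_iff, mem_singleton_iff] at hu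
      rcases hu with rfl | rfl | rfl | rfl | rfl | rfl
      exacts [hx.2, hTx, hc, hd, he, hf]
    exact fun u hu v hv => dPoch_ne_zero_of_norm_lt hp hq (norm_mul_lt_one (hall u hu) (hall v hv))
  exact (h1 x hx).div h2.differentiableWithinAt (betaProd_ne_zero hp hq hx0 hTx0 hc0 hd0 he0 hf0
    hx.2 hTx hc hd he hf (by rw [← hprod]; field_simp))

/-- The ratio of the two sides does not change if two parameters `x`, `y` are replaced by others
with the same product `T`, `|T| < |q|`: as a function of `x` on the annulus `|T| < |x| < 1` it is
invariant under multiplication by `q` and therefore assumes its maximum. -/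
theorem betaRatio_eq_of_mul_eq {c d e f T : ℂ} (hp : ‖p‖ < 1) (hq : ‖q‖ < 1) (hp0 : p ≠ 0) (hq0 : q ≠ 0)
    (hc0 : c ≠ 0) (hd0 : d ≠ 0) (he0 : e ≠ 0) (hf0 : f ≠ 0) (hT0 : T ≠ 0)
    (hc : ‖c‖ < 1) (hd : ‖d‖ < 1) (he : ‖e‖ < 1) (hf : ‖f‖ < 1)
    (hprod : T * c * d * e * f = p * q) (hT : ‖T‖ < ‖q‖) {x y : ℂ}
    (hx : x ∈ annulus ‖T‖) (hy : y ∈ annulus ‖T‖) :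
    betaRatio p q x (T / x) c d e f = betaRatio p q y (T / y) c d e f := by
  set G : ℂ → ℂ := fun x => betaRatio p q x (T / x) c d e f with hG
  have hqn : 0 < ‖q‖ := norm_pos_iff.2 hq0
  have hTn : 0 < ‖T‖ := norm_pos_iff.2 hT0
  have hTq : ‖T‖ / ‖q‖ < 1 := (div_lt_one hqn).2 hT
  have hdG : DifferentiableOn ℂ G (annulus ‖T‖) :=
    differentiableOn_betaRatio hp hq hc0 hd0 he0 hf0 hT0 hc hd he hf hprod
  have hshift : ∀ x : ℂ, ‖T‖ / ‖q‖ < ‖x‖ → ‖x‖ < 1 → G (q * x) = G x := by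
    intro x hx1 hx2
    have hx0 : x ≠ 0 := by rw [← norm_pos_iff]; exact (by positivity : 0 < ‖T‖ / ‖q‖).trans hx1
    have hqx : q * x ≠ 0 := mul_ne_zero hq0 hx0
    have hb : ‖T / (q * x)‖ < 1 := by
      rw [norm_div, norm_mul, div_lt_one (by positivity)]
      rwa [div_lt_iff₀ hqn, mul_comm] at hx1
    have hpr : x * (T / (q * x)) * c * d * e * f = p := by
      have : x * (T / (q * x)) * c * d * e * f = (T * c * d * e * f) / q := by field_simp
      rw [this, hprod, mul_div_cancel_right₀ _ hq0]
    have hne : ∀ n : ℤ, x * (T / (q * x)) ≠ p ^ n := by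
      intro n h
      -- `|p| < |T / q| < 1`
      have h1 : x * (T / (q * x)) = T / q := by field_simp
      have h2 : ‖T / q‖ = ‖p‖ ^ n := by rw [← h1, h, norm_zpow]
      have hpn := norm_pos_iff.2 hp0
      have h3 : ‖T / q‖ < 1 := by rwa [norm_div]
      have h4 : ‖p‖ < ‖T / q‖ := by
        have h5 : p = T / q * (c * d * (e * f)) := by rw [← h1]; linear_combination -hpr
        have h6 := norm_mul_lt_one (norm_mul_lt_one hc hd) (norm_mul_lt_one he hf)
        calc ‖p‖ = ‖T / q‖ * ‖c * d * (e * f)‖ := by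
              conv_lhs => rw [h5]
              rw [norm_mul]
          _ < ‖T / q‖ * 1 := by
              have : 0 < ‖T / q‖ := by rw [norm_div]; positivity
              gcongr
          _ = ‖T / q‖ := mul_one _
      rw [h2] at h3 h4
      have h5 : 0 < n := by
        by_contra hn
        have := one_le_zpow_of_nonpos₀ hpn hp.le (not_lt.1 hn)
        linarith
      have h6 : n < 1 := by
        by_contra hn
        have : ‖p‖ ^ n ≤ ‖p‖ ^ (1 : ℤ) := zpow_le_zpow_right_of_le_one₀ hpn hp.le (not_lt.1 hn)
        rw [zpow_one] at this
        linarith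
      omega
    have := betaRatio_shift hp hq hp0 hq0 hx0 (div_ne_zero hT0 hqx) hc0 hd0 he0 hf0 hx2 hb hc hd he
      hf hpr hne
    rw [show q * (T / (q * x)) = T / x by field_simp] at this
    exact this
  obtain ⟨ρ, hρ1, hρ2⟩ := exists_between hTq
  have hρ0 : 0 < ρ := (by positivity : 0 < ‖T‖ / ‖q‖).trans hρ1
  have hTρ : ‖T‖ < ‖q‖ * ρ := by rwa [div_lt_iff₀ hqn, mul_comm] at hρ1
  set K : Set ℂ := {x | ‖q‖ * ρ ≤ ‖x‖ ∧ ‖x‖ ≤ ρ} with hK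
  have hKc : IsCompact K := by
    refine Metric.isCompact_of_isClosed_isBounded ?_ ?_
    · exact (isClosed_le continuous_const continuous_norm).inter
        (isClosed_le continuous_norm continuous_const)
    · exact (Metric.isBounded_closedBall (x := (0 : ℂ)) (r := ρ)).subset fun x hx => by
        simpa using hx.2
  have hKA : K ⊆ annulus ‖T‖ := fun x hx => ⟨hTρ.trans_le hx.1, hx.2.trans_lt hρ2⟩
  have hKne : K.Nonempty := by
    refine ⟨(ρ : ℂ), ?_, ?_⟩ <;> rw [Complex.norm_real, Real.norm_eq_abs, abs_of_pos hρ0]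
    exact mul_le_of_le_one_left hρ0.le hq.le
  obtain ⟨x₀, hx₀, hmax⟩ := hKc.exists_isMaxOn hKne (hdG.continuousOn.mono hKA).norm
  have hloc : IsLocalMax (norm ∘ G) x₀ := by
    have e1 : ∀ᶠ x in 𝓝 x₀, x ∈ annulus ‖T‖ := (isOpen_annulus _).mem_nhds (hKA hx₀)
    have e2 : ∀ᶠ x in 𝓝 x₀, ‖q‖ * ‖x‖ < ρ := by
      have : ‖q‖ * ‖x₀‖ < ρ := by nlinarith [hx₀.2]
      exact (continuous_const.mul continuous_norm).continuousAt.eventually_lt_const this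
    have e3 : ∀ᶠ x in 𝓝 x₀, ‖q‖ * (‖q‖ * ρ) < ‖x‖ := by
      have : ‖q‖ * (‖q‖ * ρ) < ‖x₀‖ := by
        refine lt_of_lt_of_le ?_ hx₀.1
        have : 0 < ‖q‖ * ρ := by positivity
        nlinarith
      exact continuous_norm.continuousAt.eventually_const_lt this
    filter_upwards [e1, e2, e3] with x h1 h2 h3
    simp only [Function.comp]
    by_cases ha : ‖x‖ ≤ ρ
    · by_cases hb : ‖q‖ * ρ ≤ ‖x‖
      · exact hmax ⟨hb, ha⟩
      · push Not at hb
        have hxq : ‖x / q‖ = ‖x‖ / ‖q‖ := norm_div _ _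
        have h4 : x / q ∈ K := by
          refine ⟨?_, ?_⟩
          · rw [hxq, le_div_iff₀ hqn]; linarith
          · rw [hxq, div_le_iff₀ hqn]; linarith
        have h5 := hshift (x / q) (by rw [hxq]; gcongr; exact h1.1) (h4.2.trans_lt hρ2)
        rw [mul_div_cancel₀ _ hq0] at h5
        rw [h5]
        exact hmax h4
    · push Not at ha
      rw [← hshift x (hρ1.trans ha) h1.2]
      refine hmax ⟨?_, ?_⟩ <;> rw [norm_mul]
      · gcongr
      · exact h2.le
  have hev := Complex.eventually_eq_of_isLocalMax_norm
    ((hdG.eventually_differentiableAt ((isOpen_annulus _).mem_nhds (hKA hx₀)))) hloc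
  have hconst : EqOn G (fun _ => G x₀) (annulus ‖T‖) :=
    AnalyticOnNhd.eqOn_of_preconnected_of_eventuallyEq (hdG.analyticOnNhd (isOpen_annulus _))
      analyticOnNhd_const (isPreconnected_annulus hTn) (hKA hx₀) hev
  exact (hconst hx).trans (hconst hy).symm

open Complex (I)

/-! ### Evaluation by pinching the contour -/

/-- The regularized elliptic gamma function `(1 - s) Γ(s)`, continued to `s = 1`. -/
def gammaReg (p q s : ℂ) : ℂ :=
  dPoch p q (p * q / s) / (qPoch (p * s) p * qPoch (q * s) q * dPoch p q (p * q * s))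

lemma ellGamma_eq_gammaReg (hp : ‖p‖ < 1) (hq : ‖q‖ < 1) (s : ℂ) :
    ellGamma p q s = (1 - s)⁻¹ * gammaReg p q s := by
  rw [ellGamma_eq hp hq, gammaReg, dPoch_eq_qPoch_mul hp hq s, qPoch_eq_mul hp s, div_eq_mul_inv,
    div_eq_mul_inv, mul_assoc (1 - s), mul_assoc (1 - s), mul_inv]
  ring

lemma gammaReg_one (hp : ‖p‖ < 1) (hq : ‖q‖ < 1) :
    gammaReg p q 1 = (qPoch p p * qPoch q q)⁻¹ := by
  have : dPoch p q (p * q) ≠ 0 := dPoch_ne_zero_of_norm_lt hp hq (norm_mul_lt_one hp hq)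
  rw [gammaReg, div_one, mul_one, mul_one, mul_one]
  field_simp

lemma differentiableAt_gammaReg (hp : ‖p‖ < 1) (hq : ‖q‖ < 1) {s : ℂ} (hs : s ≠ 0)
    (h1 : ‖p * s‖ < 1) (h2 : ‖q * s‖ < 1) : DifferentiableAt ℂ (gammaReg p q) s := by
  have hE := differentiable_dPoch hp hq
  have hP := differentiable_qPoch hp
  have hQ := differentiable_qPoch hq
  have e1 : DifferentiableAt ℂ (fun s => dPoch p q (p * q / s)) s :=
    (hE _).comp s (f := fun s => p * q / s) ((differentiableAt_const _).div differentiableAt_id hs)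
  have e2 : DifferentiableAt ℂ (fun s => qPoch (p * s) p) s :=
    (hP _).comp s (f := fun s => p * s) (by fun_prop)
  have e3 : DifferentiableAt ℂ (fun s => qPoch (q * s) q) s :=
    (hQ _).comp s (f := fun s => q * s) (by fun_prop)
  have e4 : DifferentiableAt ℂ (fun s => dPoch p q (p * q * s)) s :=
    (hE _).comp s (f := fun s => p * q * s) (by fun_prop)
  refine e1.div ((e2.mul e3).mul e4) (mul_ne_zero (mul_ne_zero (qPoch_ne_zero_of_norm_lt hp h1)
    (qPoch_ne_zero_of_norm_lt hq h2)) (dPoch_ne_zero_of_norm_lt hp hq ?_))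
  rw [mul_assoc]
  exact norm_mul_lt_one hp h2

/-- Cauchy's integral formula for an annulus. -/
lemma circleIntegral_sub_circleIntegral {Q : ℂ → ℂ} {r : ℝ} (hr0 : 0 < r)
    (hQ : ∀ z ∈ Metric.closedBall (0 : ℂ) 1 \ Metric.ball 0 r, DifferentiableAt ℂ Q z)
    {w : ℂ} (hw1 : r < ‖w‖) (hw2 : ‖w‖ < 1) :
    (∮ z in C(0, 1), Q z * (z - w)⁻¹) =
      (∮ z in C(0, r), Q z * (z - w)⁻¹) + 2 * Real.pi * Complex.I * Q w := by
  have hr1 : r < 1 := hw1.trans hw2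
  have hwU : Metric.ball (0 : ℂ) 1 \ Metric.closedBall 0 r ∈ 𝓝 w :=
    (Metric.isOpen_ball.sdiff Metric.isClosed_closedBall).mem_nhds ⟨by simpa using hw2, by simpa using hw1⟩
  have hd : ∀ z ∈ Metric.closedBall (0 : ℂ) 1 \ Metric.ball 0 r,
      DifferentiableAt ℂ (fun z => z * dslope Q w z) z := by
    intro z hz
    refine differentiableAt_id.mul ?_
    rcases eq_or_ne z w with rfl | hne
    · refine ((Complex.differentiableOn_dslope hwU).2 fun y hy => ?_).differentiableAt hwU
      exact (hQ y ⟨Metric.ball_subset_closedBall hy.1, fun h =>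
        hy.2 (Metric.ball_subset_closedBall h)⟩).differentiableWithinAt
    · exact (differentiableAt_dslope_of_ne hne).2 (hQ z hz)
  have hann := Complex.circleIntegral_sub_center_inv_smul_eq_of_differentiable_on_annulus_off_countable
    (c := 0) (r := r) (R := 1) hr0 hr1.le
    countable_empty (f := fun z => z * dslope Q w z)
    (fun z hz => (hd z hz).continuousAt.continuousWithinAt)
    (fun z hz => hd z ⟨Metric.ball_subset_closedBall hz.1.1, fun h =>
      hz.1.2 (Metric.ball_subset_closedBall h)⟩)
  have key : ∀ R : ℝ, r ≤ R → R ≤ 1 → R ≠ ‖w‖ →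
      (∮ z in C(0, R), (z - 0)⁻¹ • (z * dslope Q w z)) =
        (∮ z in C(0, R), Q z * (z - w)⁻¹) - Q w * ∮ z in C(0, R), (z - w)⁻¹ := by
    intro R h1 h2 h3
    have hR : 0 < R := hr0.trans_le h1
    have hne : ∀ z ∈ Metric.sphere (0 : ℂ) R, z - w ≠ 0 := fun z hz h => by
      rw [sub_eq_zero.1 h, mem_sphere_zero_iff_norm] at hz; exact h3 hz.symm
    have hinv : ContinuousOn (fun z => (z - w)⁻¹) (Metric.sphere (0 : ℂ) R) :=
      (continuousOn_id.sub continuousOn_const).inv₀ hne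
    have hQc : ContinuousOn Q (Metric.sphere (0 : ℂ) R) := fun z hz => by
      rw [mem_sphere_zero_iff_norm] at hz
      exact (hQ z ⟨by simpa [hz] using h2, by simpa [hz] using h1⟩).continuousAt.continuousWithinAt
    have i1 : CircleIntegrable (fun z => Q z * (z - w)⁻¹) 0 R :=
      (hQc.mul hinv).circleIntegrable hR.le
    have i2 : CircleIntegrable (fun z => Q w * (z - w)⁻¹) 0 R :=
      (continuousOn_const.mul hinv).circleIntegrable hR.le
    rw [← circleIntegral.integral_const_mul, ← circleIntegral.integral_sub i1 i2]
    refine circleIntegral.integral_congr hR.le fun z hz => ?_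
    have hz0 : z ≠ 0 := by
      rintro rfl; rw [mem_sphere_zero_iff_norm, norm_zero] at hz; exact hR.ne hz
    have hzw := hne z hz
    have hzw' : z ≠ w := sub_ne_zero.1 hzw
    simp only [sub_zero, smul_eq_mul]
    rw [dslope_of_ne Q hzw', slope_def_field, inv_mul_cancel_left₀ hz0]
    field_simp
  rw [key 1 hr1.le le_rfl hw2.ne', key r le_rfl hr1.le hw1.ne,
    circleIntegral.integral_sub_inv_of_mem_ball (by simpa using hw2)] at hann
  have h0 : (∮ z in C(0, r), (z - w)⁻¹) = 0 := by
    rw [← Contour.integral_circle, Contour.integral_inv_sub,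
      Contour.winding_circle_of_gt hr0.le (by simpa using hw1), mul_zero]
  rw [h0] at hann
  linear_combination hann

/-- The parameter determined by the others in the family `i x, -i x, ∗, y, y, y`. -/
def pinchParam (p q y x : ℂ) : ℂ := p * q / (x ^ 2 * y ^ 3)

/-- The integrand with the parameters `i x, -i x, ∗, y, y, y`, multiplied by
`(1 - i x / z) (1 + i x / z)`. -/
def pinchKernel (p q y x z : ℂ) : ℂ :=
  weight p q (z ^ 2) * (ellGamma p q (I * x * z) * ellGamma p q (-I * x * z) *
    (gammaReg p q (I * x / z) * gammaReg p q (-I * x / z))) *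
    (gammaPair p q (pinchParam p q y x) z * gammaPair p q y z ^ 3)

lemma betaIntegrand_eq_pinchKernel (hp : ‖p‖ < 1) (hq : ‖q‖ < 1) {y x z : ℂ} (hz : z ≠ 0)
    (h1 : z - I * x ≠ 0) (h2 : z - -I * x ≠ 0) :
    z⁻¹ * betaIntegrand p q (I * x) (-I * x) (pinchParam p q y x) y y y z =
      1 / 2 * (pinchKernel p q y x z * (z - I * x)⁻¹ + pinchKernel p q y x z * (z - -I * x)⁻¹) := by
  have h3 : z⁻¹ * ((1 - I * x / z)⁻¹ * (1 - -I * x / z)⁻¹) =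
      1 / 2 * ((z - I * x)⁻¹ + (z - -I * x)⁻¹) := by
    have h4 : 1 - I * x / z = (z - I * x) / z := by field_simp
    have h5 : 1 - -I * x / z = (z - -I * x) / z := by field_simp
    rw [h4, h5]
    have h6 : z - -I * x = z + I * x := by ring
    rw [h6] at h2 ⊢
    field_simp
    ring
  rw [betaIntegrand, pinchKernel, gammaPair, gammaPair, ellGamma_eq_gammaReg hp hq (I * x / z),
    ellGamma_eq_gammaReg hp hq (-I * x / z)]
  linear_combination (weight p q (z ^ 2) * (ellGamma p q (I * x * z) * ellGamma p q (-I * x * z) *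
    (gammaReg p q (I * x / z) * gammaReg p q (-I * x / z))) *
    (gammaPair p q (pinchParam p q y x) z * gammaPair p q y z ^ 3)) * h3

/-- Conditions on a radius `r` that separates the poles `± i x` of the integrand from the other
poles inside the unit circle. -/
structure PinchRadius (p q : ℂ) (y r : ℝ) : Prop where
  pos : 0 < r
  lt_one : r < 1
  y_pos : 0 < y
  y_lt : y < r
  p_lt : ‖p‖ < y ^ 3
  q_lt : ‖q‖ < r ^ 3

lemma exists_pinchRadius {y : ℝ} (hq : ‖q‖ < 1) (hy0 : 0 < y) (hy1 : y < 1) (hpy : ‖p‖ < y ^ 3) :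
    ∃ r, PinchRadius p q y r := by
  set m := max y ‖q‖ with hm
  have hm1 : m < 1 := max_lt hy1 hq
  have hm0 : 0 < m := hy0.trans_le (le_max_left _ _)
  have h3 : m < (1 - (1 - m) / 4) ^ 3 := by nlinarith [sq_nonneg (1 - m), mul_pos hm0 hm0]
  have h4 : (1 - (1 - m) / 4) ^ 3 ≤ (1 - (1 - m) / 4) := by
    have h5 : 0 ≤ 1 - (1 - m) / 4 := by linarith
    have h6 : 1 - (1 - m) / 4 ≤ 1 := by linarith
    exact pow_le_of_le_one h5 h6 (by norm_num)
  exact ⟨1 - (1 - m) / 4, by linarith, by linarith, hy0,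
    (le_max_left _ _).trans_lt (h3.trans_le h4), hpy, (le_max_right _ _).trans_lt h3⟩

namespace PinchRadius

variable {y r : ℝ} (h : PinchRadius p q y r)
include h

lemma p_lt_r : ‖p‖ < r := by
  have : y ^ 3 ≤ y := pow_le_of_le_one h.y_pos.le (h.y_lt.trans h.lt_one).le (by norm_num)
  linarith [h.p_lt, h.y_lt]

lemma q_lt_r : ‖q‖ < r := by
  have : r ^ 3 ≤ r := pow_le_of_le_one h.pos.le h.lt_one.le (by norm_num)
  linarith [h.q_lt]

lemma norm_pinchParam_lt {x : ℂ} (hx : r ≤ ‖x‖) : ‖pinchParam p q y x‖ < r := by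
  have hr := h.pos
  have hy := h.y_pos
  have hx0 : 0 < ‖x‖ := hr.trans_le hx
  rw [pinchParam, norm_div, norm_mul, norm_mul, norm_pow, norm_pow, Complex.norm_real,
    Real.norm_eq_abs, abs_of_pos hy, div_lt_iff₀ (by positivity)]
  calc ‖p‖ * ‖q‖ ≤ y ^ 3 * ‖q‖ := by gcongr; exact h.p_lt.le
    _ < y ^ 3 * r ^ 3 := by gcongr; exact h.q_lt
    _ = r * (r ^ 2 * y ^ 3) := by ring
    _ ≤ r * (‖x‖ ^ 2 * y ^ 3) := by gcongr

lemma differentiableAt_pinchKernel (hp0 : p ≠ 0) (hq0 : q ≠ 0) {x z : ℂ} (hx1 : r ≤ ‖x‖)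
    (hx2 : ‖x‖ ≤ 1) (hz1 : r ≤ ‖z‖) (hz2 : ‖z‖ ≤ 1) (hxz : ‖x * z‖ < 1) :
    DifferentiableAt ℂ (fun v : ℂ × ℂ => pinchKernel p q y v.1 v.2) (x, z) := by
  have hr := h.pos
  have hp : ‖p‖ < 1 := h.p_lt_r.trans h.lt_one
  have hq : ‖q‖ < 1 := h.q_lt_r.trans h.lt_one
  have hx0 : x ≠ 0 := by rw [← norm_pos_iff]; exact hr.trans_le hx1
  have hz0 : z ≠ 0 := by rw [← norm_pos_iff]; exact hr.trans_le hz1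
  have hy0 : (y : ℂ) ≠ 0 := Complex.ofReal_ne_zero.2 h.y_pos.ne'
  have hyn : ‖(y : ℂ)‖ < r := by
    rw [Complex.norm_real, Real.norm_eq_abs, abs_of_pos h.y_pos]; exact h.y_lt
  have hfst : DifferentiableAt ℂ (fun v : ℂ × ℂ => v.1) (x, z) := differentiableAt_fst
  have hsnd : DifferentiableAt ℂ (fun v : ℂ × ℂ => v.2) (x, z) := differentiableAt_snd
  have hI : ‖I‖ = 1 := Complex.norm_I
  have hnI : ‖-I‖ = 1 := by rw [norm_neg, hI]
  have hG : ∀ c : ℂ, ‖c‖ = 1 → DifferentiableAt ℂ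
      (fun v : ℂ × ℂ => ellGamma p q (c * v.1 * v.2)) (x, z) := by
    intro c hc
    have hc0 : c ≠ 0 := norm_ne_zero_of_eq_one hc
    refine DifferentiableAt.comp (x, z) (g := ellGamma p q) (f := fun v : ℂ × ℂ => c * v.1 * v.2)
      (differentiableAt_ellGamma hp hq (mul_ne_zero (mul_ne_zero hc0 hx0) hz0)
      (dPoch_ne_zero_of_norm_lt hp hq ?_)) ((hfst.const_mul c).mul hsnd)
    rw [mul_assoc, norm_mul, hc, one_mul]; exact hxz
  have hR : ∀ c : ℂ, ‖c‖ = 1 → DifferentiableAt ℂ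
      (fun v : ℂ × ℂ => gammaReg p q (c * v.1 / v.2)) (x, z) := by
    intro c hc
    have hc0 : c ≠ 0 := norm_ne_zero_of_eq_one hc
    have hb : ∀ u : ℂ, ‖u‖ < r → ‖u * (c * x / z)‖ < 1 := by
      intro u hu
      rw [norm_mul, norm_div, norm_mul, hc, one_mul]
      have hzp : 0 < ‖z‖ := norm_pos_iff.2 hz0
      rw [← mul_div_assoc, div_lt_one hzp]
      calc ‖u‖ * ‖x‖ ≤ ‖u‖ * 1 := by gcongr
        _ < ‖z‖ := by linarith
    refine DifferentiableAt.comp (x, z) (g := gammaReg p q) (f := fun v : ℂ × ℂ => c * v.1 / v.2)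
      (differentiableAt_gammaReg hp hq (div_ne_zero (mul_ne_zero hc0 hx0) hz0)
        (hb p h.p_lt_r) (hb q h.q_lt_r)) ?_
    simp only [div_eq_mul_inv]
    exact (hfst.const_mul c).mul ((differentiableAt_inv (x := (x, z).2) hz0).comp (x, z) hsnd)
  have hpair : ∀ g : ℂ → ℂ, DifferentiableAt ℂ g x → g x ≠ 0 → ‖g x‖ < r →
      DifferentiableAt ℂ (fun v : ℂ × ℂ => gammaPair p q (g v.1) v.2) (x, z) := by
    intro g hg hg0 hg1
    refine DifferentiableAt.gammaPair_comp hp hq (DifferentiableAt.comp (x, z) (g := g)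
      (f := fun v : ℂ × ℂ => v.1) hg hfst) hsnd hg0 hz0 (dPoch_ne_zero_of_norm_lt hp hq ?_)
      (dPoch_ne_zero_of_norm_lt hp hq ?_)
    · rw [norm_mul]
      exact mul_lt_one_of_nonneg_of_lt_one_left (norm_nonneg _) (hg1.trans h.lt_one) hz2
    · rw [norm_div, div_lt_one (norm_pos_iff.2 hz0)]
      exact hg1.trans_le hz1
  have hP : DifferentiableAt ℂ (pinchParam p q y) x := by
    refine (differentiableAt_const _).div ((differentiableAt_pow 2).mul_const _)
      (mul_ne_zero (pow_ne_zero 2 hx0) (pow_ne_zero 3 hy0))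
  exact ((DifferentiableAt.weight_sq_comp hp hq hsnd hz0).mul (((hG I hI).mul (hG (-I) hnI)).mul
    ((hR I hI).mul (hR (-I) hnI)))).mul ((hpair _ hP (div_ne_zero (mul_ne_zero hp0 hq0)
    (mul_ne_zero (pow_ne_zero 2 hx0) (pow_ne_zero 3 hy0))) (h.norm_pinchParam_lt hx1)).mul
    ((hpair (fun _ => y) (differentiableAt_const _) hy0 hyn).pow 3))

/-- The integral over the unit circle as a sum of an integral over a smaller circle, which stays
bounded as `x` tends to `1`, and two residues, which do not. -/
lemma betaIntegral_eq (hp0 : p ≠ 0) (hq0 : q ≠ 0) {x : ℝ} (hx1 : r < x) (hx2 : x < 1) :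
    betaIntegral p q (I * x) (-I * x) (pinchParam p q y x) y y y =
      (∮ z in C(0, r), 1 / 2 * (pinchKernel p q y x z * (z - I * x)⁻¹ +
        pinchKernel p q y x z * (z - -I * x)⁻¹)) +
      Real.pi * I * (pinchKernel p q y x (I * x) + pinchKernel p q y x (-I * x)) := by
  have hr := h.pos
  have hp : ‖p‖ < 1 := h.p_lt_r.trans h.lt_one
  have hq : ‖q‖ < 1 := h.q_lt_r.trans h.lt_one
  have hxn : ‖(x : ℂ)‖ = x := by
    rw [Complex.norm_real, Real.norm_eq_abs, abs_of_pos (hr.trans hx1)]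
  have hn1 : ‖I * x‖ = x := by rw [norm_mul, Complex.norm_I, one_mul, hxn]
  have hn2 : ‖-I * x‖ = x := by rw [norm_mul, norm_neg, Complex.norm_I, one_mul, hxn]
  have hQ : ∀ z ∈ Metric.closedBall (0 : ℂ) 1 \ Metric.ball 0 r,
      DifferentiableAt ℂ (pinchKernel p q y x) z := by
    rintro z ⟨hz1, hz2⟩
    rw [mem_closedBall_zero_iff] at hz1
    rw [mem_ball_zero_iff, not_lt] at hz2
    have := h.differentiableAt_pinchKernel hp0 hq0 (x := x) (z := z) (by rw [hxn]; exact hx1.le)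
      (by rw [hxn]; exact hx2.le) hz2 hz1 (by
        rw [norm_mul, hxn]
        exact mul_lt_one_of_nonneg_of_lt_one_left (hr.trans hx1).le hx2 hz1)
    exact this.comp z (f := fun z => ((x : ℂ), z))
      ((differentiableAt_const _).prodMk differentiableAt_id)
  have c1 := circleIntegral_sub_circleIntegral hr hQ (w := I * x) (by rwa [hn1]) (by rwa [hn1])
  have c2 := circleIntegral_sub_circleIntegral hr hQ (w := -I * x) (by rwa [hn2]) (by rwa [hn2])
  have hsum : ∀ R : ℝ, r ≤ R → R ≤ 1 → R ≠ x →
      (∮ z in C(0, R), 1 / 2 * (pinchKernel p q y x z * (z - I * x)⁻¹ +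
        pinchKernel p q y x z * (z - -I * x)⁻¹)) =
      1 / 2 * ((∮ z in C(0, R), pinchKernel p q y x z * (z - I * x)⁻¹) +
        ∮ z in C(0, R), pinchKernel p q y x z * (z - -I * x)⁻¹) := by
    intro R h1 h2 h3
    have hR : 0 < R := hr.trans_le h1
    have hi : ∀ w : ℂ, ‖w‖ = x →
        CircleIntegrable (fun z => pinchKernel p q y x z * (z - w)⁻¹) 0 R := by
      intro w hw
      refine ContinuousOn.circleIntegrable hR.le fun z hz => ContinuousAt.continuousWithinAt ?_
      rw [mem_sphere_zero_iff_norm] at hz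
      refine (hQ z ⟨by simpa [hz] using h2, by simpa [hz] using h1⟩).continuousAt.mul ?_
      refine (continuousAt_id.sub continuousAt_const).inv₀ fun h0 => h3 ?_
      rw [← hz, ← hw, show z = w from sub_eq_zero.1 h0]
    rw [circleIntegral.integral_const_mul, circleIntegral.integral_add (hi _ hn1) (hi _ hn2)]
  have hstart : betaIntegral p q (I * x) (-I * x) (pinchParam p q y x) y y y =
      ∮ z in C(0, 1), 1 / 2 * (pinchKernel p q y x z * (z - I * x)⁻¹ +
        pinchKernel p q y x z * (z - -I * x)⁻¹) := by
    refine circleIntegral.integral_congr zero_le_one fun z hz => ?_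
    have hz1 : ‖z‖ = 1 := by simpa using hz
    refine betaIntegrand_eq_pinchKernel hp hq (norm_ne_zero_of_eq_one hz1) (fun h0 => ?_)
      fun h0 => ?_
    · rw [sub_eq_zero.1 h0, hn1] at hz1; exact hx2.ne hz1
    · rw [sub_eq_zero.1 h0, hn2] at hz1; exact hx2.ne hz1
  rw [hstart, hsum 1 h.lt_one.le le_rfl hx2.ne', hsum r le_rfl h.lt_one.le hx1.ne, c1, c2]
  ring

end PinchRadius

/-- The coefficient of `Γ(x²)` in the value of `pinchKernel` at `c x`, `c = ± i`. -/
def pinchResidue (p q y c x : ℂ) : ℂ :=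
  weight p q ((c * x) ^ 2) * ellGamma p q (-x ^ 2) * (gammaReg p q 1 * gammaReg p q (-1)) *
    (gammaPair p q (pinchParam p q y x) (c * x) * gammaPair p q y (c * x) ^ 3)

/-- The factors of the product side other than `Γ(x²)`. -/
def pinchRest (p q y x : ℂ) : ℂ :=
  (ellGamma p q (I * x * pinchParam p q y x) * ellGamma p q (I * x * y) ^ 3) *
  (ellGamma p q (-I * x * pinchParam p q y x) * ellGamma p q (-I * x * y) ^ 3) *
  (ellGamma p q (pinchParam p q y x * y) ^ 3 * ellGamma p q (y * y) ^ 3)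

lemma betaProd_eq_pinchRest (y x : ℂ) :
    betaProd p q (I * x) (-I * x) (pinchParam p q y x) y y y =
      ellGamma p q (x ^ 2) * pinchRest p q y x := by
  have h : I * x * (-I * x) = x ^ 2 := by linear_combination (-x ^ 2) * Complex.I_sq
  rw [betaProd, pinchRest, h]
  ring

lemma pinchKernel_self {y x : ℂ} (hx : x ≠ 0) {c : ℂ} (hc : c = I ∨ c = -I) :
    pinchKernel p q y x (c * x) = ellGamma p q (x ^ 2) * pinchResidue p q y c x := by
  have hI := Complex.I_ne_zero
  have h1 : I * x * (I * x) = -x ^ 2 := by linear_combination (x ^ 2) * Complex.I_sq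
  have h2 : -I * x * (I * x) = x ^ 2 := by linear_combination (-x ^ 2) * Complex.I_sq
  have h3 : I * x * (-I * x) = x ^ 2 := by rw [mul_comm, h2]
  have h4 : -I * x * (-I * x) = -x ^ 2 := by rw [← h1]; ring
  rcases hc with rfl | rfl
  · rw [pinchKernel, pinchResidue, h1, h2, div_self (mul_ne_zero hI hx),
      show -I * x / (I * x) = -1 by field_simp]
    ring
  · rw [pinchKernel, pinchResidue, h3, h4, div_self (mul_ne_zero (neg_ne_zero.2 hI) hx),
      show I * x / (-I * x) = -1 by field_simp]
    ring

/-- At `x = 1` the factors of the residue that do not depend on the parameters combine to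
`2 / ((p; p) (q; q))`. -/
lemma weight_mul_ellGamma_neg_one (hp : ‖p‖ < 1) (hq : ‖q‖ < 1) :
    weight p q (-1) * ellGamma p q (-1) * (gammaReg p q 1 * gammaReg p q (-1)) =
      2 * (qPoch p p * qPoch q q)⁻¹ := by
  have hpq := norm_mul_lt_one hp hq
  have h1 : dPoch p q (p * q * -1) ≠ 0 :=
    dPoch_ne_zero_of_norm_lt hp hq (by rwa [mul_neg_one, norm_neg])
  have h2 : ellGamma p q (-1) = 2⁻¹ * gammaReg p q (-1) := by
    rw [ellGamma_eq_gammaReg hp hq]; norm_num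
  have h3 : gammaReg p q (-1) ≠ 0 := by
    rw [gammaReg, div_neg, div_one, ← mul_neg_one (p * q)]
    refine div_ne_zero h1 (mul_ne_zero (mul_ne_zero (qPoch_ne_zero_of_norm_lt hp ?_)
      (qPoch_ne_zero_of_norm_lt hq ?_)) h1)
    · rwa [mul_neg_one, norm_neg]
    · rwa [mul_neg_one, norm_neg]
  have hinv : ((-1 : ℂ))⁻¹ = -1 := by norm_num
  rw [← inv_ellGamma_mul hp hq h1 (by rwa [hinv]), hinv, gammaReg_one hp hq, h2]
  field_simp

namespace PinchRadius

variable {y r : ℝ} (h : PinchRadius p q y r)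
include h

lemma differentiableAt_factors (hp0 : p ≠ 0) (hq0 : q ≠ 0) {c : ℂ} (hc : ‖c‖ = 1) :
    DifferentiableAt ℂ (fun x => gammaPair p q (pinchParam p q y x) (c * x)) 1 ∧
    DifferentiableAt ℂ (fun x => gammaPair p q y (c * x)) 1 ∧
    DifferentiableAt ℂ (fun x => ellGamma p q (c * x * pinchParam p q y x)) 1 ∧
    DifferentiableAt ℂ (fun x => ellGamma p q (c * x * y)) 1 := by
  have hp : ‖p‖ < 1 := h.p_lt_r.trans h.lt_one
  have hq : ‖q‖ < 1 := h.q_lt_r.trans h.lt_one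
  have hy0 : (y : ℂ) ≠ 0 := Complex.ofReal_ne_zero.2 h.y_pos.ne'
  have hyn : ‖(y : ℂ)‖ < 1 := by
    rw [Complex.norm_real, Real.norm_eq_abs, abs_of_pos h.y_pos]; exact h.y_lt.trans h.lt_one
  have hc0 := norm_ne_zero_of_eq_one hc
  have hT0 : pinchParam p q y 1 ≠ 0 := div_ne_zero (mul_ne_zero hp0 hq0)
    (mul_ne_zero (pow_ne_zero 2 one_ne_zero) (pow_ne_zero 3 hy0))
  have hT1 : ‖pinchParam p q y 1‖ < 1 :=
    (h.norm_pinchParam_lt (by rw [norm_one]; exact h.lt_one.le)).trans h.lt_one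
  have hP : DifferentiableAt ℂ (pinchParam p q y) 1 := by
    refine (differentiableAt_const _).div ((differentiableAt_pow 2).mul_const _)
      (mul_ne_zero (pow_ne_zero 2 one_ne_zero) (pow_ne_zero 3 hy0))
  have hcx : DifferentiableAt ℂ (fun x : ℂ => c * x) 1 := differentiableAt_id.const_mul c
  have hc1 : ‖c * 1‖ = 1 := by rw [mul_one, hc]
  have hc10 := norm_ne_zero_of_eq_one hc1
  have hlt : ∀ a : ℂ, ‖a‖ < 1 → ‖c * 1 * a‖ < 1 := fun a ha => by rwa [norm_mul, hc1, one_mul]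
  refine ⟨?_, ?_, ?_, ?_⟩
  · exact DifferentiableAt.gammaPair_comp hp hq hP hcx hT0 hc10
      (gammaPair_factors_ne_zero hp hq hT1 hc1).1 (gammaPair_factors_ne_zero hp hq hT1 hc1).2
  · exact DifferentiableAt.gammaPair_comp hp hq (differentiableAt_const _) hcx hy0 hc10
      (gammaPair_factors_ne_zero hp hq hyn hc1).1 (gammaPair_factors_ne_zero hp hq hyn hc1).2
  · exact differentiableAt_ellGamma_comp hp hq (hcx.mul hP) (mul_ne_zero hc10 hT0)
      (dPoch_ne_zero_of_norm_lt hp hq (hlt _ hT1))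
  · exact differentiableAt_ellGamma_comp hp hq (hcx.mul_const _) (mul_ne_zero hc10 hy0)
      (dPoch_ne_zero_of_norm_lt hp hq (hlt _ hyn))

lemma differentiableAt_pinchResidue (hp0 : p ≠ 0) (hq0 : q ≠ 0) {c : ℂ} (hc : ‖c‖ = 1) :
    DifferentiableAt ℂ (pinchResidue p q y c) 1 := by
  have hp : ‖p‖ < 1 := h.p_lt_r.trans h.lt_one
  have hq : ‖q‖ < 1 := h.q_lt_r.trans h.lt_one
  have hcx : DifferentiableAt ℂ (fun x : ℂ => c * x) 1 := differentiableAt_id.const_mul c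
  obtain ⟨h1, h2, -, -⟩ := h.differentiableAt_factors hp0 hq0 hc
  have h3 : dPoch p q (-1) ≠ 0 := by
    intro h0
    obtain ⟨j, k, hjk⟩ := (dPoch_eq_zero_iff hp hq).1 h0
    have hn : ‖p‖ ^ j * ‖q‖ ^ k = 1 := by
      have := congrArg norm hjk
      simpa using this
    rcases Nat.eq_zero_or_pos j with rfl | hj
    · rcases Nat.eq_zero_or_pos k with rfl | hk
      · norm_num at hjk
      · have := pow_lt_one₀ (norm_nonneg q) hq hk.ne'
        rw [pow_zero, one_mul] at hn
        exact this.ne hn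
    · have e1 := pow_lt_one₀ (norm_nonneg p) hp hj.ne'
      have e2 := pow_le_one₀ (norm_nonneg q) hq.le (n := k)
      have := mul_lt_one_of_nonneg_of_lt_one_left (by positivity) e1 e2
      exact this.ne hn
  have h4 : DifferentiableAt ℂ (fun x => ellGamma p q (-x ^ 2)) 1 :=
    differentiableAt_ellGamma_comp hp hq (g := fun x => -x ^ 2) (by fun_prop) (by norm_num)
      (by simpa using h3)
  exact (((DifferentiableAt.weight_sq_comp hp hq hcx (by
    rw [mul_one]; exact norm_ne_zero_of_eq_one hc)).mul h4).mul_const _).mul (h1.mul (h2.pow 3))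

lemma differentiableAt_pinchRest (hp0 : p ≠ 0) (hq0 : q ≠ 0) :
    DifferentiableAt ℂ (pinchRest p q y) 1 := by
  have hp : ‖p‖ < 1 := h.p_lt_r.trans h.lt_one
  have hq : ‖q‖ < 1 := h.q_lt_r.trans h.lt_one
  have hy0 : (y : ℂ) ≠ 0 := Complex.ofReal_ne_zero.2 h.y_pos.ne'
  have hyn : ‖(y : ℂ)‖ < 1 := by
    rw [Complex.norm_real, Real.norm_eq_abs, abs_of_pos h.y_pos]; exact h.y_lt.trans h.lt_one
  have hT0 : pinchParam p q y 1 ≠ 0 := div_ne_zero (mul_ne_zero hp0 hq0)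
    (mul_ne_zero (pow_ne_zero 2 one_ne_zero) (pow_ne_zero 3 hy0))
  have hT1 : ‖pinchParam p q y 1‖ < 1 :=
    (h.norm_pinchParam_lt (by rw [norm_one]; exact h.lt_one.le)).trans h.lt_one
  have hP : DifferentiableAt ℂ (pinchParam p q y) 1 := by
    refine (differentiableAt_const _).div ((differentiableAt_pow 2).mul_const _)
      (mul_ne_zero (pow_ne_zero 2 one_ne_zero) (pow_ne_zero 3 hy0))
  obtain ⟨-, -, h3, h4⟩ := h.differentiableAt_factors hp0 hq0 Complex.norm_I
  obtain ⟨-, -, h3', h4'⟩ := h.differentiableAt_factors hp0 hq0 (c := -I)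
    (by rw [norm_neg, Complex.norm_I])
  have h5 : DifferentiableAt ℂ (fun x => ellGamma p q (pinchParam p q y x * y)) 1 :=
    differentiableAt_ellGamma_comp hp hq (hP.mul_const _) (mul_ne_zero hT0 hy0)
      (dPoch_ne_zero_of_norm_lt hp hq (norm_mul_lt_one hT1 hyn))
  exact ((h3.mul (h4.pow 3)).mul (h3'.mul (h4'.pow 3))).mul ((h5.pow 3).mul_const _)

lemma pinchRest_one (hp0 : p ≠ 0) (hq0 : q ≠ 0) : pinchRest p q y 1 ≠ 0 ∧
    ∀ c, c = I ∨ c = -I → pinchResidue p q y c 1 =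
      2 * (qPoch p p * qPoch q q)⁻¹ * pinchRest p q y 1 := by
  have hp : ‖p‖ < 1 := h.p_lt_r.trans h.lt_one
  have hq : ‖q‖ < 1 := h.q_lt_r.trans h.lt_one
  have hy0 : (y : ℂ) ≠ 0 := Complex.ofReal_ne_zero.2 h.y_pos.ne'
  have hyn : ‖(y : ℂ)‖ < 1 := by
    rw [Complex.norm_real, Real.norm_eq_abs, abs_of_pos h.y_pos]; exact h.y_lt.trans h.lt_one
  have hT0 : pinchParam p q y 1 ≠ 0 := div_ne_zero (mul_ne_zero hp0 hq0)
    (mul_ne_zero (pow_ne_zero 2 one_ne_zero) (pow_ne_zero 3 hy0))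
  have hT1 : ‖pinchParam p q y 1‖ < 1 :=
    (h.norm_pinchParam_lt (by rw [norm_one]; exact h.lt_one.le)).trans h.lt_one
  have hTy : pinchParam p q y 1 * y * (y * y) = p * q := by
    rw [pinchParam]; field_simp
  have hΓ : ellGamma p q (pinchParam p q y 1 * y) * ellGamma p q (y * y) = 1 :=
    ellGamma_mul_ellGamma hp hq hp0 hq0 hTy
      (dPoch_ne_zero_of_norm_lt hp hq (norm_mul_lt_one hT1 hyn))
      (dPoch_ne_zero_of_norm_lt hp hq (norm_mul_lt_one hyn hyn))
  have hrest : pinchRest p q y 1 =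
      gammaPair p q (pinchParam p q y 1) I * gammaPair p q y I ^ 3 := by
    rw [pinchRest, gammaPair, gammaPair, ← mul_pow, hΓ, one_pow, Complex.div_I, Complex.div_I]
    simp only [mul_one]
    rw [mul_comm I, mul_comm I, mul_comm (-I), mul_comm (-I), mul_neg, mul_neg]
    ring
  refine ⟨?_, ?_⟩
  · -- every factor `Γ(a)` has `|pq| < |a| < 1`
    have hn : ∀ a b : ℂ, a ≠ 0 → ‖a‖ < 1 → ‖b‖ < 1 → a * b = p * q →
        gammaPair p q a I ≠ 0 := by
      intro a b ha0 ha hb hab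
      refine mul_ne_zero (ellGamma_ne_zero hp hq (y := b / I) ?_ (mul_ne_zero ha0 Complex.I_ne_zero)
        ?_ ?_) (ellGamma_ne_zero hp hq (y := b * I) ?_ (div_ne_zero ha0 Complex.I_ne_zero) ?_ ?_)
      · rw [← hab]; field_simp
      · simpa using ha
      · simpa using hb
      · rw [← hab]; field_simp
      · simpa using ha
      · simpa using hb
    rw [hrest]
    refine mul_ne_zero (hn _ (y * (y * y)) hT0 hT1 (norm_mul_lt_one hyn (norm_mul_lt_one hyn hyn))
      ?_) (pow_ne_zero 3 (hn _ (pinchParam p q y 1 * (y * y)) hy0 hyn (norm_mul_lt_one hT1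
        (norm_mul_lt_one hyn hyn)) ?_))
    · rw [← hTy]; ring
    · rw [← hTy]; ring
  · intro c hc
    have e1 : (c * 1) ^ 2 = -1 := by
      rcases hc with rfl | rfl <;> simp
    have e2 : ∀ a, gammaPair p q a (c * 1) = gammaPair p q a I := by
      intro a
      rcases hc with rfl | rfl
      · rw [mul_one]
      · simp only [gammaPair, mul_one, Complex.div_I, div_neg, mul_neg, neg_neg]
        ring
    rw [pinchResidue, e1, e2, e2, one_pow, weight_mul_ellGamma_neg_one hp hq, hrest]

lemma tendsto_betaRatio (hp0 : p ≠ 0) (hq0 : q ≠ 0) :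
    Tendsto (fun x : ℝ => betaRatio p q (I * x) (-I * x) (pinchParam p q y x) y y y) (𝓝[<] 1)
      (𝓝 (4 * Real.pi * I / (qPoch p p * qPoch q q))) := by
  have hr := h.pos
  have hp : ‖p‖ < 1 := h.p_lt_r.trans h.lt_one
  have hq : ‖q‖ < 1 := h.q_lt_r.trans h.lt_one
  have hof : Tendsto (fun x : ℝ => (x : ℂ)) (𝓝[<] 1) (𝓝 1) := by
    have := (Complex.continuous_ofReal.tendsto 1).mono_left (nhdsWithin_le_nhds (s := Iio 1))
    simpa using this
  have hev : ∀ᶠ x : ℝ in 𝓝[<] 1, r < x ∧ x < 1 := by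
    filter_upwards [self_mem_nhdsWithin, nhdsWithin_le_nhds (Ioi_mem_nhds h.lt_one)] with x h1 h2
    exact ⟨h2, h1⟩
  obtain ⟨x₁, hx₁r, hx₁⟩ := exists_between h.lt_one
  -- the integral over the smaller circle is bounded
  obtain ⟨B, hB⟩ : ∃ B : ℝ, ∀ x : ℝ, x₁ ≤ x → x ≤ 1 →
      ‖∮ z in C(0, r), 1 / 2 * (pinchKernel p q y x z * (z - I * x)⁻¹ +
        pinchKernel p q y x z * (z - -I * x)⁻¹)‖ ≤ B := by
    have hc : ContinuousOn (fun v : ℂ × ℂ => 1 / 2 * (pinchKernel p q y v.1 v.2 *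
        (v.2 - I * v.1)⁻¹ + pinchKernel p q y v.1 v.2 * (v.2 - -I * v.1)⁻¹))
        (((fun x : ℝ => (x : ℂ)) '' Icc x₁ 1) ×ˢ Metric.sphere 0 r) := by
      rintro ⟨-, z⟩ ⟨⟨x, hx, rfl⟩, hz⟩
      refine ContinuousAt.continuousWithinAt ?_
      rw [mem_sphere_zero_iff_norm] at hz
      simp only at hz
      have hx0 : 0 < x := hr.trans (hx₁r.trans_le hx.1)
      have hxn : ‖(x : ℂ)‖ = x := by rw [Complex.norm_real, Real.norm_eq_abs, abs_of_pos hx0]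
      have hk : DifferentiableAt ℂ (fun v : ℂ × ℂ => pinchKernel p q y v.1 v.2) ((x : ℂ), z) :=
        h.differentiableAt_pinchKernel hp0 hq0 (by rw [hxn]; exact (hx₁r.trans_le hx.1).le)
          (by rw [hxn]; exact hx.2) hz.ge (hz.le.trans h.lt_one.le) (by
            rw [norm_mul, hxn, hz]
            calc x * r ≤ 1 * r := by gcongr; exact hx.2
              _ < 1 := by rw [one_mul]; exact h.lt_one)
      have hne : ∀ c : ℂ, ‖c‖ = 1 → z - c * x ≠ 0 := by
        intro c hc h0
        rw [sub_eq_zero.1 h0, norm_mul, hc, hxn, one_mul] at hz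
        exact (hx₁r.trans_le hx.1).ne' hz
      have hi : ∀ c : ℂ, ‖c‖ = 1 →
          ContinuousAt (fun v : ℂ × ℂ => (v.2 - c * v.1)⁻¹) ((x : ℂ), z) := fun c hc =>
        ContinuousAt.inv₀ (by fun_prop) (hne c hc)
      exact ((hk.continuousAt.mul (hi I Complex.norm_I)).add (hk.continuousAt.mul
        (hi (-I) (by rw [norm_neg, Complex.norm_I])))).const_mul _
    have hK : IsCompact (((fun x : ℝ => (x : ℂ)) '' Icc x₁ 1) ×ˢ Metric.sphere (0 : ℂ) r) :=
      (isCompact_Icc.image Complex.continuous_ofReal).prod (isCompact_sphere 0 r)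
    obtain ⟨B, hB⟩ := hK.exists_bound_of_continuousOn hc
    refine ⟨2 * Real.pi * r * B, fun x h1 h2 => ?_⟩
    exact circleIntegral.norm_integral_le_of_norm_le_const hr.le fun z hz =>
      hB (x, z) ⟨⟨x, ⟨h1, h2⟩, rfl⟩, hz⟩
  have hΓ0 : Tendsto (fun x : ℝ => (ellGamma p q ((x : ℂ) ^ 2))⁻¹) (𝓝[<] 1) (𝓝 0) := by
    have e1 : ContinuousAt (fun x : ℂ => (1 - x ^ 2) * (gammaReg p q (x ^ 2))⁻¹) 1 := by
      have e2 : DifferentiableAt ℂ (gammaReg p q) (1 ^ 2) := by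
        rw [one_pow]
        exact differentiableAt_gammaReg hp hq one_ne_zero (by rwa [mul_one]) (by rwa [mul_one])
      have e3 : DifferentiableAt ℂ (fun x : ℂ => gammaReg p q (x ^ 2)) 1 :=
        e2.comp 1 (f := fun x : ℂ => x ^ 2) (differentiableAt_pow 2)
      refine ContinuousAt.mul (by fun_prop) (e3.continuousAt.inv₀ ?_)
      rw [one_pow, gammaReg_one hp hq]
      exact inv_ne_zero (mul_ne_zero (qPoch_ne_zero_of_norm_lt hp hp)
        (qPoch_ne_zero_of_norm_lt hq hq))
    have e4 := e1.tendsto.comp hof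
    simp only [one_pow, sub_self, zero_mul] at e4
    refine e4.congr fun x => ?_
    rw [Function.comp, ellGamma_eq_gammaReg hp hq, mul_inv, inv_inv]
  have hJ : Tendsto (fun x : ℝ => (ellGamma p q ((x : ℂ) ^ 2))⁻¹ *
      ∮ z in C(0, r), 1 / 2 * (pinchKernel p q y x z * (z - I * x)⁻¹ +
        pinchKernel p q y x z * (z - -I * x)⁻¹)) (𝓝[<] 1) (𝓝 0) := by
    have hb : Tendsto (fun x : ℝ => ‖(ellGamma p q ((x : ℂ) ^ 2))⁻¹‖ * B) (𝓝[<] 1) (𝓝 0) := by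
      simpa using hΓ0.norm.mul_const B
    refine squeeze_zero_norm' ?_ hb
    filter_upwards [self_mem_nhdsWithin, nhdsWithin_le_nhds (Ioi_mem_nhds hx₁)] with x h1 h2
    rw [norm_mul]
    gcongr
    exact hB x (le_of_lt h2) (le_of_lt h1)
  obtain ⟨hR0, hres⟩ := h.pinchRest_one hp0 hq0
  have hS : ∀ c : ℂ, c = I ∨ c = -I → Tendsto (fun x : ℝ => pinchResidue p q y c x) (𝓝[<] 1)
      (𝓝 (2 * (qPoch p p * qPoch q q)⁻¹ * pinchRest p q y 1)) := by
    intro c hc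
    have hcn : ‖c‖ = 1 := by rcases hc with rfl | rfl <;> simp
    rw [← hres c hc]
    exact (h.differentiableAt_pinchResidue hp0 hq0 hcn).continuousAt.tendsto.comp hof
  have hR : Tendsto (fun x : ℝ => pinchRest p q y x) (𝓝[<] 1) (𝓝 (pinchRest p q y 1)) :=
    (h.differentiableAt_pinchRest hp0 hq0).continuousAt.tendsto.comp hof
  have hlim := (hJ.add (((hS I (Or.inl rfl)).add (hS (-I) (Or.inr rfl))).const_mul
    (Real.pi * I))).div hR hR0
  have hval : (0 + Real.pi * I * (2 * (qPoch p p * qPoch q q)⁻¹ * pinchRest p q y 1 +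
      2 * (qPoch p p * qPoch q q)⁻¹ * pinchRest p q y 1)) / pinchRest p q y 1 =
      4 * Real.pi * I / (qPoch p p * qPoch q q) := by
    field_simp
    ring
  rw [hval] at hlim
  refine hlim.congr' ?_
  filter_upwards [hev] with x hx
  have hx0 : (x : ℂ) ≠ 0 := Complex.ofReal_ne_zero.2 (hr.trans hx.1).ne'
  have hxn : ‖(x : ℂ)‖ = x := by
    rw [Complex.norm_real, Real.norm_eq_abs, abs_of_pos (hr.trans hx.1)]
  have hΓ : ellGamma p q ((x : ℂ) ^ 2) ≠ 0 := by
    have hx2 : ‖(x : ℂ) ^ 2‖ < 1 := by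
      rw [norm_pow, hxn]; exact pow_lt_one₀ (hr.trans hx.1).le hx.2 two_ne_zero
    have e : (x : ℂ) ^ 2 * (pinchParam p q y x * y ^ 3) = p * q := by
      have := Complex.ofReal_ne_zero.2 h.y_pos.ne'
      rw [pinchParam]; field_simp
    refine ellGamma_ne_zero hp hq e (pow_ne_zero 2 hx0) hx2 (norm_mul_lt_one
      ((h.norm_pinchParam_lt (by rw [hxn]; exact hx.1.le)).trans h.lt_one) ?_)
    rw [norm_pow, Complex.norm_real, Real.norm_eq_abs, abs_of_pos h.y_pos]
    exact pow_lt_one₀ h.y_pos.le (h.y_lt.trans h.lt_one) (by norm_num)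
  rw [betaRatio, h.betaIntegral_eq hp0 hq0 hx.1 hx.2, betaProd_eq_pinchRest,
    pinchKernel_self hx0 (Or.inl rfl), pinchKernel_self hx0 (Or.inr rfl), Pi.div_apply,
    ← div_div]
  generalize circleIntegral (E := ℂ) _ 0 r = J
  congr 1
  field_simp

end PinchRadius

lemma betaRatio_rotate (a b c d e f : ℂ) :
    betaRatio p q a b c d e f = betaRatio p q a c d e f b := by
  have h1 : betaIntegral p q a b c d e f = betaIntegral p q a c d e f b := by
    simp only [betaIntegral, betaIntegrand]
    congr 1
    ext z
    ring
  have h2 : betaProd p q a b c d e f = betaProd p q a c d e f b := by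
    rw [betaProd, betaProd, mul_comm b c, mul_comm b d, mul_comm b e, mul_comm b f]
    ring
  rw [betaRatio, betaRatio, h1, h2]

lemma betaRatio_move_first (a b c d e f : ℂ) :
    betaRatio p q a b c d e f = betaRatio p q b c a d e f := by
  have h1 : betaIntegral p q a b c d e f = betaIntegral p q b c a d e f := by
    simp only [betaIntegral, betaIntegrand]
    congr 1
    ext z
    ring
  have h2 : betaProd p q a b c d e f = betaProd p q b c a d e f := by
    rw [betaProd, betaProd, mul_comm a b, mul_comm a c]
    ring
  rw [betaRatio, betaRatio, h1, h2]

/-- A nonempty open region of parameters on which the integration contour is the unit circle and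
the two-parameter moves of `betaRatio_eq_of_mul_eq` can be iterated. -/
structure SmallParams (p q a b c d e f : ℂ) : Prop where
  a_ne : a ≠ 0
  b_ne : b ≠ 0
  c_ne : c ≠ 0
  d_ne : d ≠ 0
  e_ne : e ≠ 0
  f_ne : f ≠ 0
  a_lt : ‖a‖ < ‖q‖
  b_lt : ‖b‖ < 1
  c_lt : ‖c‖ < 1
  d_lt : ‖d‖ < 1
  e_lt : ‖e‖ < 1
  f_lt : ‖f‖ < 1
  prod : a * b * c * d * e * f = p * q

/-- The second parameter may be increased in modulus, at the expense of the first one. -/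
lemma SmallParams.move {a b c d e f : ℂ} (h : SmallParams p q a b c d e f) (hp0 : p ≠ 0)
    (hp : ‖p‖ < 1) (hq : ‖q‖ < 1) {g : ℂ} (hg : ‖b‖ ≤ ‖g‖) (hg1 : ‖g‖ < 1) :
    SmallParams p q (a * b / g) c d e f g ∧
      betaRatio p q a b c d e f = betaRatio p q (a * b / g) c d e f g := by
  have hq0 : q ≠ 0 := by rw [← norm_pos_iff]; exact (norm_nonneg a).trans_lt h.a_lt
  have hbn := norm_pos_iff.2 h.b_ne
  have han := norm_pos_iff.2 h.a_ne
  have hgn : 0 < ‖g‖ := hbn.trans_le hg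
  have hg0 : g ≠ 0 := norm_pos_iff.1 hgn
  have hT0 := mul_ne_zero h.a_ne h.b_ne
  have hT : ‖a * b‖ < ‖q‖ := by
    rw [norm_mul]
    exact (mul_le_of_le_one_right han.le h.b_lt.le).trans_lt h.a_lt
  have hle : ‖a * b / g‖ ≤ ‖a‖ := by
    rw [norm_div, norm_mul, div_le_iff₀ hgn]
    gcongr
  have hlt : ‖a * b‖ < ‖a * b / g‖ := by
    rw [norm_div, lt_div_iff₀ hgn]
    exact mul_lt_of_lt_one_right (norm_pos_iff.2 hT0) hg1
  refine ⟨⟨div_ne_zero hT0 hg0, h.c_ne, h.d_ne, h.e_ne, h.f_ne, hg0, hle.trans_lt h.a_lt, h.c_lt,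
    h.d_lt, h.e_lt, h.f_lt, hg1, ?_⟩, ?_⟩
  · rw [← h.prod]; field_simp
  · have := betaRatio_eq_of_mul_eq hp hq hp0 hq0 h.c_ne h.d_ne h.e_ne h.f_ne hT0 h.c_lt h.d_lt h.e_lt
      h.f_lt h.prod hT (x := a) (y := a * b / g)
      ⟨by rw [norm_mul]; exact mul_lt_of_lt_one_right han h.b_lt, h.a_lt.trans hq⟩
      ⟨hlt, (hle.trans_lt h.a_lt).trans hq⟩
    rw [mul_div_cancel_left₀ _ h.a_ne, div_div_cancel₀ hT0] at this
    rw [this, betaRatio_rotate]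

/-- The elliptic beta integral for parameters in a small region. -/
theorem SmallParams.betaRatio_eq {a b c d e f : ℂ} (h : SmallParams p q a b c d e f) (hp0 : p ≠ 0)
    (hp : ‖p‖ < 1) (hq : ‖q‖ < 1) :
    betaRatio p q a b c d e f = 4 * Real.pi * I / (qPoch p p * qPoch q q) := by
  have hqn : 0 < ‖q‖ := (norm_nonneg a).trans_lt h.a_lt
  have hq0 : q ≠ 0 := norm_pos_iff.1 hqn
  obtain ⟨y, hy, hy1⟩ : ∃ y, max (max (max ‖b‖ ‖c‖) (max ‖d‖ ‖e‖)) ‖f‖ < y ∧ y < 1 :=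
    exists_between (by simp [h.b_lt, h.c_lt, h.d_lt, h.e_lt, h.f_lt])
  simp only [max_lt_iff] at hy
  obtain ⟨⟨⟨hb, hc⟩, hd, he⟩, hf⟩ := hy
  have hy0 : 0 < y := (norm_nonneg b).trans_lt hb
  have hpy : ‖p‖ < y ^ 3 := by
    have h1 : ‖p‖ * ‖q‖ = ‖a‖ * (‖b‖ * ‖c‖ * ‖d‖ * (‖e‖ * ‖f‖)) := by
      rw [← norm_mul, ← h.prod]
      simp only [norm_mul]
      ring
    have h2 : ‖b‖ * ‖c‖ * ‖d‖ * (‖e‖ * ‖f‖) ≤ y * y * y * (1 * 1) := by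
      have := h.e_lt.le
      have := h.f_lt.le
      gcongr
    have h3 : 0 < ‖b‖ * ‖c‖ * ‖d‖ * (‖e‖ * ‖f‖) := by
      have := norm_pos_iff.2 h.b_ne
      have := norm_pos_iff.2 h.c_ne
      have := norm_pos_iff.2 h.d_ne
      have := norm_pos_iff.2 h.e_ne
      have := norm_pos_iff.2 h.f_ne
      positivity
    have h4 : ‖p‖ * ‖q‖ < y ^ 3 * ‖q‖ := by
      rw [h1]
      calc ‖a‖ * (‖b‖ * ‖c‖ * ‖d‖ * (‖e‖ * ‖f‖)) < ‖q‖ * (‖b‖ * ‖c‖ * ‖d‖ * (‖e‖ * ‖f‖)) := by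
            gcongr; exact h.a_lt
        _ ≤ ‖q‖ * (y * y * y * (1 * 1)) := by gcongr
        _ = y ^ 3 * ‖q‖ := by ring
    exact lt_of_mul_lt_mul_right h4 hqn.le
  obtain ⟨r, hr⟩ := exists_pinchRadius (p := p) hq hy0 hy1 hpy
  refine tendsto_nhds_unique (f := fun _ : ℝ => betaRatio p q a b c d e f) tendsto_const_nhds
    ((hr.tendsto_betaRatio hp0 hq0).congr' ?_)
  filter_upwards [self_mem_nhdsWithin, nhdsWithin_le_nhds (Ioi_mem_nhds hr.lt_one)] with x h1 h2
  have hx1 : x < 1 := h1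
  have hx2 : r < x := h2
  have hx0 : 0 < x := hr.pos.trans hx2
  have hyx : y < x := hr.y_lt.trans hx2
  have hyn : ‖(y : ℂ)‖ = y := by rw [Complex.norm_real, Real.norm_eq_abs, abs_of_pos hy0]
  have hn1 : ‖I * x‖ = x := by
    rw [norm_mul, Complex.norm_I, one_mul, Complex.norm_real, Real.norm_eq_abs, abs_of_pos hx0]
  have hn2 : ‖-I * x‖ = x := by rw [neg_mul, norm_neg, hn1]
  obtain ⟨s1, e1⟩ := h.move hp0 hp hq (g := I * x) (by rw [hn1]; linarith) (by rwa [hn1])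
  obtain ⟨s2, e2⟩ := s1.move hp0 hp hq (g := -I * x) (by rw [hn2]; linarith) (by rwa [hn2])
  obtain ⟨s3, e3⟩ := s2.move hp0 hp hq (g := y) (by rw [hyn]; linarith) (by rwa [hyn])
  obtain ⟨s4, e4⟩ := s3.move hp0 hp hq (g := y) (by rw [hyn]; linarith) (by rwa [hyn])
  obtain ⟨s5, e5⟩ := s4.move hp0 hp hq (g := y) (by rw [hyn]; linarith) (by rwa [hyn])
  rw [e1, e2, e3, e4, e5]
  refine Eq.trans ?_ (betaRatio_move_first _ _ _ _ _ _).symm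
  congr 1
  have hA : ∀ A : ℂ, A * (I * x) * (-I * x) * y * y * y = p * q → pinchParam p q y x = A := by
    intro A hA
    rw [pinchParam, div_eq_iff (mul_ne_zero (pow_ne_zero 2 (Complex.ofReal_ne_zero.2 hx0.ne'))
      (pow_ne_zero 3 (Complex.ofReal_ne_zero.2 hy0.ne'))), ← hA]
    linear_combination (-A * x ^ 2 * y ^ 3) * Complex.I_sq
  exact hA _ s5.prod

/-! ### Cycles that separate the poles from their reciprocals -/

section Separation

variable {ι : Type*}

/-- The nonzero points that are neither of the form `t i p^j q^k` nor reciprocals of such points. -/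
def sepDomain (p q : ℂ) (t : ι → ℂ) : Set ℂ :=
  {z | z ≠ 0 ∧ ∀ i, dPoch p q (t i * z) ≠ 0 ∧ dPoch p q (t i / z) ≠ 0}

/-- A cycle separates the points `t i p^j q^k` from their reciprocals. -/
structure Cycle.Separates (p q : ℂ) (γ : Cycle) (t : ι → ℂ) : Prop where
  mem_inside : γ ∈ Cycle.inside (sepDomain p q t)
  winding_zero : γ.winding 0 = 1
  winding_pole : ∀ i (j k : ℕ), γ.winding (t i * p ^ j * q ^ k) = 1
  winding_inv : ∀ i (j k : ℕ), γ.winding (t i * p ^ j * q ^ k)⁻¹ = 0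

lemma isOpen_setOf_mem_sepDomain [Finite ι] (hp : ‖p‖ < 1) (hq : ‖q‖ < 1) :
    IsOpen {v : (ι → ℂ) × ℂ | v.2 ∈ sepDomain p q v.1} := by
  have hE := (differentiable_dPoch hp hq).continuous
  rw [isOpen_iff_mem_nhds]
  rintro ⟨t, z⟩ ⟨hz, h⟩
  simp only at hz h
  have e0 : ∀ᶠ v : (ι → ℂ) × ℂ in 𝓝 (t, z), v.2 ≠ 0 := continuousAt_snd.eventually_ne hz
  have e1 : ∀ᶠ v : (ι → ℂ) × ℂ in 𝓝 (t, z), ∀ i, dPoch p q (v.1 i * v.2) ≠ 0 ∧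
      dPoch p q (v.1 i / v.2) ≠ 0 := by
    refine eventually_all.2 fun i => ?_
    have hi : ContinuousAt (fun v : (ι → ℂ) × ℂ => v.1 i) (t, z) := by fun_prop
    have h1 : ContinuousAt (fun v : (ι → ℂ) × ℂ => dPoch p q (v.1 i * v.2)) (t, z) :=
      hE.continuousAt.comp (f := fun v : (ι → ℂ) × ℂ => v.1 i * v.2) (hi.mul continuousAt_snd)
    have h2 : ContinuousAt (fun v : (ι → ℂ) × ℂ => dPoch p q (v.1 i / v.2)) (t, z) :=
      hE.continuousAt.comp (f := fun v : (ι → ℂ) × ℂ => v.1 i / v.2)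
        (hi.div continuousAt_snd hz)
    exact (h1.eventually_ne (h i).1).and (h2.eventually_ne (h i).2)
  filter_upwards [e0, e1] with v h0 h1
  exact ⟨h0, h1⟩

lemma isOpen_sepDomain [Finite ι] (hp : ‖p‖ < 1) (hq : ‖q‖ < 1) (t : ι → ℂ) :
    IsOpen (sepDomain p q t) :=
  (isOpen_setOf_mem_sepDomain hp hq).preimage (f := fun z => (t, z)) (by fun_prop)

lemma eq_of_notMem_sepDomain (hp : ‖p‖ < 1) (hq : ‖q‖ < 1) {t : ι → ℂ} {a : ℂ}
    (ha : a ∉ sepDomain p q t) : a = 0 ∨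
      ∃ i, ∃ j k : ℕ, a = t i * p ^ j * q ^ k ∨ a = (t i * p ^ j * q ^ k)⁻¹ := by
  by_contra! h
  refine ha ⟨h.1, fun i => ⟨fun h0 => ?_, fun h0 => ?_⟩⟩
  · obtain ⟨j, k, hjk⟩ := (dPoch_eq_zero_iff hp hq).1 h0
    exact (h.2 i j k).2 (eq_inv_of_mul_eq_one_left (by rw [← hjk]; ring))
  · obtain ⟨j, k, hjk⟩ := (dPoch_eq_zero_iff hp hq).1 h0
    have ha0 := h.1
    refine (h.2 i j k).1 ?_
    field_simp at hjk
    rw [← hjk]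

/-- Separating cycles exist only if no pole is the reciprocal of a pole. -/
lemma Cycle.Separates.mul_ne_one {γ : Cycle} {t : ι → ℂ} (h : γ.Separates p q t) (i i' : ι)
    (j k : ℕ) : t i * t i' * p ^ j * q ^ k ≠ 1 := by
  intro h0
  have h1 := h.winding_pole i j k
  have h2 := h.winding_inv i' 0 0
  rw [pow_zero, pow_zero, mul_one, mul_one,
    ← eq_inv_of_mul_eq_one_left (a := t i * p ^ j * q ^ k) (by rw [← h0]; ring), h1] at h2
  exact one_ne_zero h2

/-- By Cauchy's theorem, all separating cycles give the same integral. -/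
lemma Cycle.Separates.integral_eq [Finite ι] (hp : ‖p‖ < 1) (hq : ‖q‖ < 1) {γ γ' : Cycle}
    {t : ι → ℂ} (h : γ.Separates p q t) (h' : γ'.Separates p q t) {f : ℂ → ℂ}
    (hf : DifferentiableOn ℂ f (sepDomain p q t)) : γ.integral f = γ'.integral f := by
  have hne : (sepDomain p q t).Nonempty := by
    obtain ⟨C, hC⟩ : γ.support.Nonempty := by
      rw [Finsupp.support_nonempty_iff]
      rintro rfl
      have := h.winding_zero
      simp [winding] at this
    obtain ⟨z, hz⟩ := C.trace_nonempty
    exact ⟨z, Cycle.mem_inside.1 h.mem_inside C hC hz⟩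
  have := Cycle.integral_eq_zero (isOpen_sepDomain hp hq t) hne
    (sub_mem h.mem_inside h'.mem_inside) (fun a ha => ?_) hf
  · rwa [integral_sub, sub_eq_zero] at this
  · rw [winding_sub]
    obtain rfl | ⟨i, j, k, rfl | rfl⟩ := eq_of_notMem_sepDomain hp hq ha
    · rw [h.winding_zero, h'.winding_zero, sub_self]
    · rw [h.winding_pole, h'.winding_pole, sub_self]
    · rw [h.winding_inv, h'.winding_inv, sub_self]

lemma finite_le_norm_pow_mul_pow (hp : ‖p‖ < 1) (hq : ‖q‖ < 1) {δ : ℝ} (hδ : 0 < δ) :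
    {n : ℕ × ℕ | δ ≤ ‖p ^ n.1 * q ^ n.2‖}.Finite := by
  have h := (summable_pow_mul_pow hp hq).tendsto_cofinite_zero.eventually_lt_const hδ
  rw [eventually_cofinite] at h
  simpa only [not_lt] using h

namespace Cycle

lemma exists_bound (γ : Cycle) : ∃ R > 0, ∀ a : ℂ, R < ‖a‖ → γ.winding a = 0 := by
  have h : ∀ C : Contour, ∃ R : ℝ, ∀ w ∈ C.trace, ‖w‖ ≤ R := fun C =>
    C.isCompact_trace.exists_bound_of_continuousOn (f := fun z => z) continuousOn_id
  choose R hR using h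
  refine ⟨∑ C ∈ γ.support, |R C| + 1, by positivity, fun a ha => ?_⟩
  rw [winding_eq_sum]
  refine Finset.sum_eq_zero fun C hC => ?_
  rw [C.winding_eq_zero_of_lt (hR C), mul_zero]
  exact (le_abs_self _).trans_lt ((Finset.single_le_sum (f := fun C => |R C|)
    (fun _ _ => abs_nonneg _) hC).trans_lt ((lt_add_one _).trans ha))

lemma winding_eventually_eq {γ : Cycle} {a : ℂ} (ha : ∀ C ∈ γ.support, a ∉ C.trace) :
    ∀ᶠ b in 𝓝 a, γ.winding b = γ.winding a := by
  have : ∀ᶠ b in 𝓝 a, ∀ C ∈ γ.support, b ∉ C.trace ∧ C.winding b = C.winding a :=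
    (eventually_all_finset _).2 fun C hC => C.winding_eventually_eq (ha C hC)
  filter_upwards [this] with b hb
  rw [winding_eq_sum, winding_eq_sum]
  exact Finset.sum_congr rfl fun C hC => by rw [(hb C hC).2]

/-- A separating cycle also separates for all nearby parameters. -/
lemma Separates.eventually [Finite ι] (hp : ‖p‖ < 1) (hq : ‖q‖ < 1) (hp0 : p ≠ 0) (hq0 : q ≠ 0) {γ : Cycle}
    {t : ι → ℂ} (ht : ∀ i, t i ≠ 0) (h : γ.Separates p q t) :
    ∀ᶠ t' in 𝓝 t, γ.Separates p q t' := by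
  obtain ⟨K, hK, hKc, hγK⟩ := exists_isCompact h.mem_inside
  have e1 : ∀ᶠ t' in 𝓝 t, ∀ z ∈ K, z ∈ sepDomain p q t' :=
    hKc.eventually_forall_of_forall_eventually fun z hz =>
      (isOpen_setOf_mem_sepDomain hp hq).mem_nhds (hK hz)
  have havoid : ∀ a ∉ sepDomain p q t, ∀ C ∈ γ.support, a ∉ C.trace := fun a ha C hC hmem =>
    ha (Cycle.mem_inside.1 h.mem_inside C hC hmem)
  have hmem : ∀ i (j k : ℕ), t i * p ^ j * q ^ k ∉ sepDomain p q t := by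
    rintro i j k ⟨h0, h1⟩
    exact (h1 i).2 ((dPoch_eq_zero_iff hp hq).2 ⟨j, k, by
      rw [div_mul_eq_mul_div, div_mul_eq_mul_div, div_self h0]⟩)
  have hmem' : ∀ i (j k : ℕ), (t i * p ^ j * q ^ k)⁻¹ ∉ sepDomain p q t := by
    rintro i j k ⟨h0, h1⟩
    exact (h1 i).1 ((dPoch_eq_zero_iff hp hq).2 ⟨j, k, by
      have h2 : t i * p ^ j * q ^ k ≠ 0 := fun h2 => h0 (by rw [h2, inv_zero])
      linear_combination mul_inv_cancel₀ h2⟩)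
  -- for all but finitely many `j`, `k` the pole lies near `0` and its reciprocal near infinity
  obtain ⟨δ, hδ, hδ'⟩ : ∃ δ > 0, ∀ a : ℂ, ‖a‖ < δ → γ.winding a = 1 := by
    have := winding_eventually_eq (havoid 0 fun h0 => h0.1 rfl)
    obtain ⟨δ, hδ, h1⟩ := Metric.eventually_nhds_iff.1 this
    exact ⟨δ, hδ, fun a ha => by rw [h1 (by simpa using ha), h.winding_zero]⟩
  obtain ⟨R, hR0, hR⟩ := γ.exists_bound
  set η := min δ R⁻¹ with hηdef
  have hη : 0 < η := by positivity
  have e2 : ∀ᶠ t' in 𝓝 t, ∀ i, t' i ≠ 0 ∧ ‖t' i‖ < ‖t i‖ + 1 := by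
    refine eventually_all.2 fun i => ?_
    have hi : ContinuousAt (fun t' : ι → ℂ => t' i) t := (continuous_apply i).continuousAt
    exact (hi.eventually_ne (ht i)).and (hi.norm.eventually_lt_const (lt_add_one _))
  have e3 : ∀ᶠ t' in 𝓝 t, ∀ i, ∀ n ∈ {n : ℕ × ℕ | η / (‖t i‖ + 1) ≤ ‖p ^ n.1 * q ^ n.2‖},
      γ.winding (t' i * p ^ n.1 * q ^ n.2) = 1 ∧ γ.winding (t' i * p ^ n.1 * q ^ n.2)⁻¹ = 0 := by
    refine eventually_all.2 fun i => ?_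
    refine (eventually_all_finite (finite_le_norm_pow_mul_pow hp hq (by positivity))).2 ?_
    rintro ⟨j, k⟩ -
    have hi : ContinuousAt (fun t' : ι → ℂ => t' i * p ^ j * q ^ k) t :=
      (((continuous_apply i).mul continuous_const).mul continuous_const).continuousAt
    have hne : t i * p ^ j * q ^ k ≠ 0 :=
      mul_ne_zero (mul_ne_zero (ht i) (pow_ne_zero _ hp0)) (pow_ne_zero _ hq0)
    filter_upwards [hi.eventually (winding_eventually_eq (havoid _ (hmem i j k))),
      (hi.inv₀ hne).eventually (winding_eventually_eq (havoid _ (hmem' i j k)))] with t' h1 h2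
    exact ⟨h1.trans (h.winding_pole i j k), h2.trans (h.winding_inv i j k)⟩
  filter_upwards [e1, e2, e3] with t' h1 h2 h3
  have key : ∀ i (j k : ℕ), γ.winding (t' i * p ^ j * q ^ k) = 1 ∧
      γ.winding (t' i * p ^ j * q ^ k)⁻¹ = 0 := by
    intro i j k
    by_cases hn : η / (‖t i‖ + 1) ≤ ‖p ^ j * q ^ k‖
    · exact h3 i (j, k) hn
    · push Not at hn
      have hlt : ‖t' i * p ^ j * q ^ k‖ < η := by
        rw [mul_assoc, norm_mul]
        rw [lt_div_iff₀ (by positivity), mul_comm] at hn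
        exact (mul_le_mul_of_nonneg_right (h2 i).2.le (norm_nonneg _)).trans_lt hn
      refine ⟨hδ' _ (hlt.trans_le (min_le_left _ _)), hR _ ?_⟩
      rw [norm_inv]
      refine (lt_inv_comm₀ ?_ hR0).1 (hlt.trans_le (min_le_right _ _))
      rw [norm_pos_iff]
      exact mul_ne_zero (mul_ne_zero (h2 i).1 (pow_ne_zero _ hp0)) (pow_ne_zero _ hq0)
  exact ⟨Cycle.mem_inside.2 fun C hC => (Cycle.mem_inside.1 hγK C hC).trans h1, h.winding_zero,
    fun i j k => (key i j k).1, fun i j k => (key i j k).2⟩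

end Cycle

section Existence

variable [Finite ι] {t : ι → ℂ}

lemma finite_le_norm_pole (hp : ‖p‖ < 1) (hq : ‖q‖ < 1) {δ : ℝ} (hδ : 0 < δ) :
    {a : ℂ | (∃ i, ∃ j k : ℕ, a = t i * p ^ j * q ^ k) ∧ δ ≤ ‖a‖}.Finite := by
  have h : (⋃ i, (fun n : ℕ × ℕ => t i * p ^ n.1 * q ^ n.2) ''
      {n : ℕ × ℕ | δ / (‖t i‖ + 1) ≤ ‖p ^ n.1 * q ^ n.2‖}).Finite :=
    finite_iUnion fun i => (finite_le_norm_pow_mul_pow hp hq (by positivity)).image _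
  refine h.subset ?_
  rintro _ ⟨⟨i, j, k, rfl⟩, ha⟩
  refine mem_iUnion.2 ⟨i, (j, k), ?_, rfl⟩
  rw [mem_ofPred_eq, div_le_iff₀ (by positivity), mul_comm]
  rw [mul_assoc, norm_mul] at ha
  exact ha.trans (mul_le_mul_of_nonneg_right (by linarith) (norm_nonneg _))

/-- The points outside the domain are isolated, except for the origin. -/
lemma exists_dist_lt_of_notMem_sepDomain (hp : ‖p‖ < 1) (hq : ‖q‖ < 1) (t : ι → ℂ) {c : ℂ}
    (hc : c ≠ 0) : ∃ ε > 0, ∀ x ∉ sepDomain p q t, x ≠ c → ε < dist x c := by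
  have hcn := norm_pos_iff.2 hc
  set T := {a : ℂ | ∃ i, ∃ j k : ℕ, a = t i * p ^ j * q ^ k} with hT
  have h1 : {a | a ∈ T ∧ ‖c‖ / 2 ≤ ‖a‖}.Finite := finite_le_norm_pole hp hq (by positivity)
  have h2 : {a | a ∈ T ∧ (2 * ‖c‖)⁻¹ ≤ ‖a‖}.Finite := finite_le_norm_pole hp hq (by positivity)
  have hS := (h1.union (h2.image fun a => a⁻¹)).subset (sdiff_subset (t := {c}))
  obtain ⟨ε, hε, hball⟩ := Metric.isOpen_iff.1 hS.isClosed.isOpen_compl c (fun h => h.2 rfl)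
  refine ⟨min (ε / 2) (‖c‖ / 4), by positivity, fun x hx hxc => ?_⟩
  by_contra! hd
  have hd1 : dist x c < ε := by linarith [hd.trans (min_le_left _ _)]
  have hd2 : ‖x - c‖ ≤ ‖c‖ / 4 := by rw [← dist_eq_norm]; exact hd.trans (min_le_right _ _)
  have hn1 : ‖c‖ / 2 ≤ ‖x‖ := by
    have := norm_sub_norm_le c x
    rw [norm_sub_rev] at this
    linarith
  have hn2 : ‖x‖ ≤ 2 * ‖c‖ := by
    have := norm_sub_norm_le x c
    linarith
  refine hball hd1 ⟨?_, hxc⟩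
  obtain rfl | ⟨i, j, k, h | h⟩ := eq_of_notMem_sepDomain hp hq hx
  · rw [norm_zero] at hn1; linarith
  · exact Or.inl ⟨⟨i, j, k, h⟩, hn1⟩
  · refine Or.inr ⟨t i * p ^ j * q ^ k, ⟨⟨i, j, k, rfl⟩, ?_⟩, h.symm⟩
    rw [← inv_inv (t i * p ^ j * q ^ k), ← h, norm_inv]
    exact inv_anti₀ (by linarith) hn2

/-- A separating cycle consists of a circle about the origin and small circles about the finitely
many points that lie on the wrong side of it. -/
lemma Cycle.exists_separates (hp : ‖p‖ < 1) (hq : ‖q‖ < 1) (hp0 : p ≠ 0) (hq0 : q ≠ 0)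
    (ht : ∀ i, t i ≠ 0) (hne : ∀ i i' (j k : ℕ), t i * t i' * p ^ j * q ^ k ≠ 1) :
    ∃ γ : Cycle, γ.Separates p q t := by
  classical
  set T := {a : ℂ | ∃ i, ∃ j k : ℕ, a = t i * p ^ j * q ^ k} with hT
  have hT0 : ∀ a ∈ T, a ≠ 0 := by
    rintro _ ⟨i, j, k, rfl⟩
    exact mul_ne_zero (mul_ne_zero (ht i) (pow_ne_zero _ hp0)) (pow_ne_zero _ hq0)
  have hTc : T.Countable := by
    have : T = ⋃ i, range fun n : ℕ × ℕ => t i * p ^ n.1 * q ^ n.2 := by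
      ext a; simp [hT, eq_comm]
    rw [this]
    exact countable_iUnion fun i => countable_range _
  have hdisj : ∀ a ∈ T, a⁻¹ ∉ T := by
    rintro _ ⟨i, j, k, rfl⟩ ⟨i', j', k', h⟩
    refine hne i i' (j + j') (k + k') ?_
    have := mul_inv_cancel₀ (hT0 _ ⟨i, j, k, rfl⟩)
    rw [h] at this
    rw [← this]; ring
  have hD : ∀ x ∉ sepDomain p q t, x = 0 ∨ x ∈ T ∨ x⁻¹ ∈ T := by
    intro x hx
    obtain h | ⟨i, j, k, h | h⟩ := eq_of_notMem_sepDomain hp hq hx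
    · exact Or.inl h
    · exact Or.inr (Or.inl ⟨i, j, k, h⟩)
    · exact Or.inr (Or.inr ⟨i, j, k, by rw [h, inv_inv]⟩)
  have hDT : ∀ x ∈ T, x ∉ sepDomain p q t := by
    rintro _ ⟨i, j, k, rfl⟩ ⟨h0, h1⟩
    exact (h1 i).2 ((dPoch_eq_zero_iff hp hq).2 ⟨j, k, by
      rw [div_mul_eq_mul_div, div_mul_eq_mul_div, div_self h0]⟩)
  have hDT' : ∀ x ∈ T, x⁻¹ ∉ sepDomain p q t := by
    rintro _ ⟨i, j, k, rfl⟩ ⟨h0, h1⟩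
    exact (h1 i).1 ((dPoch_eq_zero_iff hp hq).2 ⟨j, k, by
      have h2 : t i * p ^ j * q ^ k ≠ 0 := fun h2 => h0 (by rw [h2, inv_zero])
      linear_combination mul_inv_cancel₀ h2⟩)
  obtain ⟨ρ, hρ, hρ0, -⟩ : ∃ ρ ∈ ((fun a : ℂ => ‖a‖) '' T ∪ (fun a : ℂ => ‖a⁻¹‖) '' T)ᶜ,
      ρ ∈ Ioo (0 : ℝ) 1 :=
    (((hTc.image _).union (hTc.image _)).dense_compl ℝ).exists_mem_open isOpen_Ioo
      (nonempty_Ioo.2 zero_lt_one)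
  have hρ1 : ∀ a ∈ T, ‖a‖ ≠ ρ := fun a ha h => hρ (Or.inl ⟨a, ha, h⟩)
  have hρ2 : ∀ a ∈ T, ‖a⁻¹‖ ≠ ρ := fun a ha h => hρ (Or.inr ⟨a, ha, h⟩)
  have hA : {a | a ∈ T ∧ ρ ≤ ‖a‖}.Finite := finite_le_norm_pole hp hq hρ0
  have hB : {a | a ∈ T ∧ ρ⁻¹ ≤ ‖a‖}.Finite := finite_le_norm_pole hp hq (by positivity)
  have hε : ∀ c : ℂ, ∃ ε > 0, c ≠ 0 → ∀ x ∉ sepDomain p q t, x ≠ c → ε < dist x c := by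
    intro c
    by_cases hc : c = 0
    · exact ⟨1, one_pos, fun h => absurd hc h⟩
    · obtain ⟨ε, hε, h⟩ := exists_dist_lt_of_notMem_sepDomain hp hq t hc
      exact ⟨ε, hε, fun _ => h⟩
  choose ε hε0 hε using hε
  have hcirc : ∀ c : ℂ, c ≠ 0 → ∀ x ∉ sepDomain p q t,
      (Contour.circle c (ε c)).winding x = if x = c then 1 else 0 := by
    intro c hc x hx
    split_ifs with h
    · exact Contour.winding_circle_of_lt (by rw [h, dist_self]; exact hε0 c)
    · exact Contour.winding_circle_of_gt (hε0 c).le (hε c hc x hx h)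
  have hcin : ∀ c : ℂ, c ≠ 0 → Finsupp.single (Contour.circle c (ε c)) (1 : ℂ) ∈
      Cycle.inside (sepDomain p q t) := by
    intro c hc
    refine Cycle.single_mem_inside (fun x hx => ?_) 1
    rw [Contour.trace_circle c (hε0 c).le, mem_sphere_iff_norm, ← dist_eq_norm] at hx
    by_contra h
    refine (hε c hc x h ?_).ne' hx
    rintro rfl
    rw [dist_self] at hx
    exact (hε0 x).ne hx
  set γ : Cycle := Finsupp.single (Contour.circle 0 ρ) 1 +
    (∑ a ∈ hA.toFinset, Finsupp.single (Contour.circle a (ε a)) 1) -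
    ∑ a ∈ hB.toFinset, Finsupp.single (Contour.circle a⁻¹ (ε a⁻¹)) 1 with hγ
  have hw : ∀ x ∉ sepDomain p q t, γ.winding x = (Contour.circle 0 ρ).winding x +
      (if x ∈ T ∧ ρ ≤ ‖x‖ then 1 else 0) - (if x⁻¹ ∈ T ∧ ρ⁻¹ ≤ ‖x⁻¹‖ then 1 else 0) := by
    intro x hx
    rw [hγ, Cycle.winding_sub, Cycle.winding_add, Cycle.winding_sum, Cycle.winding_sum,
      Cycle.winding_single, one_mul]
    congr 2
    · rw [Finset.sum_congr rfl (g := fun a => if x = a then (1 : ℂ) else 0) fun a ha => ?_]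
      · rw [Finset.sum_ite_eq]; simp
      · rw [Cycle.winding_single, one_mul, hcirc a (hT0 a ((hA.mem_toFinset).1 ha).1) x hx]
    · rw [Finset.sum_congr rfl (g := fun a => if x⁻¹ = a then (1 : ℂ) else 0) fun a ha => ?_]
      · rw [Finset.sum_ite_eq]; simp
      · rw [Cycle.winding_single, one_mul,
          hcirc a⁻¹ (inv_ne_zero (hT0 a ((hB.mem_toFinset).1 ha).1)) x hx]
        simp only [inv_eq_iff_eq_inv]
  refine ⟨γ, ?_, ?_, ?_, ?_⟩
  · refine sub_mem (add_mem (Cycle.single_mem_inside (fun x hx => ?_) 1)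
      (sum_mem fun a ha => hcin a (hT0 a ((hA.mem_toFinset).1 ha).1)))
      (sum_mem fun a ha => hcin a⁻¹ (inv_ne_zero (hT0 a ((hB.mem_toFinset).1 ha).1)))
    rw [Contour.trace_circle 0 hρ0.le, mem_sphere_zero_iff_norm] at hx
    by_contra h
    rcases hD x h with rfl | h | h
    · rw [norm_zero] at hx; exact hρ0.ne hx
    · exact hρ1 x h hx
    · refine hρ2 _ h ?_
      rw [inv_inv, hx]
  · rw [hw 0 (fun h => h.1 rfl), Contour.winding_circle_of_lt (by simpa using hρ0), if_neg, if_neg]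
    · ring
    · rintro ⟨h, -⟩; exact hT0 _ h inv_zero
    · rintro ⟨h, -⟩; exact hT0 _ h rfl
  · intro i j k
    have hx : t i * p ^ j * q ^ k ∈ T := ⟨i, j, k, rfl⟩
    generalize t i * p ^ j * q ^ k = x at hx
    rw [hw x (hDT x hx), if_neg (c := x⁻¹ ∈ T ∧ ρ⁻¹ ≤ ‖x⁻¹‖) fun h => hdisj x hx h.1]
    rcases (hρ1 x hx).lt_or_gt with h | h
    · rw [Contour.winding_circle_of_lt (by simpa using h), if_neg fun h' => h'.2.not_gt h]
      ring
    · rw [Contour.winding_circle_of_gt hρ0.le (by simpa using h), if_pos ⟨hx, h.le⟩]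
      ring
  · intro i j k
    have hx : t i * p ^ j * q ^ k ∈ T := ⟨i, j, k, rfl⟩
    generalize t i * p ^ j * q ^ k = x at hx
    rw [hw x⁻¹ (hDT' x hx), if_neg fun h => hdisj x hx h.1, inv_inv]
    have hxn := norm_pos_iff.2 (hT0 x hx)
    rcases (hρ2 x hx).lt_or_gt with h | h
    · have h' : ρ⁻¹ ≤ ‖x‖ := by rw [norm_inv] at h; exact (inv_lt_of_inv_lt₀ hxn h).le
      rw [Contour.winding_circle_of_lt (by simpa using h), if_pos ⟨hx, h'⟩]
      ring
    · have h' : ¬(x ∈ T ∧ ρ⁻¹ ≤ ‖x‖) := fun h' => by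
        rw [norm_inv, lt_inv_comm₀ hρ0 hxn] at h; exact h'.2.not_gt h
      rw [Contour.winding_circle_of_gt hρ0.le (by simpa using h), if_neg h']
      ring

end Existence

end Separation

/-! ### The elliptic beta integral over a separating contour -/

/-- The integrand of the elliptic beta integral with a vector of parameters. -/
def betaKernel (p q : ℂ) (t : Fin 6 → ℂ) (z : ℂ) : ℂ :=
  z⁻¹ * betaIntegrand p q (t 0) (t 1) (t 2) (t 3) (t 4) (t 5) z

/-- The value of the elliptic beta integral with a vector of parameters. -/
def betaValue (p q : ℂ) (t : Fin 6 → ℂ) : ℂ := betaProd p q (t 0) (t 1) (t 2) (t 3) (t 4) (t 5)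

lemma differentiableAt_betaKernel {X : Type*} [NormedAddCommGroup X] [NormedSpace ℂ X]
    (hp : ‖p‖ < 1) (hq : ‖q‖ < 1) {t : X → Fin 6 → ℂ} {ζ : X → ℂ} {x : X}
    (ht : ∀ i, DifferentiableAt ℂ (fun y => t y i) x) (hζ : DifferentiableAt ℂ ζ x)
    (ht0 : ∀ i, t x i ≠ 0) (hx : ζ x ∈ sepDomain p q (t x)) :
    DifferentiableAt ℂ (fun y => betaKernel p q (t y) (ζ y)) x := by
  have key : ∀ i, DifferentiableAt ℂ (fun y => gammaPair p q (t y i) (ζ y)) x := fun i =>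
    DifferentiableAt.gammaPair_comp hp hq (ht i) hζ (ht0 i) hx.1 (hx.2 i).1 (hx.2 i).2
  have hinv : DifferentiableAt ℂ (fun y => (ζ y)⁻¹) x := (differentiableAt_inv hx.1).comp x hζ
  exact hinv.mul ((DifferentiableAt.weight_sq_comp hp hq hζ hx.1).mul ((((((key 0).mul
    (key 1)).mul (key 2)).mul (key 3)).mul (key 4)).mul (key 5)))

lemma differentiableAt_betaValue (hp : ‖p‖ < 1) (hq : ‖q‖ < 1) {t : ℂ → Fin 6 → ℂ} {x : ℂ}
    (ht : ∀ i, DifferentiableAt ℂ (fun y => t y i) x) (ht0 : ∀ i, t x i ≠ 0)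
    (hne : ∀ i i' (j k : ℕ), t x i * t x i' * p ^ j * q ^ k ≠ 1) :
    DifferentiableAt ℂ (fun y => betaValue p q (t y)) x := by
  have hmem : ∀ u ∈ ({t x 0, t x 1, t x 2, t x 3, t x 4, t x 5} : Set ℂ), ∃ i, u = t x i := by
    intro u hu
    simp only [mem_insert_iff, mem_singleton_iff] at hu
    rcases hu with h | h | h | h | h | h <;> exact ⟨_, h⟩
  refine differentiableAt_betaProd hp hq (ht 0) (ht 1) (ht 2) (ht 3) (ht 4) (ht 5) (ht0 0) (ht0 1)
    (ht0 2) (ht0 3) (ht0 4) (ht0 5) fun u hu v hv h0 => ?_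
  obtain ⟨i, rfl⟩ := hmem u hu
  obtain ⟨i', rfl⟩ := hmem v hv
  obtain ⟨j, k, h⟩ := (dPoch_eq_zero_iff hp hq).1 h0
  exact hne i i' j k h

/-- If all parameters have modulus less than `1`, the unit circle separates. -/
lemma separates_unit_circle {ι : Type*} (hp : ‖p‖ < 1) (hq : ‖q‖ < 1) (hp0 : p ≠ 0) (hq0 : q ≠ 0)
    {t : ι → ℂ} (ht0 : ∀ i, t i ≠ 0) (ht : ∀ i, ‖t i‖ < 1) :
    Cycle.Separates p q (Finsupp.single (Contour.circle 0 1) 1) t := by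
  have hle : ∀ i (j k : ℕ), ‖t i * p ^ j * q ^ k‖ < 1 := by
    intro i j k
    rw [norm_mul, norm_mul, norm_pow, norm_pow, mul_assoc]
    refine mul_lt_one_of_nonneg_of_lt_one_left (norm_nonneg _) (ht i) ?_
    exact mul_le_one₀ (pow_le_one₀ (norm_nonneg _) hp.le) (by positivity)
      (pow_le_one₀ (norm_nonneg _) hq.le)
  refine ⟨Cycle.single_mem_inside (fun z hz => ?_) 1, ?_, fun i j k => ?_, fun i j k => ?_⟩
  · rw [Contour.trace_circle 0 zero_le_one, mem_sphere_zero_iff_norm] at hz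
    exact ⟨norm_ne_zero_of_eq_one hz, fun i => gammaPair_factors_ne_zero hp hq (ht i) hz⟩
  · rw [Cycle.winding_single, Contour.winding_circle_of_lt (by simp), mul_one]
  · rw [Cycle.winding_single, Contour.winding_circle_of_lt (by simpa using hle i j k), mul_one]
  · rw [Cycle.winding_single, Contour.winding_circle_of_gt zero_le_one, mul_zero]
    have h0 : t i * p ^ j * q ^ k ≠ 0 :=
      mul_ne_zero (mul_ne_zero (ht0 i) (pow_ne_zero _ hp0)) (pow_ne_zero _ hq0)
    rw [dist_zero_right, norm_inv]
    exact (one_lt_inv₀ (norm_pos_iff.2 h0)).2 (hle i j k)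

/-- An exponential function that is not identically equal to `1` assumes this value at most
countably often. -/
lemma countable_setOf_mul_exp_eq_one {m c : ℂ} (hm : m ≠ 1) :
    {x : ℂ | m * Complex.exp (x * c) = 1}.Countable := by
  rcases eq_or_ne c 0 with rfl | hc
  · simp [hm]
  · refine (countable_range fun n : ℤ => (Complex.log m⁻¹ + n * (2 * Real.pi * I)) / c).mono ?_
    intro x hx
    have hx' : m * Complex.exp (x * c) = 1 := hx
    have hm0 : m ≠ 0 := by rintro rfl; simp at hx'
    have h1 : Complex.exp (x * c) = Complex.exp (Complex.log m⁻¹) := by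
      rw [Complex.exp_log (inv_ne_zero hm0)]
      exact eq_inv_of_mul_eq_one_right hx'
    obtain ⟨n, hn⟩ := Complex.exp_eq_exp_iff_exists_int.1 h1
    exact ⟨n, by simp only; rw [← hn, mul_div_cancel_right₀ _ hc]⟩

/-- The elliptic beta integral over a separating cycle. The parameters are moved along a curve in
parameter space to a point where the unit circle separates; both sides depend holomorphically on
the complexified position on this curve, outside of the countable set of positions at which poles
coincide with reciprocals of poles. -/
theorem Cycle.Separates.integral_betaKernel (hp : ‖p‖ < 1) (hq : ‖q‖ < 1) (hp0 : p ≠ 0) (hq0 : q ≠ 0)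
    {t : Fin 6 → ℂ} (ht : ∏ i, t i = p * q) {γ : Cycle} (hγ : γ.Separates p q t) :
    γ.integral (betaKernel p q t) =
      4 * Real.pi * I / (qPoch p p * qPoch q q) * betaValue p q t := by
  have ht0 : ∀ i, t i ≠ 0 := by
    have : ∏ i, t i ≠ 0 := by rw [ht]; exact mul_ne_zero hp0 hq0
    simpa [Finset.prod_ne_zero_iff] using this
  have hpn := norm_pos_iff.2 hp0
  have hqn := norm_pos_iff.2 hq0
  set c : Fin 6 → ℝ := fun i =>
    Real.log ‖p‖ / 6 - Real.log ‖t i‖ + (if i = 0 then Real.log ‖q‖ else 0) with hc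
  have hcsum : ∑ i, c i = 0 := by
    have h1 : ∑ i, Real.log ‖t i‖ = Real.log ‖p‖ + Real.log ‖q‖ := by
      rw [← Real.log_mul hpn.ne' hqn.ne', ← norm_mul, ← ht, norm_prod,
        Real.log_prod fun i _ => (norm_pos_iff.2 (ht0 i)).ne']
    rw [hc, Finset.sum_add_distrib, Finset.sum_sub_distrib, h1, Finset.sum_ite_eq']
    simp
    ring
  set τ : ℂ → Fin 6 → ℂ := fun x i => t i * Complex.exp (x * c i) with hτ
  have hτ0 : ∀ x i, τ x i ≠ 0 := fun x i => mul_ne_zero (ht0 i) (Complex.exp_ne_zero _)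
  have hτd : ∀ x i, DifferentiableAt ℂ (fun y => τ y i) x := fun x i => by
    simp only [hτ]; fun_prop
  have hτprod : ∀ x, ∏ i, τ x i = p * q := by
    intro x
    simp only [hτ]
    rw [Finset.prod_mul_distrib, ht, ← Complex.exp_sum, ← Finset.mul_sum, ← Complex.ofReal_sum,
      hcsum, Complex.ofReal_zero, mul_zero, Complex.exp_zero, mul_one]
  have hτzero : τ 0 = t := by ext i; simp [hτ]
  set Λ : Set ℂ := {x | ∃ γ : Cycle, γ.Separates p q (τ x)} with hΛ
  have hτc : ∀ x, ContinuousAt τ x := fun x => continuousAt_pi.2 fun i => (hτd x i).continuousAt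
  have hev : ∀ x, ∀ γ : Cycle, γ.Separates p q (τ x) → ∀ᶠ y in 𝓝 x, γ.Separates p q (τ y) :=
    fun x γ h => (hτc x).eventually (h.eventually hp hq hp0 hq0 (hτ0 x))
  have hΛo : IsOpen Λ := isOpen_iff_mem_nhds.2 fun x ⟨γ, h⟩ => (hev x γ h).mono fun y hy => ⟨γ, hy⟩
  have hΛc : Λᶜ.Countable := by
    have hS : (⋃ (i : Fin 6) (i' : Fin 6) (j : ℕ) (k : ℕ), {x : ℂ | t i * t i' * p ^ j * q ^ k *
        Complex.exp (x * (c i + c i')) = 1}).Countable :=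
      countable_iUnion fun i => countable_iUnion fun i' => countable_iUnion fun j =>
        countable_iUnion fun k => countable_setOf_mul_exp_eq_one (hγ.mul_ne_one i i' j k)
    refine hS.mono fun x hx => ?_
    by_contra hx'
    refine hx (Cycle.exists_separates hp hq hp0 hq0 (hτ0 x) fun i i' j k h => hx' ?_)
    simp only [mem_iUnion]
    refine ⟨i, i', j, k, ?_⟩
    rw [mem_ofPred_eq, ← h, mul_add, Complex.exp_add]
    simp only [hτ]
    ring
  have hΛp : IsPreconnected Λ := by
    have := hΛc.isConnected_compl_of_one_lt_rank (by rw [Complex.rank_real_complex]; norm_num)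
    rw [compl_compl] at this
    exact this.isPreconnected
  classical
  set J : ℂ → ℂ := fun x => if h : ∃ γ : Cycle, γ.Separates p q (τ x) then
    h.choose.integral (betaKernel p q (τ x)) else 0 with hJ
  have hker : ∀ x, DifferentiableOn ℂ (betaKernel p q (τ x)) (sepDomain p q (τ x)) :=
    fun x z hz => (differentiableAt_betaKernel hp hq (t := fun _ => τ x)
      (fun i => differentiableAt_const _) differentiableAt_id (hτ0 x) hz).differentiableWithinAt
  have hJeq : ∀ x (γ : Cycle), γ.Separates p q (τ x) →
      J x = γ.integral (betaKernel p q (τ x)) := by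
    intro x γ h
    have hex : ∃ γ : Cycle, γ.Separates p q (τ x) := ⟨γ, h⟩
    rw [hJ]
    simp only
    rw [dif_pos hex]
    exact hex.choose_spec.integral_eq hp hq h (hker x)
  have hJd : DifferentiableOn ℂ J Λ := by
    rintro x ⟨γ, h⟩
    obtain ⟨U, hU, hUo, hxU⟩ := eventually_nhds_iff.1 (hev x γ h)
    have h1 : DifferentiableOn ℂ (fun y => γ.integral (betaKernel p q (τ y))) U := by
      simp only [Cycle.integral_eq_sum]
      refine DifferentiableOn.fun_sum fun C hC => DifferentiableOn.const_mul ?_ _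
      have hd : ∀ y ∈ U, ∀ z ∈ C.trace,
          DifferentiableAt ℂ (fun v : ℂ × ℂ => betaKernel p q (τ v.1) v.2) (y, z) := by
        intro y hy z hz
        refine differentiableAt_betaKernel hp hq (t := fun v : ℂ × ℂ => τ v.1) (fun i => ?_)
          differentiableAt_snd (hτ0 y) (Cycle.mem_inside.1 (hU y hy).mem_inside C hC hz)
        exact (hτd y i).comp (y, z) (f := fun v : ℂ × ℂ => v.1) differentiableAt_fst
      refine C.differentiableOn_integral hUo (fun v hv => ?_) fun z hz y hy => ?_
      · exact (hd v.1 hv.1 v.2 hv.2).continuousAt.continuousWithinAt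
      · exact ((hd y hy z hz).comp y (f := fun y => (y, z))
          (differentiableAt_id.prodMk (differentiableAt_const z))).differentiableWithinAt
    have h2 : (fun y => γ.integral (betaKernel p q (τ y))) =ᶠ[𝓝 x] J :=
      (hev x γ h).mono fun y hy => (hJeq y γ hy).symm
    exact ((h1.differentiableAt (hUo.mem_nhds hxU)).congr_of_eventuallyEq
      h2.symm).differentiableWithinAt
  have hVd : DifferentiableOn ℂ (fun x => 4 * Real.pi * I / (qPoch p p * qPoch q q) *
      betaValue p q (τ x)) Λ := by
    rintro x ⟨γ, h⟩
    exact ((differentiableAt_betaValue hp hq (hτd x) (hτ0 x)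
      h.mul_ne_one).const_mul _).differentiableWithinAt
  -- near `x = 1` all parameters are small
  have hnear : ∀ᶠ x in 𝓝 (1 : ℂ), ‖τ x 0‖ < ‖q‖ ∧ ∀ i, ‖τ x i‖ < 1 := by
    have hexp : Real.exp (Real.log ‖p‖ / 6) < 1 := by
      rw [Real.exp_lt_one_iff]
      have := Real.log_neg hpn hp
      linarith
    have hn : ∀ i, ‖τ 1 i‖ = Real.exp (Real.log ‖p‖ / 6) * (if i = 0 then ‖q‖ else 1) := by
      intro i
      simp only [hτ]
      rw [norm_mul, one_mul, Complex.norm_exp, Complex.ofReal_re]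
      simp only [hc]
      rw [Real.exp_add, Real.exp_sub, Real.exp_log (norm_pos_iff.2 (ht0 i))]
      have := (norm_pos_iff.2 (ht0 i)).ne'
      split_ifs
      · rw [Real.exp_log hqn]; field_simp
      · rw [Real.exp_zero]; field_simp
    have h0 : ‖τ 1 0‖ < ‖q‖ := by
      rw [hn, if_pos rfl]
      exact mul_lt_of_lt_one_left hqn hexp
    have hi : ∀ i, ‖τ 1 i‖ < 1 := by
      intro i
      rw [hn]
      split_ifs
      · exact mul_lt_one_of_nonneg_of_lt_one_left (Real.exp_pos _).le hexp hq.le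
      · rwa [mul_one]
    exact ((hτd 1 0).continuousAt.norm.eventually_lt_const h0).and (eventually_all.2 fun i =>
      (hτd 1 i).continuousAt.norm.eventually_lt_const (hi i))
  have heq : J =ᶠ[𝓝 1] fun x => 4 * Real.pi * I / (qPoch p p * qPoch q q) *
      betaValue p q (τ x) := by
    filter_upwards [hnear] with x ⟨hx0, hx⟩
    have hprod : τ x 0 * τ x 1 * τ x 2 * τ x 3 * τ x 4 * τ x 5 = p * q := by
      rw [← hτprod x, Fin.prod_univ_six]
    have hsmall : SmallParams p q (τ x 0) (τ x 1) (τ x 2) (τ x 3) (τ x 4) (τ x 5) :=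
      ⟨hτ0 x 0, hτ0 x 1, hτ0 x 2, hτ0 x 3, hτ0 x 4, hτ0 x 5, hx0, hx 1, hx 2, hx 3, hx 4, hx 5,
        hprod⟩
    have hV := betaProd_ne_zero hp hq (hτ0 x 0) (hτ0 x 1) (hτ0 x 2) (hτ0 x 3) (hτ0 x 4) (hτ0 x 5)
      (hx 0) (hx 1) (hx 2) (hx 3) (hx 4) (hx 5) hprod
    rw [hJeq x _ (separates_unit_circle hp hq hp0 hq0 (hτ0 x) hx), Cycle.integral_single, one_mul,
      Contour.integral_circle, betaValue, ← hsmall.betaRatio_eq hp0 hp hq, betaRatio,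
      div_mul_cancel₀ _ hV]
    rfl
  have h1Λ : (1 : ℂ) ∈ Λ :=
    ⟨_, separates_unit_circle hp hq hp0 hq0 (hτ0 1) hnear.self_of_nhds.2⟩
  have h0Λ : (0 : ℂ) ∈ Λ := ⟨γ, by rwa [hτzero]⟩
  have hall := AnalyticOnNhd.eqOn_of_preconnected_of_eventuallyEq (hJd.analyticOnNhd hΛo)
    (hVd.analyticOnNhd hΛo) hΛp h1Λ heq h0Λ
  rw [hJeq 0 γ (by rwa [hτzero])] at hall
  simp only [hτzero] at hall
  exact hall

/-! ### Iterated contour integrals -/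

namespace Contour

lemma integrable_mul (C : Contour) {f g : ℂ → ℂ} (hf : ContinuousOn f C.trace)
    (hg : C.Integrable g) : C.Integrable fun z => f z * g z := by
  rw [integrable_iff] at hg ⊢
  obtain ⟨M, hM⟩ := C.isCompact_trace.exists_bound_of_continuousOn hf
  simp only [mul_assoc]
  refine hg.bdd_mul (c := M) (C.aestronglyMeasurable_comp hf) ?_
  filter_upwards [C.ae_mem_trace] with θ hθ
  exact hM _ hθ

/-- Fubini's theorem for two contours, a continuous kernel and an integrable function. -/
lemma integral_comm (C C' : Contour) {F : ℂ → ℂ → ℂ} {α : ℂ → ℂ}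
    (hF : ContinuousOn (fun v : ℂ × ℂ => F v.1 v.2) (C'.trace ×ˢ C.trace)) (hα : C.Integrable α) :
    C'.integral (fun x => C.integral fun z => F x z * α z) =
      C.integral (fun z => C'.integral (fun x => F x z) * α z) := by
  rw [integrable_iff] at hα
  simp only [integral_eq]
  set μ : Measure ℝ := volume.restrict (Ioc (0 : ℝ) 1) with hμ
  obtain ⟨M, hM⟩ := (C'.isCompact_trace.prod C.isCompact_trace).exists_bound_of_continuousOn hF
  obtain ⟨K, hK0, hK⟩ := C'.exists_deriv_bound
  have hint : MeasureTheory.Integrable (fun v : ℝ × ℝ => F (C'.toFun v.1) (C.toFun v.2) *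
      deriv C'.toFun v.1 * (α (C.toFun v.2) * deriv C.toFun v.2)) (μ.prod μ) := by
    refine (hα.comp_snd μ).bdd_mul (c := M * K) ?_ ?_
    · refine AEStronglyMeasurable.mul ?_ C'.aestronglyMeasurable_deriv.comp_fst
      rw [hμ, Measure.prod_restrict]
      refine ContinuousOn.aestronglyMeasurable ?_ (measurableSet_Ioc.prod measurableSet_Ioc)
      refine hF.comp (f := fun v : ℝ × ℝ => (C'.toFun v.1, C.toFun v.2)) ?_ ?_
      · refine ContinuousOn.prodMk (C'.continuousOn.comp continuousOn_fst ?_)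
          (C.continuousOn.comp continuousOn_snd ?_)
        · exact fun v hv => Ioc_subset_Icc_self hv.1
        · exact fun v hv => Ioc_subset_Icc_self hv.2
      · exact fun v hv => ⟨C'.mem_trace (Ioc_subset_Icc_self hv.1),
          C.mem_trace (Ioc_subset_Icc_self hv.2)⟩
    · have e1 := Measure.quasiMeasurePreserving_fst (μ := μ) (ν := μ) |>.ae
        (hK.and C'.ae_mem_trace)
      have e2 := Measure.quasiMeasurePreserving_snd (μ := μ) (ν := μ) |>.ae C.ae_mem_trace
      filter_upwards [e1, e2] with v h1 h2
      rw [norm_mul]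
      have h3 := hM (C'.toFun v.1, C.toFun v.2) ⟨h1.2, h2⟩
      exact mul_le_mul h3 h1.1 (norm_nonneg _) ((norm_nonneg _).trans h3)
  have hswap := MeasureTheory.integral_integral_swap (f := fun x z => F (C'.toFun x) (C.toFun z) *
      deriv C'.toFun x * (α (C.toFun z) * deriv C.toFun z)) hint
  refine Eq.trans ?_ (hswap.trans ?_)
  · congr 1
    ext x
    rw [← MeasureTheory.integral_mul_const]
    congr 1
    ext z
    ring
  · congr 1
    ext z
    rw [MeasureTheory.integral_mul_const, mul_assoc]

lemma integral_comm' (C C' : Contour) {F : ℂ → ℂ → ℂ}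
    (hF : ContinuousOn (fun v : ℂ × ℂ => F v.1 v.2) (C'.trace ×ˢ C.trace)) :
    C'.integral (fun x => C.integral fun z => F x z) =
      C.integral (fun z => C'.integral (fun x => F x z)) := by
  simpa using C.integral_comm C' (α := fun _ => 1) hF
    (C.integrable_of_continuousOn continuousOn_const)

/-- If `C` winds around `t C'` and `C'` does not wind around `t⁻¹ C`, then `C` winds around `t b`
as often as `C'` winds around `b`. -/
lemma winding_mul (C C' : Contour) {t b : ℂ} (ht : t ≠ 0) {n m : ℂ}
    (hC : ∀ x ∈ C'.trace, t * x ∉ C.trace ∧ C.winding (t * x) = n)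
    (hC' : ∀ z ∈ C.trace, C'.winding (z / t) = m) (hb : b ∉ C'.trace) (htb : t * b ∉ C.trace) :
    C.winding (t * b) * (C'.winding b - m) = n * C'.winding b := by
  have hπ := Complex.two_pi_I_ne_zero
  have h1 : ∀ x ∈ C'.trace, x - b ≠ 0 := fun x hx h => hb (by rwa [← sub_eq_zero.1 h])
  have h2 : ∀ x ∈ C'.trace, ∀ z ∈ C.trace, z - t * x ≠ 0 := fun x hx z hz h =>
    (hC x hx).1 (by rwa [← sub_eq_zero.1 h])
  have h3 : ∀ z ∈ C.trace, z - t * b ≠ 0 := fun z hz h => htb (by rwa [← sub_eq_zero.1 h])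
  have hF : ContinuousOn (fun v : ℂ × ℂ => (v.1 - b)⁻¹ * (v.2 - t * v.1)⁻¹)
      (C'.trace ×ˢ C.trace) :=
    ContinuousOn.mul (ContinuousOn.inv₀ (by fun_prop) fun v hv => h1 _ hv.1)
      (ContinuousOn.inv₀ (by fun_prop) fun v hv => h2 _ hv.1 _ hv.2)
  have hswap := C.integral_comm' C' (F := fun x z => (x - b)⁻¹ * (z - t * x)⁻¹) hF
  have hl : C'.integral (fun x => C.integral fun z => (x - b)⁻¹ * (z - t * x)⁻¹) =
      2 * Real.pi * I * n * (2 * Real.pi * I * C'.winding b) := by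
    rw [← integral_inv_sub, ← integral_const_mul]
    refine C'.integral_congr fun x hx => ?_
    rw [integral_const_mul, integral_inv_sub, (hC x hx).2, mul_comm]
  have hr : C.integral (fun z => C'.integral fun x => (x - b)⁻¹ * (z - t * x)⁻¹) =
      2 * Real.pi * I * (C'.winding b - m) * (2 * Real.pi * I * C.winding (t * b)) := by
    rw [← integral_inv_sub, ← integral_const_mul]
    refine C.integral_congr fun z hz => ?_
    have h4 : ∀ x ∈ C'.trace, x - z / t ≠ 0 := fun x hx h => h2 x hx z hz (by
      rw [sub_eq_zero.1 h]; field_simp; ring)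
    have h5 : C'.integral (fun x => (x - b)⁻¹ * (z - t * x)⁻¹) =
        C'.integral fun x => (z - t * b)⁻¹ * ((x - b)⁻¹ - (x - z / t)⁻¹) := by
      refine C'.integral_congr fun x hx => ?_
      have e1 := h1 x hx
      have e2 := h2 x hx z hz
      have e3 := h3 z hz
      have e4 : x - z / t = -(z - t * x) / t := by field_simp; ring
      rw [e4, inv_div, div_neg, sub_neg_eq_add, div_eq_mul_inv]
      linear_combination (-(x - b)⁻¹ * (z - t * x)⁻¹) * inv_mul_cancel₀ e3 +
        (z - t * b)⁻¹ * (x - b)⁻¹ * inv_mul_cancel₀ e2 +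
        (z - t * b)⁻¹ * t * (z - t * x)⁻¹ * inv_mul_cancel₀ e1
    rw [h5, integral_const_mul, integral_sub, integral_inv_sub, integral_inv_sub, hC' z hz]
    · ring
    · exact C'.integrable_of_continuousOn (f := fun x => (x - b)⁻¹)
        (ContinuousOn.inv₀ (by fun_prop) h1)
    · exact C'.integrable_of_continuousOn (f := fun x => (x - z / t)⁻¹)
        (ContinuousOn.inv₀ (by fun_prop) h4)
  rw [hl, hr] at hswap
  refine mul_left_cancel₀ (mul_ne_zero hπ hπ) ?_
  linear_combination -hswap

/-- If `C` does not wind around the reciprocals of `t C'`, it does not wind around the reciprocal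
of `t b` either, provided that `C'` winds around `b` but not around the reciprocals of `t C`. -/
lemma winding_inv_mul (C C' : Contour) {t b : ℂ} (ht : t ≠ 0) (hb0 : b ≠ 0)
    (h0 : (0 : ℂ) ∉ C.trace) (h0' : (0 : ℂ) ∉ C'.trace)
    (hC : ∀ x ∈ C'.trace, (t * x)⁻¹ ∉ C.trace ∧ C.winding (t * x)⁻¹ = 0)
    (hC' : ∀ z ∈ C.trace, C'.winding (t * z)⁻¹ = 0) (hb : b ∉ C'.trace) (hb1 : C'.winding b = 1)
    (htb : (t * b)⁻¹ ∉ C.trace) : C.winding (t * b)⁻¹ = 0 := by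
  have hπ := Complex.two_pi_I_ne_zero
  have hz0 : ∀ z ∈ C.trace, z ≠ 0 := fun z hz h => h0 (by rwa [← h])
  have hx0 : ∀ x ∈ C'.trace, x ≠ 0 := fun x hx h => h0' (by rwa [← h])
  have h1 : ∀ x ∈ C'.trace, x - b ≠ 0 := fun x hx h => hb (by rwa [← sub_eq_zero.1 h])
  have h2 : ∀ x ∈ C'.trace, ∀ z ∈ C.trace, z - (t * x)⁻¹ ≠ 0 := fun x hx z hz h =>
    (hC x hx).1 (by rwa [← sub_eq_zero.1 h])
  have h3 : ∀ z ∈ C.trace, z - (t * b)⁻¹ ≠ 0 := fun z hz h => htb (by rwa [← sub_eq_zero.1 h])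
  have hF : ContinuousOn (fun v : ℂ × ℂ => (v.1 - b)⁻¹ * (v.2 - (t * v.1)⁻¹)⁻¹)
      (C'.trace ×ˢ C.trace) :=
    ContinuousOn.mul (ContinuousOn.inv₀ (by fun_prop) fun v hv => h1 _ hv.1)
      (ContinuousOn.inv₀ (continuousOn_snd.sub (ContinuousOn.inv₀ (by fun_prop) fun v hv =>
        mul_ne_zero ht (hx0 _ hv.1))) fun v hv => h2 _ hv.1 _ hv.2)
  have hswap := C.integral_comm' C' (F := fun x z => (x - b)⁻¹ * (z - (t * x)⁻¹)⁻¹) hF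
  have hl : C'.integral (fun x => C.integral fun z => (x - b)⁻¹ * (z - (t * x)⁻¹)⁻¹) = 0 := by
    rw [C'.integral_congr (g := fun _ => 0 * (0 : ℂ)), integral_const_mul, zero_mul]
    intro x hx
    rw [integral_const_mul, integral_inv_sub, (hC x hx).2]
    ring
  have hr : C.integral (fun z => C'.integral fun x => (x - b)⁻¹ * (z - (t * x)⁻¹)⁻¹) =
      2 * Real.pi * I * (2 * Real.pi * I * C.winding (t * b)⁻¹) := by
    rw [← integral_inv_sub, ← integral_const_mul]
    refine C.integral_congr fun z hz => ?_
    have e0 := hz0 z hz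
    have e3 := h3 z hz
    have h4 : ∀ x ∈ C'.trace, x - (t * z)⁻¹ ≠ 0 := fun x hx h => h2 x hx z hz (by
      rw [sub_eq_zero.1 h]; field_simp; ring)
    have e5 : t * b * z - 1 ≠ 0 := fun h => e3 (by
      exact sub_eq_zero.2 (eq_inv_of_mul_eq_one_left (by linear_combination h)))
    have h5 : C'.integral (fun x => (x - b)⁻¹ * (z - (t * x)⁻¹)⁻¹) =
        C'.integral fun x => (z - (t * b)⁻¹)⁻¹ * ((x - b)⁻¹ -
          (t * b * z)⁻¹ * (x - (t * z)⁻¹)⁻¹) := by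
      refine C'.integral_congr fun x hx => ?_
      have e1 := h1 x hx
      have e2 := hx0 x hx
      have e6 : t * x * z - 1 ≠ 0 := fun h => h2 x hx z hz (by
        exact sub_eq_zero.2 (eq_inv_of_mul_eq_one_left (by linear_combination h)))
      have e7 : z - (t * x)⁻¹ = (t * x * z - 1) / (t * x) := by field_simp
      have e8 : z - (t * b)⁻¹ = (t * b * z - 1) / (t * b) := by field_simp
      have e9 : x - (t * z)⁻¹ = (t * x * z - 1) / (t * z) := by field_simp
      have e10 : (t * b * z)⁻¹ * (t * z / (t * x * z - 1)) = b⁻¹ * (t * x * z - 1)⁻¹ := by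
        rw [div_eq_mul_inv]; field_simp
      rw [e7, e8, e9, inv_div, inv_div, inv_div, e10, div_eq_mul_inv, div_eq_mul_inv]
      linear_combination (-t * (x - b)⁻¹ * (t * x * z - 1)⁻¹ * x) * inv_mul_cancel₀ e5 +
        t * b * (t * b * z - 1)⁻¹ * (x - b)⁻¹ * inv_mul_cancel₀ e6 -
        t * (t * b * z - 1)⁻¹ * (t * x * z - 1)⁻¹ * inv_mul_cancel₀ e1 +
        t * (t * b * z - 1)⁻¹ * (t * x * z - 1)⁻¹ * mul_inv_cancel₀ hb0
    rw [h5, integral_const_mul, integral_sub, integral_const_mul, integral_inv_sub,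
      integral_inv_sub, hC' z hz, hb1]
    · ring
    · exact C'.integrable_of_continuousOn (f := fun x => (x - b)⁻¹)
        (ContinuousOn.inv₀ (by fun_prop) h1)
    · exact C'.integrable_of_continuousOn (f := fun x => (t * b * z)⁻¹ * (x - (t * z)⁻¹)⁻¹)
        (continuousOn_const.mul (ContinuousOn.inv₀ (by fun_prop) h4))
  rw [hl, hr] at hswap
  simpa [hπ, Real.pi_ne_zero] using hswap.symm

end Contour

/-! ### The operators of the Bailey lemma -/

lemma ellGamma4_eq_gammaPair (a x y : ℂ) :
    ellGamma4 p q a x y = gammaPair p q (a * x) y * gammaPair p q (a * x⁻¹) y := by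
  simp only [ellGamma4, gammaPair, div_eq_mul_inv]

lemma ellGamma4_comm (a x y : ℂ) : ellGamma4 p q a x y = ellGamma4 p q a y x := by
  rw [ellGamma4, ellGamma4, mul_right_comm a y x, mul_right_comm a y x⁻¹, mul_right_comm a y⁻¹ x,
    mul_right_comm a y⁻¹ x⁻¹]
  ring

/-- The products `1 / Γ(z^{±2})` in `M` may be replaced by `weight`, since the two differ
at countably many points only. -/
lemma M_eq (hp : ‖p‖ < 1) (hq : ‖q‖ < 1) (C : Contour) (t w : ℂ) (f : ℂ → ℂ) :
    M p q C t f w = qPoch p p * qPoch q q / (4 * Real.pi * I) * ((ellGamma p q (t ^ 2))⁻¹ *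
      C.integral fun z => z⁻¹ * weight p q (z ^ 2) * ellGamma4 p q t w z * f z) := by
  rw [M]
  congr 1
  rw [← C.integral_const_mul]
  set S : Set ℂ := (⋃ (j : ℕ) (k : ℕ), {z : ℂ | z ^ 2 = (p ^ (j + 1) * q ^ (k + 1))⁻¹}) ∪
    ⋃ (j : ℕ) (k : ℕ), {z : ℂ | z ^ 2 = p ^ (j + 1) * q ^ (k + 1)} with hS
  have hSc : S.Countable :=
    (countable_iUnion fun j => countable_iUnion fun k => countable_sq_eq _).union
      (countable_iUnion fun j => countable_iUnion fun k => countable_sq_eq _)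
  refine C.integral_congr_of_countable hSc fun z _ hz => ?_
  have h1 : dPoch p q (p * q * z ^ 2) ≠ 0 := fun h => hz (Or.inl (by
    obtain ⟨j, k, hjk⟩ := (dPoch_eq_zero_iff hp hq).1 h
    simp only [mem_iUnion]
    exact ⟨j, k, eq_inv_of_mul_eq_one_left (by rw [← hjk]; ring)⟩))
  have h2 : dPoch p q (p * q * (z ^ 2)⁻¹) ≠ 0 := fun h => hz (Or.inr (by
    obtain ⟨j, k, hjk⟩ := (dPoch_eq_zero_iff hp hq).1 h
    simp only [mem_iUnion]
    refine ⟨j, k, inv_injective ?_⟩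
    exact eq_inv_of_mul_eq_one_left (by rw [← hjk]; ring)))
  rw [inv_pow, ← inv_ellGamma_mul hp hq h1 h2, div_eq_mul_inv, div_eq_mul_inv, mul_inv]
  ring

lemma D_mul_D_inv (hp : ‖p‖ < 1) (hq : ‖q‖ < 1) (hp0 : p ≠ 0) (hq0 : q ≠ 0) {r s u w : ℂ}
    (hr : r ^ 2 = p * q) (hs : s ≠ 0) (hu : u ≠ 0) (hw : w ≠ 0) (h1 : DDefined p q r s u w)
    (h2 : DDefined p q r s⁻¹ u w) : D p q r s u w * D p q r s⁻¹ u w = 1 := by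
  have hne : ∀ a : ℂ, w ∉ poles p q a u → w⁻¹ ∉ poles p q a u →
      dPoch p q (a * u * w) ≠ 0 ∧ dPoch p q (a * u * w⁻¹) ≠ 0 ∧ dPoch p q (a * u⁻¹ * w) ≠ 0 ∧
        dPoch p q (a * u⁻¹ * w⁻¹) ≠ 0 := by
    intro a ha ha'
    have key : ∀ b v : ℂ, v ≠ 0 → dPoch p q (b * v) = 0 → ∃ j k : ℕ, v⁻¹ = b * p ^ j * q ^ k := by
      intro b v hv h
      obtain ⟨j, k, hjk⟩ := (dPoch_eq_zero_iff hp hq).1 h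
      exact ⟨j, k, inv_eq_of_mul_eq_one_right (by rw [← hjk]; ring)⟩
    refine ⟨fun h => ?_, fun h => ?_, fun h => ?_, fun h => ?_⟩
    · obtain ⟨j, k, h⟩ := key _ _ hw h
      exact ha' ⟨j, k, Or.inl h⟩
    · obtain ⟨j, k, h⟩ := key _ _ (inv_ne_zero hw) h
      exact ha ⟨j, k, Or.inl (by rw [← h, inv_inv])⟩
    · obtain ⟨j, k, h⟩ := key _ _ hw h
      exact ha' ⟨j, k, Or.inr h⟩
    · obtain ⟨j, k, h⟩ := key _ _ (inv_ne_zero hw) h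
      exact ha ⟨j, k, Or.inr (by rw [← h, inv_inv])⟩
  obtain ⟨a1, a2, a3, a4⟩ := hne _ h1.1 h1.2
  obtain ⟨b1, b2, b3, b4⟩ := hne _ h2.1 h2.2
  have e1 := ellGamma_mul_ellGamma hp hq hp0 hq0 (by rw [← hr]; field_simp) a1 b4
  have e2 := ellGamma_mul_ellGamma hp hq hp0 hq0 (by rw [← hr]; field_simp) a2 b3
  have e3 := ellGamma_mul_ellGamma hp hq hp0 hq0 (by rw [← hr]; field_simp) a3 b2
  have e4 := ellGamma_mul_ellGamma hp hq hp0 hq0 (by rw [← hr]; field_simp) a4 b1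
  rw [D, D, ellGamma4, ellGamma4]
  generalize ellGamma p q (r * s⁻¹ * u * w) = x1 at *
  generalize ellGamma p q (r * s⁻¹ * u * w⁻¹) = x2 at *
  generalize ellGamma p q (r * s⁻¹ * u⁻¹ * w) = x3 at *
  generalize ellGamma p q (r * s⁻¹ * u⁻¹ * w⁻¹) = x4 at *
  generalize ellGamma p q (r * s⁻¹⁻¹ * u * w) = y1 at *
  generalize ellGamma p q (r * s⁻¹⁻¹ * u * w⁻¹) = y2 at *
  generalize ellGamma p q (r * s⁻¹⁻¹ * u⁻¹ * w) = y3 at *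
  generalize ellGamma p q (r * s⁻¹⁻¹ * u⁻¹ * w⁻¹) = y4 at *
  calc x1 * x2 * (x3 * x4) * (y1 * y2 * (y3 * y4)) =
      (x1 * y4) * (x2 * y3) * (x3 * y2) * (x4 * y1) := by ring
    _ = 1 := by rw [e1, e2, e3, e4]; ring

lemma Contour.Separates.ne_zero {C : Contour} {S : Set ℂ} (h : C.Separates S) {a : ℂ}
    (ha : a ∈ S) : a ≠ 0 := by
  rintro rfl
  have h1 := (h.2 0 ha).1.2
  have h2 := (h.2 0 ha).2.2
  rw [inv_zero, h1] at h2
  exact one_ne_zero h2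

/-- A contour that separates the points `t i p^j q^k` from their reciprocals is a separating cycle. -/
lemma Cycle.Separates.of_contour (hp : ‖p‖ < 1) (hq : ‖q‖ < 1) {ι : Type*} {C : Contour}
    (h0 : C.Encloses 0) {t : ι → ℂ} (h : ∀ i (j k : ℕ), C.Encloses (t i * p ^ j * q ^ k) ∧
      C.Excludes (t i * p ^ j * q ^ k)⁻¹) :
    Cycle.Separates p q (Finsupp.single C 1) t := by
  refine ⟨Cycle.single_mem_inside (fun z hz => ?_) 1, ?_, fun i j k => ?_, fun i j k => ?_⟩
  · by_contra hz'
    obtain rfl | ⟨i, j, k, rfl | rfl⟩ := eq_of_notMem_sepDomain hp hq hz'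
    · exact h0.1 hz
    · exact (h i j k).1.1 hz
    · exact (h i j k).2.1 hz
  · rw [Cycle.winding_single, h0.2, mul_one]
  · rw [Cycle.winding_single, (h i j k).1.2, mul_one]
  · rw [Cycle.winding_single, (h i j k).2.2, mul_zero]

/-- The parameters of the beta integral in the proof of the Bailey lemma. -/
def baileyParams (r s t u w z : ℂ) : Fin 6 → ℂ :=
  ![s * w, s * w⁻¹, r * (s * t)⁻¹ * u, r * (s * t)⁻¹ * u⁻¹, t * z, t * z⁻¹]

lemma betaKernel_baileyParams (r s t u w z x : ℂ) :
    betaKernel p q (baileyParams r s t u w z) x =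
      x⁻¹ * weight p q (x ^ 2) * ellGamma4 p q s w x *
        (D p q r (s * t) u x * ellGamma4 p q t x z) := by
  rw [D, ellGamma4_comm t x z]
  simp only [betaKernel, betaIntegrand, ellGamma4_eq_gammaPair, baileyParams, Matrix.cons_val]
  ring

lemma betaValue_baileyParams {r s t : ℂ} (hs : s ≠ 0) (ht : t ≠ 0) {w z u : ℂ} (hw : w ≠ 0)
    (hz : z ≠ 0) (hu : u ≠ 0) :
    betaValue p q (baileyParams r s t u w z) =
      ellGamma p q (s ^ 2) * ellGamma p q (t ^ 2) * ellGamma p q ((r * (s * t)⁻¹) ^ 2) *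
        D p q r t u w * ellGamma4 p q (s * t) w z * D p q r s u z := by
  simp only [betaValue, betaProd, baileyParams, Matrix.cons_val, D, ellGamma4]
  have e1 : s * w * (s * w⁻¹) = s ^ 2 := by field_simp
  have e2 : r * (s * t)⁻¹ * u * (r * (s * t)⁻¹ * u⁻¹) = (r * (s * t)⁻¹) ^ 2 := by field_simp
  have e3 : t * z * (t * z⁻¹) = t ^ 2 := by field_simp
  have f : ∀ v x : ℂ, s * v * (r * (s * t)⁻¹ * x) = r * t⁻¹ * x * v := fun v x => by
    field_simp
  have g : ∀ v x : ℂ, s * v * (t * x) = s * t * v * x := fun v x => by ring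
  have h : ∀ v x : ℂ, r * (s * t)⁻¹ * v * (t * x) = r * s⁻¹ * v * x := fun v x => by
    field_simp
  simp only [e1, e2, e3, f, g, h]
  ring

/-- The Bailey lemma: with the definition of `β` inserted, the double integral is turned around and
the integral over `C'` is an elliptic beta integral. -/
theorem IsBaileyPair.step (hp : ‖p‖ < 1) (hq : ‖q‖ < 1) (hp0 : p ≠ 0) (hq0 : q ≠ 0) {r s t u : ℂ}
    (hr : r ^ 2 = p * q) {C C' : Contour} {α β : ℂ → ℂ}
    (hC'D : C'.Separates (poles p q (r * (s * t)⁻¹) u))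
    (hC'M : ∀ z ∈ C.trace, C'.Separates (poles p q t z))
    (hpair : IsBaileyPair p q C t C'.trace α β) :
    IsBaileyPair p q C (s * t) {w | MDefined p q C' s w ∧ DDefined p q r t⁻¹ u w}
      (fun z => D p q r s u z * α z)
      (fun w => D p q r t⁻¹ u w * M p q C' s (fun x => D p q r (s * t) u x * β x) w) := by
  obtain ⟨hα, hβ⟩ := hpair
  -- all parameters are nonzero, as `0` would be its own reciprocal
  obtain ⟨z₀, hz₀⟩ := C.trace_nonempty
  have ht : t ≠ 0 := by
    rintro rfl
    exact (hC'M z₀ hz₀).ne_zero ⟨0, 0, Or.inl rfl⟩ (by simp)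
  have hz0 : ∀ z ∈ C.trace, z ≠ 0 := by
    rintro z hz rfl
    exact (hC'M 0 hz).ne_zero ⟨0, 0, Or.inl rfl⟩ (by simp)
  have hu : u ≠ 0 := by
    rintro rfl
    exact hC'D.ne_zero ⟨0, 0, Or.inl rfl⟩ (by simp)
  have hs : s ≠ 0 := by
    rintro rfl
    exact hC'D.ne_zero ⟨0, 0, Or.inl rfl⟩ (by simp)
  have h0' := hC'D.1
  obtain ⟨x₀, hx₀⟩ := C'.trace_nonempty
  have h0 := (hβ x₀ hx₀).1.1.1
  -- `C'` separates the last four parameters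
  have hsep4 : ∀ z ∈ C.trace, Cycle.Separates p q (Finsupp.single C' 1)
      ![r * (s * t)⁻¹ * u, r * (s * t)⁻¹ * u⁻¹, t * z, t * z⁻¹] := by
    intro z hz
    refine Cycle.Separates.of_contour hp hq h0' fun i j k => ?_
    fin_cases i
    · exact hC'D.2 _ ⟨j, k, Or.inl rfl⟩
    · exact hC'D.2 _ ⟨j, k, Or.inr rfl⟩
    · exact (hC'M z hz).2 _ ⟨j, k, Or.inl rfl⟩
    · exact (hC'M z hz).2 _ ⟨j, k, Or.inr rfl⟩
  have hDcont : ContinuousOn (D p q r s u) C.trace := by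
    intro z hz
    have hne := (hsep4 z hz).mul_ne_one
    have hz' := hz0 z hz
    have hr0 : r ≠ 0 := by rintro rfl; exact mul_ne_zero hp0 hq0 (by rw [← hr]; ring)
    have key : ∀ a : ℂ, a ≠ 0 → (∀ j k : ℕ, r * (s * t)⁻¹ * a * (t * z) * p ^ j * q ^ k ≠ 1) →
        (∀ j k : ℕ, r * (s * t)⁻¹ * a * (t * z⁻¹) * p ^ j * q ^ k ≠ 1) →
        DifferentiableAt ℂ (fun z => gammaPair p q (r * s⁻¹ * a) z) z := by
      intro a ha h1 h2
      refine DifferentiableAt.gammaPair_comp hp hq (differentiableAt_const _) differentiableAt_id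
        (mul_ne_zero (mul_ne_zero hr0 (inv_ne_zero hs)) ha) hz' (fun h => ?_) fun h => ?_
      · obtain ⟨j, k, hjk⟩ := (dPoch_eq_zero_iff hp hq).1 h
        refine h1 j k ?_
        rw [← hjk]; field_simp
      · obtain ⟨j, k, hjk⟩ := (dPoch_eq_zero_iff hp hq).1 h
        refine h2 j k ?_
        rw [← hjk]; field_simp
    have h : DifferentiableAt ℂ (fun z => D p q r s u z) z := by
      simp only [D, ellGamma4_eq_gammaPair]
      exact (key u hu (hne 0 2) (hne 0 3)).mul (key u⁻¹ (inv_ne_zero hu) (hne 1 2) (hne 1 3))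
    exact h.continuousAt.continuousWithinAt
  refine ⟨C.integrable_mul hDcont hα, ?_⟩
  rintro w ⟨⟨hsw, hs2⟩, hDw⟩
  have hw : w ≠ 0 := by
    rintro rfl
    exact hsw.ne_zero ⟨0, 0, Or.inl rfl⟩ (by simp)
  have hsep : ∀ z ∈ C.trace,
      Cycle.Separates p q (Finsupp.single C' 1) (baileyParams r s t u w z) := by
    intro z hz
    refine Cycle.Separates.of_contour hp hq h0' fun i j k => ?_
    fin_cases i
    · exact hsw.2 _ ⟨j, k, Or.inl rfl⟩
    · exact hsw.2 _ ⟨j, k, Or.inr rfl⟩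
    · exact hC'D.2 _ ⟨j, k, Or.inl rfl⟩
    · exact hC'D.2 _ ⟨j, k, Or.inr rfl⟩
    · exact (hC'M z hz).2 _ ⟨j, k, Or.inl rfl⟩
    · exact (hC'M z hz).2 _ ⟨j, k, Or.inr rfl⟩
  have hprod : ∀ z ∈ C.trace, ∏ i, baileyParams r s t u w z i = p * q := by
    intro z hz
    have := hz0 z hz
    rw [Fin.prod_univ_six, ← hr]
    simp only [baileyParams, Matrix.cons_val]
    field_simp
  have hne := (hsep z₀ hz₀).mul_ne_one
  have hst2 : ∀ j k : ℕ, (s * t) ^ 2 ≠ p ^ (j + 1) * q ^ (k + 1) := by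
    intro j k h
    refine hne 2 3 j k ?_
    simp only [baileyParams, Matrix.cons_val]
    have h1 : r * (s * t)⁻¹ * u * (r * (s * t)⁻¹ * u⁻¹) * p ^ j * q ^ k =
        p ^ (j + 1) * q ^ (k + 1) / (s * t) ^ 2 := by
      rw [pow_succ p, pow_succ q, show p ^ j * p * (q ^ k * q) = r ^ 2 * p ^ j * q ^ k by
        rw [hr]; ring]
      field_simp
    rw [h1, ← h, div_self (pow_ne_zero 2 (mul_ne_zero hs ht))]
  have hMdef : MDefined p q C (s * t) w := by
    refine ⟨⟨h0, ?_⟩, hst2⟩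
    have key : ∀ b : ℂ, C'.Encloses b → C'.Excludes b⁻¹ →
        C.Encloses (t * b) ∧ C.Excludes (t * b)⁻¹ := by
      intro b hb hb'
      have hb0 : b ≠ 0 := by
        rintro rfl
        have := hb'.2
        rw [inv_zero, hb.2] at this
        exact one_ne_zero this
      have hnot : t * b ∉ C.trace := fun hz => by
        have := ((hC'M _ hz).2 (t * (t * b)⁻¹) ⟨0, 0, Or.inr (by simp)⟩).1.2
        rw [mul_inv, mul_inv_cancel_left₀ ht, hb'.2] at this
        exact zero_ne_one this
      have hnot' : (t * b)⁻¹ ∉ C.trace := fun hz => by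
        have := ((hC'M _ hz).2 (t * (t * b)⁻¹) ⟨0, 0, Or.inl (by simp)⟩).1.2
        rw [mul_inv, mul_inv_cancel_left₀ ht, hb'.2] at this
        exact zero_ne_one this
      refine ⟨⟨hnot, ?_⟩, hnot', ?_⟩
      · have := C.winding_mul C' (n := 1) (m := 0) ht (fun x hx =>
          ((hβ x hx).1.1.2 (t * x) ⟨0, 0, Or.inl (by simp)⟩).1) (fun z hz => ?_) hb.1 hnot
        · rwa [hb.2, sub_zero, mul_one, mul_one] at this
        · have := ((hC'M z hz).2 (t * z⁻¹) ⟨0, 0, Or.inr (by simp)⟩).2.2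
          rwa [mul_inv, inv_inv, mul_comm, ← div_eq_mul_inv] at this
      · exact C.winding_inv_mul C' ht hb0 h0.1 h0'.1 (fun x hx =>
          ((hβ x hx).1.1.2 (t * x) ⟨0, 0, Or.inl (by simp)⟩).2) (fun z hz =>
          ((hC'M z hz).2 (t * z) ⟨0, 0, Or.inl (by simp)⟩).2.2) hb.1 hb.2 hnot'
    rintro _ ⟨j, k, rfl | rfl⟩
    · have h := hsw.2 (s * w * p ^ j * q ^ k) ⟨j, k, Or.inl rfl⟩
      have := key _ h.1 h.2
      rwa [show t * (s * w * p ^ j * q ^ k) = s * t * w * p ^ j * q ^ k by ring] at this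
    · have h := hsw.2 (s * w⁻¹ * p ^ j * q ^ k) ⟨j, k, Or.inr rfl⟩
      have := key _ h.1 h.2
      rwa [show t * (s * w⁻¹ * p ^ j * q ^ k) = s * t * w⁻¹ * p ^ j * q ^ k by ring] at this
  refine ⟨hMdef, ?_⟩
  -- the gamma functions in the denominators are finite and nonzero
  have hΓ : ∀ a b v : ℂ, a * b = v ^ 2 → (∀ j k : ℕ, a * b * p ^ j * q ^ k ≠ 1) →
      (∀ j k : ℕ, v ^ 2 ≠ p ^ (j + 1) * q ^ (k + 1)) → v ≠ 0 → ellGamma p q (v ^ 2) ≠ 0 := by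
    intro a b v hab h1 h2 hv
    rw [ellGamma_eq hp hq]
    refine div_ne_zero (fun h => ?_) fun h => ?_
    · obtain ⟨j, k, hjk⟩ := (dPoch_eq_zero_iff hp hq).1 h
      refine h2 j k ?_
      field_simp at hjk
      rw [← hjk]; ring
    · obtain ⟨j, k, hjk⟩ := (dPoch_eq_zero_iff hp hq).1 h
      exact h1 j k (by rw [hab, hjk])
  have hz₀' := hz0 z₀ hz₀
  have hΓs : ellGamma p q (s ^ 2) ≠ 0 :=
    hΓ (s * w) (s * w⁻¹) s (by field_simp) (hne 0 1) hs2 hs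
  have hΓt : ellGamma p q (t ^ 2) ≠ 0 :=
    hΓ (t * z₀) (t * z₀⁻¹) t (by field_simp) (hne 4 5) (hβ x₀ hx₀).1.2 ht
  have hΓst : ellGamma p q ((r * (s * t)⁻¹) ^ 2) = (ellGamma p q ((s * t) ^ 2))⁻¹ := by
    refine eq_inv_of_mul_eq_one_left (ellGamma_mul_ellGamma hp hq hp0 hq0 ?_ (fun h => ?_)
      fun h => ?_)
    · rw [← hr]; field_simp
    · obtain ⟨j, k, hjk⟩ := (dPoch_eq_zero_iff hp hq).1 h
      refine hne 2 3 j k ?_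
      simp only [baileyParams, Matrix.cons_val]
      rw [← hjk]; field_simp
    · obtain ⟨j, k, hjk⟩ := (dPoch_eq_zero_iff hp hq).1 h
      have h1 := hMdef.1.2 (s * t * w * p ^ j * q ^ k) ⟨j, k, Or.inl rfl⟩
      have h2 := hMdef.1.2 (s * t * w⁻¹) ⟨0, 0, Or.inr (by simp)⟩
      have h3 : s * t * w * p ^ j * q ^ k = (s * t * w⁻¹)⁻¹ :=
        eq_inv_of_mul_eq_one_left (by rw [← hjk]; field_simp)
      have h4 := h1.1.2
      rw [h3, h2.2.2] at h4
      exact zero_ne_one h4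
  have hD1 : D p q r t⁻¹ u w * D p q r t u w = 1 := by
    have hmul : ∀ v x : ℂ, ∀ j k : ℕ, s * v * (r * (s * t)⁻¹ * x) * p ^ j * q ^ k =
        r * t⁻¹ * x * p ^ j * q ^ k * v := fun v x j k => by field_simp
    have hDt : DDefined p q r t u w := by
      refine ⟨?_, ?_⟩
      · rintro ⟨j, k, h | h⟩
        · exact hne 1 2 j k ((hmul _ _ _ _).trans (by rw [← h, mul_inv_cancel₀ hw]))
        · exact hne 1 3 j k ((hmul _ _ _ _).trans (by rw [← h, mul_inv_cancel₀ hw]))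
      · rintro ⟨j, k, h | h⟩
        · exact hne 0 2 j k ((hmul _ _ _ _).trans (by rw [← h, inv_mul_cancel₀ hw]))
        · exact hne 0 3 j k ((hmul _ _ _ _).trans (by rw [← h, inv_mul_cancel₀ hw]))
    have := D_mul_D_inv hp hq hp0 hq0 hr ht hu hw hDt hDw
    rwa [mul_comm] at this
  set κ : ℂ := qPoch p p * qPoch q q / (4 * Real.pi * Complex.I) with hκ
  have hP : qPoch p p * qPoch q q ≠ 0 :=
    mul_ne_zero (qPoch_ne_zero_of_norm_lt hp hp) (qPoch_ne_zero_of_norm_lt hq hq)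
  have hκ0 : κ ≠ 0 := div_ne_zero hP (by simp [Real.pi_ne_zero])
  have hκ' : 4 * Real.pi * Complex.I / (qPoch p p * qPoch q q) = κ⁻¹ := by rw [hκ, inv_div]
  -- the double integral, evaluated by Fubini's theorem and the elliptic beta integral
  have hdouble : C'.integral (fun x => C.integral fun z =>
      betaKernel p q (baileyParams r s t u w z) x * (z⁻¹ * weight p q (z ^ 2) * α z)) =
      C.integral fun z => κ⁻¹ * betaValue p q (baileyParams r s t u w z) *
        (z⁻¹ * weight p q (z ^ 2) * α z) := by
    have hweight : ContinuousOn (fun z => z⁻¹ * weight p q (z ^ 2)) C.trace := by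
      intro z hz
      have h := DifferentiableAt.weight_sq_comp hp hq (x := z) differentiableAt_id (hz0 z hz)
      exact ((continuousAt_inv₀ (hz0 z hz)).mul h.continuousAt).continuousWithinAt
    rw [C.integral_comm C' ?_ (C.integrable_mul hweight hα)]
    · refine C.integral_congr fun z hz => ?_
      have := (hsep z hz).integral_betaKernel hp hq hp0 hq0 (hprod z hz)
      rw [Cycle.integral_single, one_mul, hκ'] at this
      rw [← this]
    · rintro ⟨x, z⟩ ⟨hx, hz⟩
      have hx := Cycle.mem_inside.1 (hsep z hz).mem_inside C' (by simp) hx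
      have h : DifferentiableAt ℂ (fun v : ℂ × ℂ =>
          betaKernel p q (baileyParams r s t u w v.2) v.1) (x, z) := by
        refine differentiableAt_betaKernel hp hq (t := fun v : ℂ × ℂ => baileyParams r s t u w v.2)
          (ζ := fun v => v.1) (fun i => ?_) differentiableAt_fst (fun i => ?_) hx
        · have hinv : DifferentiableAt ℂ (fun v : ℂ × ℂ => v.2⁻¹) (x, z) :=
            (differentiableAt_inv (x := (x, z).2) (hz0 z hz)).comp (x, z) differentiableAt_snd
          fin_cases i
          · exact differentiableAt_const _
          · exact differentiableAt_const _
          · exact differentiableAt_const _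
          · exact differentiableAt_const _
          · exact differentiableAt_snd.const_mul t
          · exact hinv.const_mul t
        · intro h
          have h2 := hprod z hz
          rw [Finset.prod_eq_zero (Finset.mem_univ i) h] at h2
          exact mul_ne_zero hp0 hq0 h2.symm
      exact h.continuousAt.continuousWithinAt
  have hL : M p q C' s (fun x => D p q r (s * t) u x * β x) w =
      κ * ((ellGamma p q (s ^ 2))⁻¹ * (κ * (ellGamma p q (t ^ 2))⁻¹ *
        C'.integral (fun x => C.integral fun z =>
          betaKernel p q (baileyParams r s t u w z) x * (z⁻¹ * weight p q (z ^ 2) * α z)))) := by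
    rw [M_eq hp hq, ← C'.integral_const_mul (κ * (ellGamma p q (t ^ 2))⁻¹)]
    congr 2
    refine C'.integral_congr fun x hx => ?_
    rw [(hβ x hx).2, M_eq hp hq, ← hκ]
    simp only [← Contour.integral_const_mul]
    congr 1
    ext z
    rw [betaKernel_baileyParams]
    ring
  simp only
  rw [hL, hdouble, M_eq hp hq, ← hκ]
  simp only [← Contour.integral_const_mul]
  refine C.integral_congr fun z hz => ?_
  have hcancel : ∀ x y c e : ℂ, x ≠ 0 → y ≠ 0 →
      κ * (x⁻¹ * (κ * y⁻¹ * (κ⁻¹ * (x * y * c) * e))) = κ * c * e := by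
    intro x y c e hx hy
    field_simp
  have h1 := hcancel _ _ ((ellGamma p q ((s * t) ^ 2))⁻¹ * D p q r t u w *
    ellGamma4 p q (s * t) w z * D p q r s u z) (z⁻¹ * weight p q (z ^ 2) * α z) hΓs hΓt
  rw [betaValue_baileyParams hs ht hw (hz0 z hz) hu, hΓst]
  linear_combination D p q r t⁻¹ u w * h1 + κ * ((ellGamma p q ((s * t) ^ 2))⁻¹ *
    ellGamma4 p q (s * t) w z * D p q r s u z) * (z⁻¹ * weight p q (z ^ 2) * α z) * hD1

end EllipticBailey

end

theorem theorem2 (p q r s t u : ℂ)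
    (hp0 : p ≠ 0) (hq0 : q ≠ 0) (hp : ‖p‖ < 1) (hq : ‖q‖ < 1) (hr : r ^ 2 = p * q)
    (C C' : EllipticBailey.Contour) (α β : ℂ → ℂ)
    (hC'D : C'.Separates (EllipticBailey.poles p q (r * (s * t)⁻¹) u))
    (hC'M : ∀ z ∈ C.trace, C'.Separates (EllipticBailey.poles p q t z))
    (hpair : EllipticBailey.IsBaileyPair p q C t C'.trace α β) :
    EllipticBailey.IsBaileyPair p q C (s * t)
        {w | EllipticBailey.MDefined p q C' s w ∧ EllipticBailey.DDefined p q r t⁻¹ u w}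
        (fun z => EllipticBailey.D p q r s u z * α z)
        (fun w => EllipticBailey.D p q r t⁻¹ u w *
          EllipticBailey.M p q C' s (fun x => EllipticBailey.D p q r (s * t) u x * β x) w) ∧
      ∀ s₁ u₁ w₁ : ℂ, s₁ ≠ 0 → u₁ ≠ 0 → w₁ ≠ 0 →
        EllipticBailey.DDefined p q r s₁ u₁ w₁ → EllipticBailey.DDefined p q r s₁⁻¹ u₁ w₁ →
          EllipticBailey.D p q r s₁ u₁ w₁ * EllipticBailey.D p q r s₁⁻¹ u₁ w₁ = 1 :=
  ⟨EllipticBailey.IsBaileyPair.step hp hq hp0 hq0 hr hC'D hC'M hpair,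
    fun _ _ _ hs hu hw h1 h2 => EllipticBailey.D_mul_D_inv hp hq hp0 hq0 hr hs hu hw h1 h2⟩
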